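/- **Theorem.** Probabilistic independence logic with Boolean negation, $\mathrm{FO}(\perp\!\!\!\perp_{\mathrm c},\sim)$, and second-order logic over $\mathbb R$-structures, $\mathrm{SO}_{\mathbb R}(+,\times)$, are equally expressive, both for sentences and for formulas. *Setting.* Let $\tau$ be a finite relational vocabulary (with equality); structures $\mathcal A$ are finite with nonempty domain $A$. For a finite set $D$ of variables, a *distribution over $D$* is a function $\mathbb X$ that assigns to each assignment $s\colon D\to A$ a weight $\mathbb X(s)\ge 0$ such that the weights sum to $1$. Write $|\mathbb X_{\vec x=\vec a}|$ for the sum of $\mathbb X(s)$ over all $s$ with $s(\vec x)=\vec a$, and $s(a/x)$ for the assignment on $D\cup\{x\}$ that maps $x$ to $a$ and agrees with $s$ elsewhere. For a function $F$ from assignments to probability distributions on $A$, $\mathbb X(F/x)$ is the distribution over $D\cup\{x\}$ with $\mathbb X(F/x)(s')=\sum_{(t,a):\,t(a/x)=s'}\mathbb X(t)\cdot F(t)(a)$; and $\mathbb X(A/x)$ is $\mathbb X(F/x)$ with every $F(t)$ uniform on $A$. *The logic $\mathrm{FO}(\perp\!\!\!\perp_{\mathrm c},\sim)$* has the formulas $$\phi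 ::= \lambda\mid\neg\lambda\mid \vec y\perp\!\!\!\perp_{\vec x}\vec z\mid{\sim}\phi\mid(\phi\wedge\phi)\mid(\phi\vee\phi)\mid\exists x\phi\mid\forall x\phi ,$$ where $\lambda$ is $x=y$ or $R(\vec x)$ with $R\in\tau$. Satisfaction $\mathcal A\models_{\mathbb X}\phi$ by a distribution is defined as follows. A literal holds iff every $s$ with $\mathbb X(s)\ne0$ satisfies it. The atom $\vec y\perp\!\!\!\perp_{\vec x}\vec z$ holds iff $|\mathbb X_{\vec x\vec y=\vec a\vec b}|\cdot|\mathbb X_{\vec x\vec z=\vec a\vec c}|=|\mathbb X_{\vec x\vec y\vec z=\vec a\vec b\vec c}|\cdot|\mathbb X_{\vec x=\vec a}|$ for all values $\vec a\vec b\vec c=t(\vec x\vec y\vec z)$, where $t$ is an assignment of the variables of the atom. ${\sim}\phi$ holds iff $\phi$ does not; $\wedge$ is conjunction. $\phi\vee\psi$ holds iff $\mathbb X=k\mathbb Y+(1-k)\mathbb Z$ for some $k\in[0,1]$ and distributions $\mathbb Y,\mathbb Z$ over the same variables with $\mathcal A\models_{\mathbb Y}\phi$ and $\mathcal A\models_{\mathbb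 Z}\psi$. $\exists x\phi$ holds iff $\mathcal A\models_{\mathbb X(F/x)}\phi$ for some $F$; $\forall x\phi$ holds iff $\mathcal A\models_{\mathbb X(A/x)}\phi$. For a sentence, $\mathcal A\models\phi$ means satisfaction by the distribution giving weight $1$ to the empty assignment. The theorem holds for this clause for $\vee$, and also for the variant in which a component with scaling factor $0$ counts as the empty team, which satisfies every disjunct (so that $\mathcal A\models_{\mathbb Y}\phi$ is required only if $k\ne0$, and $\mathcal A\models_{\mathbb Z}\psi$ only if $k\neq 1$). *The logic $\mathrm{SO}_{\mathbb R}(+,\times)$* has function variables $f$ with arities, numerical terms $i::=f(\vec x)\mid i+i\mid i\times i$, and formulas $$\psi::= i=j\mid\neg\, i=j\mid\lambda\mid\neg\lambda\mid(\psi\wedge\psi)\mid(\psi\vee\psi)\mid\exists x\psi\mid\forall x\psi\mid\exists f\psi\mid\forall f\psi ,$$ with the usual Tarski semantics, where first-order variables range over $A$ and an $n$-ary function variable ranges over all functions $A^n\to\mathbb R$. *Claim.* 1. (Sentences) For every sentence $\phi$ of $\mathrm{FO}(\perp\!\!\!\perp_{\mathrm c},\sim)$ there is a sentence $\psi$ of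 $\mathrm{SO}_{\mathbb R}(+,\times)$, and for every sentence $\psi$ there is a sentence $\phi$, such that $\mathcal A\models\phi\iff\mathcal A\models\psi$ for all $\mathcal A$. 2. (Formulas) Let $\vec v=(v_1,\dots,v_k)$ be a tuple of distinct variables and $f$ a $k$-ary function variable. For every formula $\phi$ of $\mathrm{FO}(\perp\!\!\!\perp_{\mathrm c},\sim)$ with free variables among $\vec v$ there is a formula $\psi$ of $\mathrm{SO}_{\mathbb R}(+,\times)$ without free first-order variables and with $f$ as its only free function variable, such that for all $\mathcal A$ and all distributions $\mathbb X$ over $\{v_1,\dots,v_k\}$, $$\mathcal A\models_{\mathbb X}\phi\iff(\mathcal A,f_{\mathbb X})\models\psi ,\qquad\text{where } f_{\mathbb X}(s(\vec v))=\mathbb X(s)\text{ for all } s.$$ Conversely, for every formula $\psi$ of $\mathrm{SO}_{\mathbb R}(+,\times)$ without free first-order variables and with no free function variable other than $f$, there is a formula $\phi$ of $\mathrm{FO}(\perp\!\!\!\perp_{\mathrm c},\sim)$ with free variables among $\vec v$ for which the same equivalence holds for all $\mathcal A$ and $\mathbb X$. -/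

import Mathlib

universe u v w

namespace ProbTeam

/-! ### Probabilistic teams

First-order variables are natural numbers.  A probabilistic team over a finite set `D` of
variables with values in `A` is a weight function on all assignments `D → A`
(zero weights are allowed). -/

/-- Assignments of `A` for the finite set of variables `D`. -/
abbrev Assignment (D : Finset ℕ) (A : Type w) := D → A

/-- Weight functions on the set of all assignments `D → A`. -/
abbrev Team (D : Finset ℕ) (A : Type w) := Assignment D A → ℝ

/-- Probability distributions on a finite set. -/
def IsDistribution {B : Type*} [Fintype B] (d : B → ℝ) : Prop :=
  (∀ b, 0 ≤ d b) ∧ ∑ b, d b = 1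

/-- The value of the variable `x` under `s`; only used for `x ∈ D`
(variables outside `D` get an arbitrary value). -/
noncomputable def Assignment.val {A : Type w} [Nonempty A] {D : Finset ℕ}
    (s : Assignment D A) (x : ℕ) : A :=
  if h : x ∈ D then s ⟨x, h⟩ else Classical.arbitrary A

/-- The modified assignment `s(a/x)` with domain `D ∪ {x}`. -/
noncomputable def Assignment.modify {A : Type w} [Nonempty A] {D : Finset ℕ}
    (s : Assignment D A) (x : ℕ) (a : A) : Assignment (insert x D) A :=
  fun y => if (y : ℕ) = x then a else s.val y

open Classical in
/-- `|X_{x = a}|`: the total weight of the assignments that map the tuple `x` to `a`. -/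
noncomputable def Team.weight {A : Type w} [Fintype A] [Nonempty A] {D : Finset ℕ}
    (X : Team D A) (x : List ℕ) (a : List A) : ℝ :=
  ∑ s : Assignment D A, if x.map s.val = a then X s else 0

open Classical in
/-- The team `X(F/x)`: the weight of an assignment `s'` of `D ∪ {x}` is the sum of
`X t * F t a` over all `t` and `a` with `t(a/x) = s'`. -/
noncomputable def Team.supplement {A : Type w} [Fintype A] [Nonempty A] {D : Finset ℕ}
    (X : Team D A) (x : ℕ) (F : Assignment D A → A → ℝ) : Team (insert x D) A :=
  fun s' => ∑ t : Assignment D A, ∑ a : A, if t.modify x a = s' then X t * F t a else 0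

/-- The team `X(A/x)`. -/
noncomputable def Team.duplicate {A : Type w} [Fintype A] [Nonempty A] {D : Finset ℕ}
    (X : Team D A) (x : ℕ) : Team (insert x D) A :=
  X.supplement x fun _ _ => 1 / (Fintype.card A : ℝ)

/-- The `k`-scaled union of two teams. -/
def Team.scaledUnion {A : Type w} {D : Finset ℕ} (k : ℝ) (Y Z : Team D A) : Team D A :=
  fun s => k * Y s + (1 - k) * Z s

/-- The team over the empty set of variables giving weight 1 to the empty assignment. -/
def Team.trivial (A : Type w) : Team ∅ A := fun _ => 1

/-! ### Probabilistic independence logic with Boolean negation -/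

/-- Formulas of `FO(⊥⊥_c, ∼)` over the relational vocabulary `L` (with equality).
`indep x y z` is the atom "`y` and `z` are independent given `x`". -/
inductive TeamFormula (L : FirstOrder.Language.{u, v}) : Type v
  | eq (x y : ℕ) : TeamFormula L
  | neq (x y : ℕ) : TeamFormula L
  | rel {n : ℕ} (R : L.Relations n) (x : Fin n → ℕ) : TeamFormula L
  | nrel {n : ℕ} (R : L.Relations n) (x : Fin n → ℕ) : TeamFormula L
  | indep (x y z : List ℕ) : TeamFormula L
  | bneg (φ : TeamFormula L) : TeamFormula L
  | and (φ ψ : TeamFormula L) : TeamFormula L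
  | or (φ ψ : TeamFormula L) : TeamFormula L
  | ex (x : ℕ) (φ : TeamFormula L) : TeamFormula L
  | all (x : ℕ) (φ : TeamFormula L) : TeamFormula L

/-- The free variables of a formula. -/
def TeamFormula.freeVars {L : FirstOrder.Language.{u, v}} : TeamFormula L → Finset ℕ
  | eq x y => {x, y}
  | neq x y => {x, y}
  | rel _ x => Finset.univ.image x
  | nrel _ x => Finset.univ.image x
  | indep x y z => (x ++ y ++ z).toFinset
  | bneg φ => φ.freeVars
  | and φ ψ => φ.freeVars ∪ ψ.freeVars
  | or φ ψ => φ.freeVars ∪ ψ.freeVars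
  | ex x φ => φ.freeVars.erase x
  | all x φ => φ.freeVars.erase x

/-- How a component of weight zero in a scaled union is treated in the clause for `∨`:
either both components have to be distributions satisfying their disjunct (`strict`), or a
component with scaling factor zero is the empty team, which satisfies every disjunct
(`vacuous`). -/
inductive SplitConvention : Type
  | strict : SplitConvention
  | vacuous : SplitConvention

/-- The requirement on a component with scaling factor `k`, where `P` says that the component
satisfies its disjunct. -/
def SplitConvention.part (c : SplitConvention) (k : ℝ) (P : Prop) : Prop :=
  match c with
  | strict => P
  | vacuous => k = 0 ∨ P

/-- Team semantics: `φ.Sat c D X` is satisfaction of `φ` by the distribution `X` over `D`.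
In the clause for `indep`, only the values of `t` on the variables of the atom matter. -/
def TeamFormula.Sat {L : FirstOrder.Language.{u, v}} (c : SplitConvention)
    {A : Type w} [Fintype A] [Nonempty A] [L.Structure A] :
    TeamFormula L → (D : Finset ℕ) → Team D A → Prop
  | eq x y, _, X => ∀ s, X s ≠ 0 → s.val x = s.val y
  | neq x y, _, X => ∀ s, X s ≠ 0 → s.val x ≠ s.val y
  | rel R x, _, X => ∀ s, X s ≠ 0 →
      FirstOrder.Language.Structure.RelMap R fun i => s.val (x i)
  | nrel R x, _, X => ∀ s, X s ≠ 0 →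
      ¬ FirstOrder.Language.Structure.RelMap R fun i => s.val (x i)
  | indep x y z, _, X => ∀ t : ℕ → A,
      X.weight (x ++ y) ((x ++ y).map t) * X.weight (x ++ z) ((x ++ z).map t) =
        X.weight (x ++ y ++ z) ((x ++ y ++ z).map t) * X.weight x (x.map t)
  | bneg φ, D, X => ¬ φ.Sat c D X
  | and φ ψ, D, X => φ.Sat c D X ∧ ψ.Sat c D X
  | or φ ψ, D, X => ∃ (k : ℝ) (Y Z : Team D A), 0 ≤ k ∧ k ≤ 1 ∧
      IsDistribution Y ∧ IsDistribution Z ∧ Team.scaledUnion k Y Z = X ∧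
      c.part k (φ.Sat c D Y) ∧ c.part (1 - k) (ψ.Sat c D Z)
  | ex x φ, D, X => ∃ F : Assignment D A → A → ℝ, (∀ s, IsDistribution (F s)) ∧
      φ.Sat c (insert x D) (X.supplement x F)
  | all x φ, D, X => φ.Sat c (insert x D) (X.duplicate x)

/-! ### Second-order logic over `ℝ`-structures

A function variable of arity `n` is a pair `(n, f)` with name `f : ℕ`. -/

/-- Numerical terms built from function variables by `+` and `×`. -/
inductive NumTerm : Type
  | app (n f : ℕ) (x : Fin n → ℕ) : NumTerm
  | add (i j : NumTerm) : NumTerm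
  | mul (i j : NumTerm) : NumTerm

/-- Formulas of `SO_ℝ(+, ×)` over the relational vocabulary `L` (with equality). -/
inductive SOFormula (L : FirstOrder.Language.{u, v}) : Type v
  | numEq (i j : NumTerm) : SOFormula L
  | numNeq (i j : NumTerm) : SOFormula L
  | eq (x y : ℕ) : SOFormula L
  | neq (x y : ℕ) : SOFormula L
  | rel {n : ℕ} (R : L.Relations n) (x : Fin n → ℕ) : SOFormula L
  | nrel {n : ℕ} (R : L.Relations n) (x : Fin n → ℕ) : SOFormula L
  | and (φ ψ : SOFormula L) : SOFormula L
  | or (φ ψ : SOFormula L) : SOFormula L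
  | ex (x : ℕ) (φ : SOFormula L) : SOFormula L
  | all (x : ℕ) (φ : SOFormula L) : SOFormula L
  | exFun (n f : ℕ) (φ : SOFormula L) : SOFormula L
  | allFun (n f : ℕ) (φ : SOFormula L) : SOFormula L

/-- First-order variables of a numerical term. -/
def NumTerm.vars : NumTerm → Finset ℕ
  | app _ _ x => Finset.univ.image x
  | add i j => i.vars ∪ j.vars
  | mul i j => i.vars ∪ j.vars

/-- Function variables of a numerical term. -/
def NumTerm.funs : NumTerm → Finset (ℕ × ℕ)
  | app n f _ => {(n, f)}
  | add i j => i.funs ∪ j.funs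
  | mul i j => i.funs ∪ j.funs

/-- Free first-order variables of a formula. -/
def SOFormula.freeVars {L : FirstOrder.Language.{u, v}} : SOFormula L → Finset ℕ
  | numEq i j => i.vars ∪ j.vars
  | numNeq i j => i.vars ∪ j.vars
  | eq x y => {x, y}
  | neq x y => {x, y}
  | rel _ x => Finset.univ.image x
  | nrel _ x => Finset.univ.image x
  | and φ ψ => φ.freeVars ∪ ψ.freeVars
  | or φ ψ => φ.freeVars ∪ ψ.freeVars
  | ex x φ => φ.freeVars.erase x
  | all x φ => φ.freeVars.erase x
  | exFun _ _ φ => φ.freeVars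
  | allFun _ _ φ => φ.freeVars

/-- Free function variables of a formula. -/
def SOFormula.freeFuns {L : FirstOrder.Language.{u, v}} : SOFormula L → Finset (ℕ × ℕ)
  | numEq i j => i.funs ∪ j.funs
  | numNeq i j => i.funs ∪ j.funs
  | eq _ _ => ∅
  | neq _ _ => ∅
  | rel _ _ => ∅
  | nrel _ _ => ∅
  | and φ ψ => φ.freeFuns ∪ ψ.freeFuns
  | or φ ψ => φ.freeFuns ∪ ψ.freeFuns
  | ex _ φ => φ.freeFuns
  | all _ φ => φ.freeFuns
  | exFun n f φ => φ.freeFuns.erase (n, f)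
  | allFun n f φ => φ.freeFuns.erase (n, f)

/-- Interpretations of all function variables by real-valued functions on tuples from `A`.
A finite structure `A` with such an interpretation is an `ℝ`-structure; a formula only sees
the interpretations of its free function variables. -/
abbrev FunInterp (A : Type w) := (n : ℕ) → ℕ → (Fin n → A) → ℝ

/-- Reinterpret the `n`-ary function variable `f` as `g`. -/
def FunInterp.update {A : Type w} (E : FunInterp A) (n f : ℕ) (g : (Fin n → A) → ℝ) :
    FunInterp A :=
  Function.update E n (Function.update (E n) f g)

/-- The value of a numerical term. -/
def NumTerm.eval {A : Type w} (E : FunInterp A) (s : ℕ → A) : NumTerm → ℝ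
  | app n f x => E n f fun i => s (x i)
  | add i j => i.eval E s + j.eval E s
  | mul i j => i.eval E s * j.eval E s

/-- Tarski semantics of `SO_ℝ(+, ×)`; function variables range over all functions
`(Fin n → A) → ℝ`. -/
def SOFormula.Sat {L : FirstOrder.Language.{u, v}} {A : Type w} [L.Structure A] :
    SOFormula L → FunInterp A → (ℕ → A) → Prop
  | numEq i j, E, s => i.eval E s = j.eval E s
  | numNeq i j, E, s => i.eval E s ≠ j.eval E s
  | eq x y, _, s => s x = s y
  | neq x y, _, s => s x ≠ s y
  | rel R x, _, s => FirstOrder.Language.Structure.RelMap R fun i => s (x i)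
  | nrel R x, _, s => ¬ FirstOrder.Language.Structure.RelMap R fun i => s (x i)
  | and φ ψ, E, s => φ.Sat E s ∧ ψ.Sat E s
  | or φ ψ, E, s => φ.Sat E s ∨ ψ.Sat E s
  | ex x φ, E, s => ∃ a : A, φ.Sat E (Function.update s x a)
  | all x φ, E, s => ∀ a : A, φ.Sat E (Function.update s x a)
  | exFun n f φ, E, s => ∃ g : (Fin n → A) → ℝ, φ.Sat (E.update n f g) s
  | allFun n f φ, E, s => ∀ g : (Fin n → A) → ℝ, φ.Sat (E.update n f g) s

/-! ### Comparison of the two logics -/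

/-- A team sentence `φ` and a second-order sentence `ψ` are true in the same finite nonempty
structures.  (A sentence `ψ` does not depend on `E` and `s`.) -/
def EquivSentences {L : FirstOrder.Language.{u, v}} (c : SplitConvention)
    (φ : TeamFormula L) (ψ : SOFormula L) : Prop :=
  ∀ (A : Type w) [Fintype A] [Nonempty A] [L.Structure A] (E : FunInterp A) (s : ℕ → A),
    φ.Sat c ∅ (Team.trivial A) ↔ ψ.Sat E s

/-- For all finite nonempty structures `A` and all distributions `X` over the variables
`v 0, …, v (k - 1)`, the team `X` satisfies `φ` iff `(A, f_X)` satisfies `ψ`, where `f_X` is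
the interpretation of the `k`-ary function variable `f` given by `f_X(s(v)) = X(s)`. -/
def EquivFormulas {L : FirstOrder.Language.{u, v}} (c : SplitConvention) {k : ℕ}
    (v : Fin k ↪ ℕ) (f : ℕ) (φ : TeamFormula L) (ψ : SOFormula L) : Prop :=
  ∀ (A : Type w) [Fintype A] [Nonempty A] [L.Structure A]
    (X : Team (Finset.univ.map v) A), IsDistribution X →
    ∀ (E : FunInterp A) (s : ℕ → A),
      (∀ t : Assignment (Finset.univ.map v) A, E k f (fun i => t.val (v i)) = X t) →
      (φ.Sat c (Finset.univ.map v) X ↔ ψ.Sat E s)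

end ProbTeam

/-! From team logic to second-order logic, a distribution over a finite set `D` of variables is
stored in a function variable of arity `D.card`, and the clauses of team semantics are written out
by recursion on the formula (`TeamFormula.exists_soFormula`). These clauses speak of sums of
weights, whereas numerical terms contain no summation over the domain. `SOFormula.marginal` supplies
it: one quantifies a permutation `π` of the assignments and a function `R` with `R(π a) = R(a) +
w(a)`, except that at a single assignment `d` the candidate value `g` is subtracted on the right.
Adding all equations cancels `R` and leaves `g = ∑ w`; conversely, a cyclic permutation and its
partial sums solve them. Nonnegative numbers are squares. The kernel `F` in the clause for `∃` need
not be quantified: the teams `X(F/x)` are the nonnegative ones with the marginals of `X` off `x`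
(`exists_supplement_eq`), and `X(A/x)` is the one among them that does not distinguish the values of
`x` (`Team.eq_duplicate_iff`).

In the other direction, consider first a structure with two distinct elements, named by constant
variables. An element is represented by a constant variable, which is a variable independent of
itself. A function `h` is represented by a block of fresh variables, consisting of a tag and
arguments, with `h(a) = (P(pos, a) - P(neg, a)) / P(den)`; the division lets probabilities code
arbitrary reals. After clearing denominators, the equations `r = r₁ + r₂`, `r = r₁ * r₂` and `r =
f(x)` become equalities between two probabilities: independence of blocks turns products into
conjunctions, and incompatibility of tags turns sums into disjunctions. Equality of `P(α)` and
`P(β)` is itself an independence statement (`TeamFormula.sat_probEq`): draw `q` uniformly and let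
`m` record the truth of `α` if `q` is one fixed element and of `β` otherwise; then `m` and `q` are
independent iff the probabilities coincide. Boolean negation provides disjunction, universal
quantifiers and inequality of numbers. `SOFormula.sat_toTeam` is the resulting induction, with
invariant `Team.Represents`.

Two points remain. The given team has to be coded by a block itself, for which one more uniform
variable suffices (`Team.codes_teamBlock`). In one-element structures there are no distinct
constants; there, however, the only distribution has weight one, and a finite vocabulary admits
finitely many such structures up to isomorphism, so the ones satisfying the sentence can be listed.
-/

set_option linter.unusedSectionVars false

namespace ProbTeam

open scoped Classical

/-! ### Probabilities of events in a team -/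

section Basics

variable {A : Type w} [Fintype A] [Nonempty A] {D D' : Finset ℕ}

/-- The restriction of a total assignment to `D`. -/
def Assignment.ofFun (D : Finset ℕ) (s : ℕ → A) : Assignment D A := fun y => s y

theorem Assignment.val_ofFun {s : ℕ → A} {x : ℕ} (hx : x ∈ D) :
    (Assignment.ofFun D s).val x = s x := by
  simp [Assignment.val, Assignment.ofFun, hx]

theorem Assignment.ofFun_val (s : Assignment D A) : Assignment.ofFun D s.val = s := by
  funext y
  simp [Assignment.val, Assignment.ofFun]

theorem Assignment.ofFun_eq_iff {u : ℕ → A} {s : Assignment D A} :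
    Assignment.ofFun D u = s ↔ ∀ x ∈ D, u x = s.val x := by
  constructor
  · rintro rfl x hx
    rw [Assignment.val_ofFun hx]
  · intro h
    rw [← Assignment.ofFun_val s]
    funext y
    exact h y y.2

theorem Assignment.ext_val {s t : Assignment D A} (h : ∀ x ∈ D, s.val x = t.val x) : s = t := by
  rw [← Assignment.ofFun_val s]
  exact Assignment.ofFun_eq_iff.2 h

theorem Assignment.val_of_notMem {s : Assignment D A} {x : ℕ} (hx : x ∉ D) :
    s.val x = Classical.arbitrary A := by
  simp [Assignment.val, hx]

theorem Assignment.modify_eq_ofFun (s : Assignment D A) (x : ℕ) (a : A) :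
    s.modify x a = Assignment.ofFun (insert x D) (Function.update s.val x a) := by
  funext y
  simp [Assignment.modify, Assignment.ofFun, Function.update_apply]

theorem Assignment.val_modify (s : Assignment D A) (x : ℕ) (a : A) :
    (s.modify x a).val = Function.update s.val x a := by
  funext y
  by_cases hy : y ∈ insert x D
  · rw [Assignment.modify_eq_ofFun, Assignment.val_ofFun hy]
  · have h1 : y ≠ x := fun h => hy (by simp [h])
    have h2 : y ∉ D := fun h => hy (by simp [h])
    -- Outside `insert x D` both sides take the same default element, so the identity holds for
    -- total assignments and not only on the domain.
    rw [Assignment.val_of_notMem hy, Function.update_of_ne h1, Assignment.val_of_notMem h2]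

theorem Assignment.modify_eq_iff {s : Assignment D A} {x : ℕ} {a : A}
    {t : Assignment (insert x D) A} :
    s.modify x a = t ↔ a = t.val x ∧ ∀ y ∈ D.erase x, s.val y = t.val y := by
  rw [Assignment.modify_eq_ofFun, Assignment.ofFun_eq_iff]
  constructor
  · intro h
    refine ⟨by simpa using h x (by simp), fun y hy => ?_⟩
    have h1 := Finset.mem_erase.1 hy
    simpa [Function.update_of_ne h1.1] using h y (by simp [h1.2])
  · rintro ⟨h1, h2⟩ y hy
    by_cases hyx : y = x
    · subst hyx
      simpa using h1
    · rw [Function.update_of_ne hyx]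
      exact h2 y (by simpa [hyx] using hy)

/-- The total weight of the assignments in an event. -/
noncomputable def Team.prob (X : Team D A) (p : (ℕ → A) → Prop) : ℝ :=
  ∑ s : Assignment D A, if p s.val then X s else 0

/-- An event holds on the support of a team. -/
def Team.Forces (X : Team D A) (p : (ℕ → A) → Prop) : Prop :=
  ∀ s, X s ≠ 0 → p s.val

theorem Team.weight_eq_prob (X : Team D A) (x : List ℕ) (a : List A) :
    X.weight x a = X.prob fun s => x.map s = a := by
  refine Finset.sum_congr rfl fun s _ => ?_
  congr

theorem Team.prob_congr {X : Team D A} {p q : (ℕ → A) → Prop}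
    (h : X.Forces fun s => p s ↔ q s) : X.prob p = X.prob q := by
  refine Finset.sum_congr rfl fun s _ => ?_
  by_cases hs : X s = 0
  · simp [hs]
  · simp [h s hs]

theorem Team.prob_not {X : Team D A} (hX : IsDistribution X) (p : (ℕ → A) → Prop) :
    X.prob (fun s => ¬ p s) = 1 - X.prob p := by
  rw [eq_sub_iff_add_eq, ← hX.2, Team.prob, Team.prob, ← Finset.sum_add_distrib]
  refine Finset.sum_congr rfl fun s _ => ?_
  by_cases h : p s.val <;> simp [h]

theorem Team.prob_nonneg {X : Team D A} (hX : IsDistribution X) (p : (ℕ → A) → Prop) :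
    0 ≤ X.prob p := by
  refine Finset.sum_nonneg fun s _ => ?_
  split_ifs
  · exact hX.1 s
  · exact le_rfl

/-- Weights are nonnegative, so the sum vanishes only termwise. This and its complement translate
between supports and probabilities. -/
theorem Team.prob_eq_zero_iff {X : Team D A} (hX : IsDistribution X) {p : (ℕ → A) → Prop} :
    X.prob p = 0 ↔ X.Forces fun s => ¬ p s := by
  rw [Team.prob, Finset.sum_eq_zero_iff_of_nonneg]
  · refine forall_congr' fun s => ?_
    simp only [Finset.mem_univ, true_imp_iff, ite_eq_right_iff]
    tauto
  · intro s _
    split_ifs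
    · exact hX.1 s
    · exact le_rfl

theorem Team.prob_eq_one_iff {X : Team D A} (hX : IsDistribution X) {p : (ℕ → A) → Prop} :
    X.prob p = 1 ↔ X.Forces p := by
  have h1 := Team.prob_eq_zero_iff hX (p := fun s => ¬ p s)
  rw [Team.prob_not hX] at h1
  simp only [not_not] at h1
  rw [← show X.Forces (fun s => p s) ↔ X.Forces p from Iff.rfl, ← h1, sub_eq_zero, eq_comm]

theorem Team.prob_or {X : Team D A} {p q : (ℕ → A) → Prop} (h : ∀ s, p s → ¬ q s) :
    X.prob (fun s => p s ∨ q s) = X.prob p + X.prob q := by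
  rw [Team.prob, Team.prob, Team.prob, ← Finset.sum_add_distrib]
  refine Finset.sum_congr rfl fun s _ => ?_
  have := h s.val
  by_cases h1 : p s.val <;> by_cases h2 : q s.val <;> simp_all

theorem Team.prob_true {X : Team D A} (hX : IsDistribution X) :
    X.prob (fun _ => True) = 1 := by
  simp [Team.prob, hX.2]

theorem Team.prob_eq_sum {ι : Type*} [Fintype ι] (X : Team D A) (p : (ℕ → A) → Prop)
    (e : (ℕ → A) → ι) : X.prob p = ∑ i, X.prob fun s => p s ∧ e s = i := by
  simp only [Team.prob]
  rw [Finset.sum_comm]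
  refine Finset.sum_congr rfl fun s _ => ?_
  by_cases h : p s.val <;> simp [h]

theorem IsDistribution.exists_ne_zero {B : Type*} [Fintype B] {d : B → ℝ}
    (hd : IsDistribution d) : ∃ b, d b ≠ 0 := by
  by_contra! h
  have := hd.2
  simp [h] at this

theorem Team.Forces.mono {X : Team D A} {p q : (ℕ → A) → Prop} (hp : X.Forces p)
    (h : ∀ s, p s → q s) : X.Forces q := fun s hs => h _ (hp s hs)

theorem Team.Forces.and {X : Team D A} {p q : (ℕ → A) → Prop} (hp : X.Forces p)
    (hq : X.Forces q) : X.Forces fun s => p s ∧ q s := fun s hs => ⟨hp s hs, hq s hs⟩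

theorem Team.forces_const_iff {X : Team D A} (hX : IsDistribution X) {P : Prop} :
    (X.Forces fun _ => P) ↔ P := by
  obtain ⟨s, hs⟩ := hX.exists_ne_zero
  exact ⟨fun h => h s hs, fun h _ _ => h⟩

theorem Team.Forces.congr {X : Team D A} {p q : (ℕ → A) → Prop}
    (h : X.Forces fun s => p s ↔ q s) : X.Forces p ↔ X.Forces q :=
  forall_congr' fun s => imp_congr_right fun hs => h s hs

/-! ### Image distributions -/

/-- The distribution over `D` of a random total assignment `U`. -/
noncomputable def Team.law {Ω : Type*} [Fintype Ω] (D : Finset ℕ) (m : Ω → ℝ) (U : Ω → ℕ → A) :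
    Team D A :=
  fun s => ∑ ω, if Assignment.ofFun D (U ω) = s then m ω else 0

/-- An event that depends only on `D` has the same truth value at `U ω` and at its restriction to
`D`, so the double sum over `s` and `ω` collapses to a sum over `ω`. -/
theorem Team.prob_law {Ω : Type*} [Fintype Ω] {m : Ω → ℝ} {U : Ω → ℕ → A}
    {p : (ℕ → A) → Prop} (hp : DependsOn p (D : Set ℕ)) :
    (Team.law D m U).prob p = ∑ ω, if p (U ω) then m ω else 0 := by
  have h1 : ∀ s : Assignment D A, (if p s.val then Team.law D m U s else 0) =
      ∑ ω, if Assignment.ofFun D (U ω) = s then (if p (U ω) then m ω else 0) else 0 := by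
    intro s
    have h2 : ∀ ω, Assignment.ofFun D (U ω) = s → (p (U ω) ↔ p s.val) := by
      rintro ω rfl
      rw [hp (x := U ω) (y := (Assignment.ofFun D (U ω)).val)]
      intro x hx
      rw [Assignment.val_ofFun hx]
    by_cases h : p s.val
    · rw [if_pos h, Team.law]
      refine Finset.sum_congr rfl fun ω _ => ?_
      by_cases h3 : Assignment.ofFun D (U ω) = s
      · simp [h3, (h2 ω h3).2 h]
      · simp [h3]
    · rw [if_neg h, eq_comm]
      refine Finset.sum_eq_zero fun ω _ => ?_
      by_cases h3 : Assignment.ofFun D (U ω) = s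
      · have : ¬ p (U ω) := fun h4 => h ((h2 ω h3).1 h4)
        simp [this]
      · simp [h3]
  rw [Team.prob, Finset.sum_congr rfl fun s _ => h1 s, Finset.sum_comm]
  exact Finset.sum_congr rfl fun ω _ => by simp

theorem IsDistribution.law {Ω : Type*} [Fintype Ω] {m : Ω → ℝ} (hm : IsDistribution m)
    (U : Ω → ℕ → A) : IsDistribution (Team.law D m U) := by
  constructor
  · intro s
    refine Finset.sum_nonneg fun ω _ => ?_
    split_ifs
    · exact hm.1 ω
    · exact le_rfl
  · have h := Team.prob_law (D := D) (m := m) (U := U) (p := fun _ => True) (fun _ _ _ => rfl)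
    simpa [Team.prob, hm.2] using h

/-- The supplement is the joint distribution of an assignment and a value drawn from the kernel,
pushed forward along modification; the facts on image distributions then give its total mass and its
probabilities of events. -/
theorem Team.supplement_eq_law (X : Team D A) (x : ℕ) (F : Assignment D A → A → ℝ) :
    X.supplement x F = Team.law (insert x D) (fun ω : Assignment D A × A => X ω.1 * F ω.1 ω.2)
      fun ω => Function.update ω.1.val x ω.2 := by
  funext s
  simp only [Team.supplement, Team.law, Fintype.sum_prod_type, Assignment.modify_eq_ofFun]

theorem isDistribution_kernel {X : Team D A} (hX : IsDistribution X)
    {F : Assignment D A → A → ℝ} (hF : ∀ s, IsDistribution (F s)) :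
    IsDistribution fun ω : Assignment D A × A => X ω.1 * F ω.1 ω.2 := by
  refine ⟨fun ω => mul_nonneg (hX.1 _) ((hF _).1 _), ?_⟩
  rw [Fintype.sum_prod_type, ← hX.2]
  exact Finset.sum_congr rfl fun s _ => by
    simp only [← Finset.mul_sum, (hF s).2, mul_one]

theorem IsDistribution.supplement {X : Team D A} (hX : IsDistribution X) (x : ℕ)
    {F : Assignment D A → A → ℝ} (hF : ∀ s, IsDistribution (F s)) :
    IsDistribution (X.supplement x F) := by
  rw [Team.supplement_eq_law]
  exact (isDistribution_kernel hX hF).law _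

theorem isDistribution_uniform :
    IsDistribution fun _ : A => 1 / (Fintype.card A : ℝ) := by
  refine ⟨fun _ => by positivity, ?_⟩
  simp

theorem IsDistribution.duplicate {X : Team D A} (hX : IsDistribution X) (x : ℕ) :
    IsDistribution (X.duplicate x) :=
  hX.supplement x fun _ => isDistribution_uniform

theorem Team.prob_supplement {X : Team D A} {x : ℕ} {F : Assignment D A → A → ℝ}
    {p : (ℕ → A) → Prop} (hp : DependsOn p ((insert x D : Finset ℕ) : Set ℕ)) :
    (X.supplement x F).prob p =
      ∑ t, ∑ a, if p (Function.update t.val x a) then X t * F t a else 0 := by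
  rw [Team.supplement_eq_law, Team.prob_law hp, Fintype.sum_prod_type]

theorem _root_.DependsOn.mono_finset {p : (ℕ → A) → Prop} {S T : Finset ℕ} (hp : DependsOn p (S : Set ℕ))
    (h : S ⊆ T) : DependsOn p (T : Set ℕ) :=
  fun _ _ hxy => hp fun i hi => hxy i (h hi)

theorem _root_.DependsOn.update_iff {p : (ℕ → A) → Prop} {S : Finset ℕ} (hp : DependsOn p (S : Set ℕ))
    {x : ℕ} (hx : x ∉ S) (s : ℕ → A) (a : A) : p (Function.update s x a) ↔ p s := by
  rw [hp (x := Function.update s x a) (y := s)]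
  intro i hi
  rw [Function.update_of_ne]
  rintro rfl
  exact hx hi

/-- Such events do not see `x`, and every row of the kernel has mass one, so the new value sums out.
The variable `x` may already belong to `D`; its old value is then lost, hence `D.erase x`. -/
theorem Team.prob_supplement_of_erase {X : Team D A} {x : ℕ} {F : Assignment D A → A → ℝ}
    (hF : ∀ s, IsDistribution (F s)) {p : (ℕ → A) → Prop}
    (hp : DependsOn p ((D.erase x : Finset ℕ) : Set ℕ)) :
    (X.supplement x F).prob p = X.prob p := by
  rw [Team.prob_supplement (hp.mono_finset ((Finset.erase_subset _ _).trans (Finset.subset_insert _ _)))]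
  refine Finset.sum_congr rfl fun t _ => ?_
  simp only [hp.update_iff (Finset.notMem_erase x D)]
  by_cases h : p t.val
  · simp [h, ← Finset.mul_sum, (hF t).2]
  · simp [h]

/-- Two assignments agree on a set of variables. -/
def AgreeOn (S : Finset ℕ) (t s : ℕ → A) : Prop := ∀ y ∈ S, s y = t y

theorem dependsOn_agreeOn (S : Finset ℕ) (t : ℕ → A) :
    DependsOn (AgreeOn S t) (S : Set ℕ) := by
  intro s s' h
  refine propext (forall_congr' fun y => imp_congr_right fun hy => ?_)
  rw [h y hy]

/-- The modifications of `t` at `x` are precisely the assignments that agree with `t` off `x`, each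
occurring once. -/
theorem Team.sum_modify (Y : Team (insert x D) A) (t : Assignment D A) :
    ∑ a, Y (t.modify x a) = Y.prob (AgreeOn (D.erase x) t.val) := by
  rw [Team.prob, ← Finset.sum_filter]
  refine Finset.sum_bij (fun a _ => t.modify x a) ?_ ?_ ?_ ?_
  · intro a _
    simp only [Finset.mem_filter, Finset.mem_univ, true_and]
    intro y hy
    rw [Assignment.val_modify, Function.update_of_ne (Finset.ne_of_mem_erase hy)]
  · intro a _ b _ h
    have := congrArg (fun s => s.val x) h
    simpa [Assignment.val_modify] using this
  · intro s hs
    simp only [Finset.mem_filter, Finset.mem_univ, true_and] at hs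
    exact ⟨s.val x, Finset.mem_univ _, Assignment.modify_eq_iff.2 ⟨rfl, fun y hy => (hs y hy).symm⟩⟩
  · intro a _
    rfl

theorem AgreeOn.congr_left {S : Finset ℕ} {t t' : ℕ → A} (h : AgreeOn S t' t) :
    AgreeOn S t = AgreeOn S t' := by
  funext s
  refine propext (forall_congr' fun y => imp_congr_right fun hy => ?_)
  rw [h y hy]

/-- A distribution is of the form `X(F/x)` if it has the marginals of `X` off `x`. -/
theorem exists_supplement_eq {x : ℕ} {X : Team D A} (hX : IsDistribution X)
    {Y : Team (insert x D) A} (hY : ∀ s, 0 ≤ Y s)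
    (h : ∀ t : Assignment D A,
      Y.prob (AgreeOn (D.erase x) t.val) = X.prob (AgreeOn (D.erase x) t.val)) :
    ∃ F : Assignment D A → A → ℝ, (∀ s, IsDistribution (F s)) ∧ X.supplement x F = Y := by
  have hM := fun t : Assignment D A => Team.prob_nonneg hX (AgreeOn (D.erase x) t.val)
  -- The kernel is the conditional distribution of `x` given the values off `x`. On fibres of mass
  -- zero its choice is irrelevant; the uniform distribution keeps it a kernel.
  refine ⟨fun t a => if X.prob (AgreeOn (D.erase x) t.val) = 0 then 1 / (Fintype.card A : ℝ)
    else Y (t.modify x a) / X.prob (AgreeOn (D.erase x) t.val), fun t => ?_, ?_⟩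
  · by_cases h0 : X.prob (AgreeOn (D.erase x) t.val) = 0
    · simp only [h0, if_true]
      exact isDistribution_uniform
    · simp only [h0, if_false]
      refine ⟨fun a => div_nonneg (hY _) (hM t), ?_⟩
      rw [← Finset.sum_div, Team.sum_modify, h t, div_self h0]
  · funext s
    let t₀ : Assignment D A := Assignment.ofFun D s.val
    have ht₀ : AgreeOn (D.erase x) s.val t₀.val := fun y hy =>
      Assignment.val_ofFun (Finset.mem_of_mem_erase hy)
    have hs : t₀.modify x (s.val x) = s := Assignment.modify_eq_iff.2 ⟨rfl, ht₀⟩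
    -- Only `a = s.val x` can lead from `t` to `s`, and only if `t` agrees with `s` off `x`.
    have key : ∀ t : Assignment D A, (∑ a, if t.modify x a = s then
        X t * (if X.prob (AgreeOn (D.erase x) t.val) = 0 then 1 / (Fintype.card A : ℝ)
        else Y (t.modify x a) / X.prob (AgreeOn (D.erase x) t.val)) else 0) =
        if AgreeOn (D.erase x) s.val t.val then
        X t * (if X.prob (AgreeOn (D.erase x) s.val) = 0 then 1 / (Fintype.card A : ℝ)
        else Y s / X.prob (AgreeOn (D.erase x) s.val)) else 0 := by
      intro t
      by_cases ht : AgreeOn (D.erase x) s.val t.val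
      · rw [if_pos ht, Finset.sum_eq_single (s.val x)]
        · have := Assignment.modify_eq_iff.2 ⟨rfl, ht⟩
          rw [if_pos this, this, ht.congr_left]
        · intro a _ ha
          rw [if_neg]
          intro h1
          exact ha (Assignment.modify_eq_iff.1 h1).1
        · simp
      · rw [if_neg ht]
        refine Finset.sum_eq_zero fun a _ => if_neg fun h1 => ht (Assignment.modify_eq_iff.1 h1).2
    rw [Team.supplement, Finset.sum_congr rfl fun t _ => key t]
    have h2 := h t₀
    rw [ht₀.congr_left] at h2
    by_cases h0 : X.prob (AgreeOn (D.erase x) s.val) = 0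
    -- On a null fibre `Y` vanishes as well, its fibre mass being that of `X`.
    · have h3 : ∑ a, Y (t₀.modify x a) = 0 := by
        rw [Team.sum_modify, ht₀.congr_left, h2, h0]
      have h4 := (Finset.sum_eq_zero_iff_of_nonneg fun a _ => hY _).1 h3 (s.val x)
        (Finset.mem_univ _)
      rw [hs] at h4
      rw [h4]
      refine Finset.sum_eq_zero fun t _ => ?_
      have h5 := (Team.prob_eq_zero_iff hX).1 h0 t
      by_cases h6 : X t = 0
      · simp [h6]
      · rw [if_neg (h5 h6)]
    · simp only [h0, if_false]
      have : ∀ t : Assignment D A, (if AgreeOn (D.erase x) s.val t.val then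
          X t * (Y s / X.prob (AgreeOn (D.erase x) s.val)) else 0) =
          (if AgreeOn (D.erase x) s.val t.val then X t else 0) *
            (Y s / X.prob (AgreeOn (D.erase x) s.val)) := by
        intro t
        split_ifs <;> simp
      rw [Finset.sum_congr rfl fun t _ => this t, ← Finset.sum_mul]
      exact mul_div_cancel₀ _ h0

end Basics

/-! ### Derived second-order formulas -/

namespace SOFormula

variable {L : FirstOrder.Language.{u, v}} {A : Type w} [Fintype A] [Nonempty A] [L.Structure A]

/-- Negation, by De Morgan duality. -/
def neg : SOFormula L → SOFormula L
  | numEq i j => numNeq i j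
  | numNeq i j => numEq i j
  | eq x y => neq x y
  | neq x y => eq x y
  | rel R x => nrel R x
  | nrel R x => rel R x
  | and φ ψ => or φ.neg ψ.neg
  | or φ ψ => and φ.neg ψ.neg
  | ex x φ => all x φ.neg
  | all x φ => ex x φ.neg
  | exFun n f φ => allFun n f φ.neg
  | allFun n f φ => exFun n f φ.neg

@[simp] theorem sat_neg (φ : SOFormula L) (E : FunInterp A) (s : ℕ → A) :
    φ.neg.Sat E s ↔ ¬ φ.Sat E s := by
  induction φ generalizing E s <;> simp_all [neg, Sat]
  tauto

/-- Implication. -/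
def imp (φ ψ : SOFormula L) : SOFormula L := or φ.neg ψ

@[simp] theorem sat_imp (φ ψ : SOFormula L) (E : FunInterp A) (s : ℕ → A) :
    (φ.imp ψ).Sat E s ↔ (φ.Sat E s → ψ.Sat E s) := by
  simp [imp, Sat, imp_iff_not_or]

/-- Finite conjunctions. -/
def bigAnd : List (SOFormula L) → SOFormula L
  | [] => all 0 (eq 0 0)
  | φ :: l => and φ (bigAnd l)

@[simp] theorem sat_bigAnd (l : List (SOFormula L)) (E : FunInterp A) (s : ℕ → A) :
    (bigAnd l).Sat E s ↔ ∀ φ ∈ l, φ.Sat E s := by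
  induction l <;> simp_all [bigAnd, Sat]

end SOFormula

/-! ### Assignments coded by blocks of first-order variables -/

/-- A tagged copy of an assignment of `D`: the variable `Nat.pair b x` gets the value of `x`. -/
def setBlk {A : Type w} (s : ℕ → A) (b : ℕ) (D : Finset ℕ) (t : ℕ → A) : ℕ → A := fun n =>
  if (Nat.unpair n).1 = b ∧ (Nat.unpair n).2 ∈ D then t (Nat.unpair n).2 else s n

theorem setBlk_of_mem {A : Type w} {s : ℕ → A} {b : ℕ} {D : Finset ℕ} {t : ℕ → A} {x : ℕ}
    (hx : x ∈ D) : setBlk s b D t (Nat.pair b x) = t x := by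
  simp [setBlk, hx]

theorem setBlk_of_ne {A : Type w} {s : ℕ → A} {b b' : ℕ} {D : Finset ℕ} {t : ℕ → A} {x : ℕ}
    (hb : b' ≠ b) : setBlk s b D t (Nat.pair b' x) = s (Nat.pair b' x) := by
  simp [setBlk, hb]

/-- The tuple of values of the variables in `D`, in increasing order. -/
def tup {A : Type w} (D : Finset ℕ) (t : ℕ → A) : Fin D.card → A :=
  fun i => t (D.orderEmbOfFin rfl i)

/-- The value of the `b`-th copy of the variables in `D`. -/
def readBlk {A : Type w} (s : ℕ → A) (b : ℕ) (D : Finset ℕ) : Fin D.card → A :=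
  tup D fun x => s (Nat.pair b x)

/-- The `b`-th copy of the variables in `D`. -/
def blkVars (b : ℕ) (D : Finset ℕ) : Fin D.card → ℕ :=
  tup D fun x => Nat.pair b x

theorem apply_blkVars {A : Type w} (s : ℕ → A) (b : ℕ) (D : Finset ℕ) :
    (fun i => s (blkVars b D i)) = readBlk s b D := rfl

theorem tup_congr {A : Type w} {D : Finset ℕ} {t t' : ℕ → A} (h : ∀ x ∈ D, t x = t' x) :
    tup D t = tup D t' :=
  funext fun i => h _ (D.orderEmbOfFin_mem rfl i)

theorem readBlk_setBlk_of_subset {A : Type w} {s : ℕ → A} {b : ℕ} {D D' : Finset ℕ} {t : ℕ → A}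
    (h : D ⊆ D') : readBlk (setBlk s b D' t) b D = tup D t :=
  tup_congr fun _ hx => setBlk_of_mem (h hx)

@[simp] theorem readBlk_setBlk {A : Type w} {s : ℕ → A} {b : ℕ} {D : Finset ℕ} {t : ℕ → A} :
    readBlk (setBlk s b D t) b D = tup D t :=
  readBlk_setBlk_of_subset subset_rfl

theorem readBlk_setBlk_of_ne {A : Type w} {s : ℕ → A} {b b' : ℕ} {D D' : Finset ℕ} {t : ℕ → A}
    (h : b' ≠ b) : readBlk (setBlk s b D t) b' D' = readBlk s b' D' :=
  tup_congr fun _ _ => setBlk_of_ne h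

theorem tup_eq_iff {A : Type w} {D : Finset ℕ} {t t' : ℕ → A} :
    tup D t = tup D t' ↔ ∀ x ∈ D, t x = t' x := by
  refine ⟨fun h x hx => ?_, tup_congr⟩
  have h1 : x ∈ Set.range (D.orderEmbOfFin rfl) := by simpa using hx
  obtain ⟨i, rfl⟩ := h1
  exact congrFun h i

/-- A tuple determines the assignment it comes from, so every weight function factors through tuples
and can be stored in a function variable of arity `D.card`. -/
theorem exists_tup_eq {A : Type w} [Fintype A] [Nonempty A] (D : Finset ℕ) (X : Assignment D A → ℝ) :
    ∃ g : (Fin D.card → A) → ℝ, ∀ t, g (tup D t.val) = X t := by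
  have : Function.Injective fun t : Assignment D A => tup D t.val := fun t t' h =>
    Assignment.ext_val (tup_eq_iff.1 h)
  exact ⟨Function.extend _ X 0, fun t => this.extend_apply X 0 t⟩

theorem exists_tup_append_eq {A : Type w} [Fintype A] [Nonempty A] (D : Finset ℕ)
    (X : Assignment D A → Assignment D A → ℝ) :
    ∃ g : (Fin (D.card + D.card) → A) → ℝ,
      ∀ t t', g (Fin.append (tup D t.val) (tup D t'.val)) = X t t' := by
  have : Function.Injective fun t : Assignment D A × Assignment D A =>
      Fin.append (tup D t.1.val) (tup D t.2.val) := by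
    rintro ⟨t, t'⟩ ⟨r, r'⟩ h
    have h1 : tup D t.val = tup D r.val := funext fun i => by
      simpa only [Fin.append_left] using congrFun h (Fin.castAdd _ i)
    have h2 : tup D t'.val = tup D r'.val := funext fun i => by
      simpa only [Fin.append_right] using congrFun h (Fin.natAdd _ i)
    exact Prod.ext (Assignment.ext_val (tup_eq_iff.1 h1)) (Assignment.ext_val (tup_eq_iff.1 h2))
  exact ⟨Function.extend _ (fun p : Assignment D A × Assignment D A => X p.1 p.2)
    fun _ => 0,
    fun t t' => this.extend_apply _ _ (t, t')⟩

@[simp] theorem FunInterp.update_same {A : Type w} (E : FunInterp A) (n f : ℕ)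
    (g : (Fin n → A) → ℝ) : E.update n f g n f = g := by
  simp [FunInterp.update]

theorem FunInterp.update_of_ne {A : Type w} (E : FunInterp A) {n f n' f' : ℕ}
    (g : (Fin n → A) → ℝ) (h : f' ≠ f) : E.update n f g n' f' = E n' f' := by
  by_cases hn : n' = n
  · subst hn
    simp [FunInterp.update, h]
  · simp [FunInterp.update, hn]

/-! ### Quantifiers over coded assignments and simple numerical predicates -/

namespace SOFormula

variable {L : FirstOrder.Language.{u, v}} {A : Type w} [Fintype A] [Nonempty A] [L.Structure A]

/-- Universal quantification over the `b`-th copy of a list of variables. -/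
def allList (b : ℕ) : List ℕ → SOFormula L → SOFormula L
  | [], φ => φ
  | x :: l, φ => all (Nat.pair b x) (allList b l φ)

theorem sat_allList (b : ℕ) (l : List ℕ) (φ : SOFormula L) (E : FunInterp A) (s : ℕ → A) :
    (allList b l φ).Sat E s ↔ ∀ t : ℕ → A, φ.Sat E (setBlk s b l.toFinset t) := by
  induction l generalizing s with
  | nil =>
    have : ∀ t, setBlk s b (List.toFinset []) t = s := fun t => by funext n; simp [setBlk]
    simp only [allList, this, forall_const]
  | cons x l ih =>
    simp only [allList, Sat, ih]
    constructor
    · intro h t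
      convert h (t x) t using 1
      funext n
      simp only [setBlk, List.toFinset_cons, Finset.mem_insert, Function.update_apply]
      by_cases h1 : (Nat.unpair n).1 = b ∧ (Nat.unpair n).2 ∈ l.toFinset
      · simp [h1]
      · by_cases h2 : n = Nat.pair b x
        · simp [h2]
        · have : ¬ ((Nat.unpair n).1 = b ∧ (Nat.unpair n).2 = x) := by
            rintro ⟨rfl, rfl⟩
            exact h2 (Nat.pair_unpair n).symm
          simp only [h2, h1, if_false]
          rw [if_neg]
          tauto
    · intro h a t
      -- If `x` occurs again in `l`, the inner quantifier overrides the value `a`; otherwise `a` has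
      -- to be entered into `t`.
      convert h (if x ∈ l then t else Function.update t x a) using 1
      funext n
      simp only [setBlk, List.toFinset_cons, Finset.mem_insert, Function.update_apply]
      by_cases h1 : (Nat.unpair n).1 = b ∧ (Nat.unpair n).2 ∈ l.toFinset
      · by_cases h3 : x ∈ l
        · simp [h1, h3]
        · have : (Nat.unpair n).2 ≠ x := by
            rintro rfl
            exact h3 (by simpa using h1.2)
          simp [h1, h3, this]
      · by_cases h2 : n = Nat.pair b x
        · subst h2
          have h3 : x ∉ l := by simpa using h1
          simp [h3]
        · have : ¬ ((Nat.unpair n).1 = b ∧ (Nat.unpair n).2 = x) := by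
            rintro ⟨rfl, rfl⟩
            exact h2 (Nat.pair_unpair n).symm
          simp only [h2, h1, if_false]
          rw [if_neg]
          tauto

/-- Universal quantification over the `b`-th copy of the variables in `D`. -/
noncomputable def allBlk (b : ℕ) (D : Finset ℕ) (φ : SOFormula L) : SOFormula L :=
  allList b D.toList φ

@[simp] theorem sat_allBlk (b : ℕ) (D : Finset ℕ) (φ : SOFormula L) (E : FunInterp A)
    (s : ℕ → A) :
    (allBlk b D φ).Sat E s ↔ ∀ t : Assignment D A, φ.Sat E (setBlk s b D t.val) := by
  rw [allBlk, sat_allList, Finset.toList_toFinset]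
  refine ⟨fun h t => h _, fun h t => ?_⟩
  convert h (Assignment.ofFun D t) using 1
  funext n
  simp only [setBlk]
  split_ifs with h1
  · rw [Assignment.val_ofFun h1.2]
  · rfl

/-- Existential quantification over the `b`-th copy of the variables in `D`. -/
noncomputable def exBlk (b : ℕ) (D : Finset ℕ) (φ : SOFormula L) : SOFormula L :=
  (allBlk b D φ.neg).neg

@[simp] theorem sat_exBlk (b : ℕ) (D : Finset ℕ) (φ : SOFormula L) (E : FunInterp A)
    (s : ℕ → A) :
    (exBlk b D φ).Sat E s ↔ ∃ t : Assignment D A, φ.Sat E (setBlk s b D t.val) := by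
  simp [exBlk]

/-- The copies `b` and `b'` of the variables in `S` have the same values. -/
noncomputable def agree (S : Finset ℕ) (b b' : ℕ) : SOFormula L :=
  bigAnd (S.toList.map fun x => eq (Nat.pair b x) (Nat.pair b' x))

theorem sat_agree (S : Finset ℕ) (b b' : ℕ) (E : FunInterp A) (s : ℕ → A) :
    (agree (L := L) S b b').Sat E s ↔ ∀ x ∈ S, s (Nat.pair b x) = s (Nat.pair b' x) := by
  simp [agree, Sat]

/-- The function variable `f` applied to the `b`-th copy of the variables in `D`. -/
def _root_.ProbTeam.NumTerm.appBlk (f : ℕ) (D : Finset ℕ) (b : ℕ) : NumTerm :=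
  .app D.card f (blkVars b D)

@[simp] theorem _root_.ProbTeam.NumTerm.eval_appBlk (f : ℕ) (D : Finset ℕ) (b : ℕ)
    (E : FunInterp A) (s : ℕ → A) :
    (NumTerm.appBlk f D b).eval E s = E D.card f (readBlk s b D) := rfl

/-- A function variable applied to two copies of the variables in `D`. -/
def _root_.ProbTeam.NumTerm.appBlk₂ (f : ℕ) (D : Finset ℕ) (b b' : ℕ) : NumTerm :=
  .app (D.card + D.card) f (Fin.append (blkVars b D) (blkVars b' D))

@[simp] theorem _root_.ProbTeam.NumTerm.eval_appBlk₂ (f : ℕ) (D : Finset ℕ) (b b' : ℕ)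
    (E : FunInterp A) (s : ℕ → A) :
    (NumTerm.appBlk₂ f D b b').eval E s =
      E (D.card + D.card) f (Fin.append (readBlk s b D) (readBlk s b' D)) := by
  simp only [NumTerm.appBlk₂, NumTerm.eval]
  congr 1
  funext i
  refine Fin.addCases (fun i => ?_) (fun i => ?_) i
  · simp only [← apply_blkVars, Fin.append_left]
  · simp only [← apply_blkVars, Fin.append_right]

/-- The value of the term is zero. -/
def isZero (i : NumTerm) : SOFormula L := numEq (i.add i) i

@[simp] theorem sat_isZero (i : NumTerm) (E : FunInterp A) (s : ℕ → A) :
    (isZero (L := L) i).Sat E s ↔ i.eval E s = 0 := by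
  simp [isZero, Sat, NumTerm.eval]

/-- The value of the term is one. -/
def isOne (i : NumTerm) : SOFormula L := and (numEq (i.mul i) i) (isZero i).neg

-- A nonzero real number that equals its square is one; numerical terms contain no constants.
@[simp] theorem sat_isOne (i : NumTerm) (E : FunInterp A) (s : ℕ → A) :
    (isOne (L := L) i).Sat E s ↔ i.eval E s = 1 := by
  simp only [isOne, Sat, NumTerm.eval, sat_neg, sat_isZero]
  constructor
  · rintro ⟨h1, h2⟩
    exact mul_left_cancel₀ h2 (by rw [h1, mul_one])
  · intro h
    simp [h]

/-- The value of `f(x)` is nonnegative. -/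
def isNonneg (n f : ℕ) (x : Fin n → ℕ) : SOFormula L :=
  exFun 0 (f + 1) (numEq (.app n f x)
    (.mul (.app 0 (f + 1) Fin.elim0) (.app 0 (f + 1) Fin.elim0)))

-- Order is not part of the language, but the nonnegative reals are the squares. The root is stored
-- under the name `f + 1`, which differs from `f`.
@[simp] theorem sat_isNonneg (n f : ℕ) (x : Fin n → ℕ) (E : FunInterp A) (s : ℕ → A) :
    (isNonneg (L := L) n f x).Sat E s ↔ 0 ≤ E n f fun i => s (x i) := by
  simp only [isNonneg, Sat, NumTerm.eval, FunInterp.update_same,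
    FunInterp.update_of_ne E _ (Nat.succ_ne_self f).symm]
  constructor
  · rintro ⟨g, hg⟩
    rw [hg]
    exact mul_self_nonneg _
  · intro h
    exact ⟨fun _ => Real.sqrt (E n f fun i => s (x i)), (Real.mul_self_sqrt h).symm⟩

end SOFormula

/-! ### Definability of sums: marginals of a weight function -/

/-- Sums over a finite set are telescoped by a cyclic permutation. -/
theorem exists_perm_telescoping (B : Type*) [Fintype B] [Nonempty B] :
    ∃ (π : Equiv.Perm B) (b₀ : B), ∀ G : B → ℝ, ∃ P : B → ℝ,
      ∀ b, P (π b) + (if b = b₀ then ∑ a, G a else 0) = P b + G b := by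
  obtain ⟨n, hn⟩ : ∃ n, Fintype.card B = n + 1 :=
    ⟨Fintype.card B - 1, by have := Fintype.card_pos (α := B); omega⟩
  let e : B ≃ Fin (n + 1) := Fintype.equivFinOfCardEq hn
  refine ⟨(e.trans (finRotate (n + 1))).trans e.symm, e.symm (Fin.last n), fun G => ?_⟩
  -- `P b` is the sum of `G` strictly below `b` in an enumeration. The rotation sends the last
  -- element to the first, whose partial sum is empty, so exactly there the total has to be added on
  -- the left.
  refine ⟨fun b => ∑ j with j < e b, G (e.symm j), fun b => ?_⟩
  obtain ⟨i, rfl⟩ := e.symm.surjective b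
  simp only [Equiv.trans_apply, Equiv.apply_symm_apply, EmbeddingLike.apply_eq_iff_eq]
  induction i using Fin.lastCases with
  | last =>
    simp only [finRotate_last, Fin.not_lt_zero, Finset.filter_false, Finset.sum_empty, if_true,
      zero_add]
    rw [← e.symm.sum_comp G, ← Finset.sum_erase_add _ _ (Finset.mem_univ (Fin.last n))]
    congr 1
    refine Finset.sum_congr ?_ fun _ _ => rfl
    ext j
    simp [Fin.lt_last_iff_ne_last]
  | cast i =>
    rw [if_neg (Fin.castSucc_lt_last i).ne, add_zero, finRotate_apply, Fin.coeSucc_eq_succ,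
      ← Finset.sum_erase_add (Finset.univ.filter (· < i.succ)) _ (a := i.castSucc)]
    · congr 1
      refine Finset.sum_congr ?_ fun _ _ => rfl
      ext j
      simp only [Finset.mem_erase, Finset.mem_filter, Finset.mem_univ, true_and, Fin.lt_def,
        Fin.val_succ, Fin.val_castSucc, ne_eq, Fin.ext_iff]
      omega
    · simp

namespace SOFormula

variable {L : FirstOrder.Language.{u, v}} {A : Type w} [Fintype A] [Nonempty A] [L.Structure A]

/-- Case distinction. -/
def cond (φ α β : SOFormula L) : SOFormula L := and (imp φ α) (imp φ.neg β)

@[simp] theorem sat_cond (φ α β : SOFormula L) (E : FunInterp A) (s : ℕ → A) :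
    (cond φ α β).Sat E s ↔ if φ.Sat E s then α.Sat E s else β.Sat E s := by
  simp only [cond, Sat, sat_imp, sat_neg]
  split_ifs <;> tauto

open NumTerm in
/-- The function `g` is the marginal on `S` of the weight function `f` on assignments of `D`. -/
noncomputable def marginal (D S : Finset ℕ) (f g : ℕ) : SOFormula L :=
  exFun (D.card + D.card) (f + g + 1) <| exFun (D.card + D.card) (f + g + 2) <| exBlk 3 D <|
    and (allBlk 0 D (exBlk 1 D (isZero (appBlk₂ (f + g + 1) D 0 1)))) <|
    and (allBlk 0 D <| allBlk 1 D <| allBlk 2 D <| imp (isZero (appBlk₂ (f + g + 1) D 0 1)) <|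
      imp (isZero (appBlk₂ (f + g + 1) D 2 1)) (agree D 0 2)) <|
    allBlk 0 D <| allBlk 1 D <| allBlk 2 D <| imp (isZero (appBlk₂ (f + g + 1) D 0 1)) <|
      cond (agree D 0 3)
        (cond (agree S 0 2)
          (numEq (add (appBlk₂ (f + g + 2) D 2 1) (appBlk g D 2))
            (add (appBlk₂ (f + g + 2) D 2 0) (appBlk f D 0)))
          (numEq (add (appBlk₂ (f + g + 2) D 2 1) (appBlk g D 2))
            (appBlk₂ (f + g + 2) D 2 0)))
        (cond (agree S 0 2)
          (numEq (appBlk₂ (f + g + 2) D 2 1)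
            (add (appBlk₂ (f + g + 2) D 2 0) (appBlk f D 0)))
          (numEq (appBlk₂ (f + g + 2) D 2 1) (appBlk₂ (f + g + 2) D 2 0)))

theorem sat_agree_of_subset {S D : Finset ℕ} (h : S ⊆ D) {b b' : ℕ} {s : ℕ → A}
    {E : FunInterp A} {t t' : ℕ → A} (ht : ∀ x ∈ D, s (Nat.pair b x) = t x)
    (ht' : ∀ x ∈ D, s (Nat.pair b' x) = t' x) :
    (agree (L := L) S b b').Sat E s ↔ AgreeOn S t' t := by
  rw [sat_agree]
  exact forall₂_congr fun x hx => by rw [ht x (h hx), ht' x (h hx)]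

/-- The zeros of the first auxiliary function relate every assignment to some image, and distinct
assignments share no image; a choice of images is injective, hence a permutation `π`. The second
auxiliary function stores for each `b` a function `R` with `R(π a) = R(a) + w(a)`, up to the
correction by `g(b)` at `a = d`, where `w(a)` is the weight of `a` if it agrees with `b` on `S` and
zero otherwise. Adding these equations over all `a` isolates `g(b)`. The formula does not require
`π` to be cyclic; a cyclic permutation is only used to find a solution `R`. -/
theorem sat_marginal {D S : Finset ℕ} (hS : S ⊆ D) (f g : ℕ) (E : FunInterp A) (s : ℕ → A) :
    (marginal (L := L) D S f g).Sat E s ↔ ∀ b : Assignment D A, E D.card g (tup D b.val) =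
      Team.prob (D := D) (fun a => E D.card f (tup D a.val)) (AgreeOn S b.val) := by
  have hr2 : f + g + 1 ≠ f + g + 2 := by omega
  have hf1 : f ≠ f + g + 1 := by omega
  have hg1 : g ≠ f + g + 1 := by omega
  have hf2 : f ≠ f + g + 2 := by omega
  have hg2 : g ≠ f + g + 2 := by omega
  have hag : ∀ (E : FunInterp A) (d a a' b : Assignment D A), (agree (L := L) S 0 2).Sat E
      (setBlk (setBlk (setBlk (setBlk s 3 D d.val) 0 D a.val) 1 D a'.val) 2 D b.val) ↔
      AgreeOn S b.val a.val := fun E d a a' b => sat_agree_of_subset hS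
    (fun x hx => by simp [setBlk_of_mem hx, setBlk_of_ne])
    (fun x hx => by simp [setBlk_of_mem hx])
  have hag' : ∀ (E : FunInterp A) (d a a' b : Assignment D A), (agree (L := L) D 0 2).Sat E
      (setBlk (setBlk (setBlk (setBlk s 3 D d.val) 0 D a.val) 1 D a'.val) 2 D b.val) ↔
      AgreeOn D b.val a.val := fun E d a a' b => sat_agree_of_subset subset_rfl
    (fun x hx => by simp [setBlk_of_mem hx, setBlk_of_ne])
    (fun x hx => by simp [setBlk_of_mem hx])
  have hag3 : ∀ (E : FunInterp A) (d a a' b : Assignment D A), (agree (L := L) D 0 3).Sat E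
      (setBlk (setBlk (setBlk (setBlk s 3 D d.val) 0 D a.val) 1 D a'.val) 2 D b.val) ↔
      AgreeOn D d.val a.val := fun E d a a' b => sat_agree_of_subset subset_rfl
    (fun x hx => by simp [setBlk_of_mem hx, setBlk_of_ne])
    (fun x hx => by simp [setBlk_of_mem hx, setBlk_of_ne])
  have heq : ∀ a b : Assignment D A, AgreeOn D b.val a.val ↔ a = b := fun a b =>
    ⟨fun h => Assignment.ext_val h, by rintro rfl x _; rfl⟩
  simp only [marginal, Sat, sat_exBlk, sat_allBlk, sat_imp, sat_cond, sat_isZero, hag, hag', hag3,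
    heq, NumTerm.eval, NumTerm.eval_appBlk, NumTerm.eval_appBlk₂, FunInterp.update_same,
    FunInterp.update_of_ne, ne_eq, hr2, hf1, hg1, hf2, hg2, not_false_eq_true, readBlk_setBlk,
    readBlk_setBlk_of_ne, OfNat.zero_ne_ofNat, zero_ne_one, OfNat.one_ne_ofNat]
  constructor
  · rintro ⟨Q, R, d, hQ, hinj, hstep⟩ b
    choose π hπ using hQ
    have hπi : Function.Injective π := fun a a' h => by
      have := hinj a (π a) a' (hπ a) (by rw [h]; exact hπ a')
      exact this
    have hb : Function.Bijective π := Finite.injective_iff_bijective.1 hπi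
    have hsum : ∑ a : Assignment D A, (R (Fin.append (tup D b.val) (tup D (π a).val)) +
        if a = d then E D.card g (tup D b.val) else 0) =
        ∑ a : Assignment D A, (R (Fin.append (tup D b.val) (tup D a.val)) +
          if AgreeOn S b.val a.val then E D.card f (tup D a.val) else 0) := by
      refine Finset.sum_congr rfl fun a _ => ?_
      have := hstep a (π a) b (hπ a)
      split_ifs at this ⊢ <;> simpa using this
    -- Reindexing along the bijection `π` makes the two sums of `R` equal.
    rw [Finset.sum_add_distrib, Finset.sum_add_distrib,
      hb.sum_comp fun a : Assignment D A => R (Fin.append (tup D b.val) (tup D a.val))] at hsum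
    simpa [Team.prob] using hsum
  · intro h
    obtain ⟨π, d, hπ⟩ := exists_perm_telescoping (Assignment D A)
    choose P hP using fun b : Assignment D A => hπ fun a : Assignment D A =>
      if AgreeOn S b.val a.val then E D.card f (tup D a.val) else 0
    -- Among pairs of assignments, `Q` vanishes exactly on the graph of `π`.
    obtain ⟨Q, hQ⟩ := exists_tup_append_eq D fun a a' : Assignment D A =>
      if a' = π a then 0 else 1
    obtain ⟨R, hR⟩ := exists_tup_append_eq D P
    refine ⟨Q, R, d, fun a => ⟨π a, by simp [hQ]⟩, fun a a' b h1 h2 => ?_, fun a a' b h1 => ?_⟩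
    · have h1' : a' = π a := by simpa [hQ] using h1
      have h2' : a' = π b := by simpa [hQ] using h2
      exact π.injective (h1'.symm.trans h2')
    · have h1' : a' = π a := by simpa [hQ] using h1
      subst h1'
      have := hP b a
      have h3 := h b
      simp only [Team.prob] at h3
      rw [← h3] at this
      simp only [hR]
      split_ifs at this ⊢ <;> simpa using this

end SOFormula

theorem Team.weight_map {A : Type w} [Fintype A] [Nonempty A] {D : Finset ℕ} (X : Team D A)
    (l : List ℕ) (t : ℕ → A) : X.weight l (l.map t) = X.prob (AgreeOn l.toFinset t) := by
  rw [Team.weight_eq_prob]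
  congr 1
  funext s
  simp [AgreeOn, List.map_inj_left]

/-- The team `X(A/x)` is the extension of `X` by `x` that does not distinguish the values
of `x`. -/
theorem Team.eq_duplicate_iff {A : Type w} [Fintype A] [Nonempty A] {D : Finset ℕ}
    {X : Team D A} {x : ℕ} {Y : Team (insert x D) A} :
    Y = X.duplicate x ↔ (∀ t : Assignment D A,
      Y.prob (AgreeOn (D.erase x) t.val) = X.prob (AgreeOn (D.erase x) t.val)) ∧
      ∀ s s' : Assignment (insert x D) A, AgreeOn (D.erase x) s'.val s.val → Y s = Y s' := by
  have hm : ∀ t : Assignment D A, (X.duplicate x).prob (AgreeOn (D.erase x) t.val) =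
      X.prob (AgreeOn (D.erase x) t.val) := fun t =>
    Team.prob_supplement_of_erase (fun _ => isDistribution_uniform) (dependsOn_agreeOn _ _)
  have hi : ∀ s s' : Assignment (insert x D) A, AgreeOn (D.erase x) s'.val s.val →
      X.duplicate x s = X.duplicate x s' := by
    intro s s' h
    refine Finset.sum_congr rfl fun t _ => ?_
    have key : ∀ r : Assignment (insert x D) A,
        (∑ a, if t.modify x a = r then X t * (1 / (Fintype.card A : ℝ)) else 0) =
        if AgreeOn (D.erase x) r.val t.val then X t * (1 / (Fintype.card A : ℝ)) else 0 := by
      intro r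
      simp only [Assignment.modify_eq_iff]
      by_cases hr : AgreeOn (D.erase x) r.val t.val
      · rw [if_pos hr, Finset.sum_eq_single (r.val x)]
        · rw [if_pos ⟨rfl, hr⟩]
        · intro a _ ha
          exact if_neg fun h1 => ha h1.1
        · simp
      · rw [if_neg hr]
        exact Finset.sum_eq_zero fun a _ => if_neg fun h1 => hr h1.2
    have h1 : AgreeOn (D.erase x) s.val t.val ↔ AgreeOn (D.erase x) s'.val t.val :=
      forall₂_congr fun y hy => by rw [h y hy]
    rw [key, key]
    simp only [h1]
  constructor
  · rintro rfl
    exact ⟨hm, hi⟩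
  · rintro ⟨h1, h2⟩
    -- A fibre over the values off `x` consists of `|A|` assignments of equal weight, so the mass of
    -- the fibre determines this weight.
    have hval : ∀ Z : Team (insert x D) A, (∀ s s' : Assignment (insert x D) A,
        AgreeOn (D.erase x) s'.val s.val → Z s = Z s') → ∀ s : Assignment (insert x D) A,
        Z.prob (AgreeOn (D.erase x) (Assignment.ofFun D s.val).val) = Fintype.card A * Z s := by
      intro Z hZ s
      rw [← Team.sum_modify, Finset.sum_congr rfl fun a _ => hZ _ s _]
      · simp
      · intro a _ y hy
        rw [Assignment.val_modify, Function.update_of_ne (Finset.ne_of_mem_erase hy),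
          Assignment.val_ofFun (Finset.mem_of_mem_erase hy)]
    funext s
    have h3 := hval Y h2 s
    rw [h1, ← hm, hval _ hi s] at h3
    exact (mul_left_cancel₀ (by simp) h3).symm

/-! ### Distributions, supplements and duplicates are definable -/

namespace SOFormula

variable {L : FirstOrder.Language.{u, v}} {A : Type w} [Fintype A] [Nonempty A] [L.Structure A]

/-- The team over `D` stored in a function variable. -/
noncomputable def _root_.ProbTeam.FunInterp.team (E : FunInterp A) (D : Finset ℕ) (f : ℕ) : Team D A :=
  fun t => E D.card f (tup D t.val)

theorem exists_update_team (E : FunInterp A) (D : Finset ℕ) (f : ℕ) (X : Team D A) :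
    ∃ g, (E.update D.card f g).team D f = X := by
  obtain ⟨g, hg⟩ := exists_tup_eq D X
  exact ⟨g, funext fun t => by simp [FunInterp.team, hg]⟩

theorem team_update_of_ne (E : FunInterp A) {D : Finset ℕ} {n f f' : ℕ} (h : f' ≠ f)
    (g : (Fin n → A) → ℝ) : (E.update n f g).team D f' = E.team D f' := by
  funext t
  rw [FunInterp.team, FunInterp.update_of_ne E g h, FunInterp.team]

theorem tup_ofFun (D : Finset ℕ) (t : ℕ → A) : tup D (Assignment.ofFun D t).val = tup D t :=
  tup_congr fun _ hx => Assignment.val_ofFun hx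

/-- The weight function `g` is a distribution over `D`. -/
noncomputable def isDist (D : Finset ℕ) (g : ℕ) : SOFormula L :=
  and (allBlk 0 D (isNonneg D.card g (blkVars 0 D))) <| exFun D.card (g + 1) <|
    and (marginal D ∅ g (g + 1)) (allBlk 0 D (isOne (.appBlk (g + 1) D 0)))

-- The marginal on the empty set of variables is the constant function whose value is the total
-- weight.
@[simp] theorem sat_isDist (D : Finset ℕ) (g : ℕ) (E : FunInterp A) (s : ℕ → A) :
    (isDist (L := L) D g).Sat E s ↔ IsDistribution (E.team D g) := by
  have hg : g ≠ g + 1 := by omega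
  simp only [isDist, Sat, sat_allBlk, sat_isNonneg, apply_blkVars, readBlk_setBlk,
    sat_marginal (Finset.empty_subset D), FunInterp.update_same, FunInterp.update_of_ne, ne_eq, hg,
    not_false_eq_true, sat_isOne, NumTerm.eval_appBlk]
  refine and_congr Iff.rfl ?_
  have hp : ∀ b : Assignment D A, Team.prob (D := D) (fun a => E D.card g (tup D a.val))
      (AgreeOn ∅ b.val) = ∑ t, E.team D g t := fun b => by simp [Team.prob, AgreeOn, FunInterp.team]
  constructor
  · rintro ⟨h, h1, h2⟩
    rw [← hp (Classical.arbitrary _), ← h1, h2]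
  · intro h
    exact ⟨fun _ => 1, fun b => by rw [hp, h], fun _ => rfl⟩

/-- The teams `f` over `D` and `f + 1` over `D ∪ {x}` have the same marginals off `x`. -/
noncomputable def sameMarginals (D : Finset ℕ) (x f : ℕ) : SOFormula L :=
  exFun D.card (f + 2) <| exFun (insert x D).card (f + 3) <|
    and (marginal D (D.erase x) f (f + 2)) <|
    and (marginal (insert x D) (D.erase x) (f + 1) (f + 3)) <|
    allBlk 0 (insert x D) (numEq (.appBlk (f + 2) D 0) (.appBlk (f + 3) (insert x D) 0))

/-- The two marginals are stored in functions of possibly different arities, so they are compared at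
assignments of `D ∪ {x}`, whose restrictions exhaust the assignments of `D`. -/
theorem sat_sameMarginals (D : Finset ℕ) (x f : ℕ) (E : FunInterp A) (s : ℕ → A) :
    (sameMarginals (L := L) D x f).Sat E s ↔ ∀ t : Assignment D A,
      (E.team (insert x D) (f + 1)).prob (AgreeOn (D.erase x) t.val) =
        (E.team D f).prob (AgreeOn (D.erase x) t.val) := by
  have h1 : D.erase x ⊆ insert x D := (Finset.erase_subset _ _).trans (Finset.subset_insert _ _)
  have e1 : f ≠ f + 2 := by omega
  have e2 : f ≠ f + 3 := by omega
  have e3 : f + 1 ≠ f + 2 := by omega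
  have e4 : f + 1 ≠ f + 3 := by omega
  have e5 : f + 2 ≠ f + 3 := by omega
  simp only [sameMarginals, Sat, sat_allBlk, sat_marginal (Finset.erase_subset x D),
    sat_marginal h1, NumTerm.eval_appBlk, FunInterp.update_same,
    FunInterp.update_of_ne, ne_eq, e1, e2, e3, e4, e5, not_false_eq_true, readBlk_setBlk,
    readBlk_setBlk_of_subset (Finset.subset_insert x D)]
  have hag : ∀ (D' : Finset ℕ) (t : ℕ → A), D.erase x ⊆ D' →
      AgreeOn (D.erase x) t = AgreeOn (D.erase x) (Assignment.ofFun D' t).val := by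
    intro D' t hD'
    refine AgreeOn.congr_left fun y hy => ?_
    rw [Assignment.val_ofFun (hD' hy)]
  constructor
  · rintro ⟨g, h, hg, hh, hgh⟩ t
    have h2 := hgh (Assignment.ofFun _ t.val)
    rw [hh, ← hag _ _ h1, show tup D (Assignment.ofFun (insert x D) t.val).val = tup D t.val from
      tup_congr fun y hy => Assignment.val_ofFun (Finset.mem_insert_of_mem hy), hg] at h2
    exact h2.symm
  · intro h
    obtain ⟨g, hg⟩ := exists_tup_eq D fun t : Assignment D A =>
      (E.team D f).prob (AgreeOn (D.erase x) t.val)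
    obtain ⟨g', hg'⟩ := exists_tup_eq (insert x D) fun t : Assignment (insert x D) A =>
      (E.team (insert x D) (f + 1)).prob (AgreeOn (D.erase x) t.val)
    refine ⟨g, g', hg, hg', fun t => ?_⟩
    rw [hg', ← tup_ofFun D, hg, ← h, ← hag _ _ (Finset.erase_subset _ _)]

/-- The team `f + 1` over `D ∪ {x}` is of the form `X(F/x)` for the team `X` stored in `f`. -/
noncomputable def isSupplement (D : Finset ℕ) (x f : ℕ) : SOFormula L :=
  and (allBlk 0 (insert x D) (isNonneg (insert x D).card (f + 1) (blkVars 0 (insert x D))))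
    (sameMarginals D x f)

/-- By `exists_supplement_eq` the kernel can be eliminated: nonnegativity and the right marginals
off `x` characterise the teams it produces. -/
theorem sat_isSupplement (D : Finset ℕ) (x f : ℕ) (E : FunInterp A) (s : ℕ → A)
    (hX : IsDistribution (E.team D f)) :
    (isSupplement (L := L) D x f).Sat E s ↔ ∃ F : Assignment D A → A → ℝ,
      (∀ s, IsDistribution (F s)) ∧ (E.team D f).supplement x F = E.team (insert x D) (f + 1) := by
  simp only [isSupplement, Sat, sat_allBlk, sat_isNonneg, apply_blkVars, readBlk_setBlk,
    sat_sameMarginals]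
  constructor
  · rintro ⟨h1, h2⟩
    exact exists_supplement_eq hX h1 h2
  · rintro ⟨F, hF, h⟩
    rw [← h]
    refine ⟨fun t => ?_, fun t => Team.prob_supplement_of_erase hF (dependsOn_agreeOn _ _)⟩
    have := (hX.supplement x hF).1 t
    rwa [h] at this

/-- The team `f + 1` over `D ∪ {x}` is `X(A/x)` for the team `X` stored in `f`. -/
noncomputable def isDuplicate (D : Finset ℕ) (x f : ℕ) : SOFormula L :=
  and (sameMarginals D x f) <| allBlk 0 (insert x D) <| allBlk 1 (insert x D) <|
    imp (agree (D.erase x) 0 1)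
      (numEq (.appBlk (f + 1) (insert x D) 0) (.appBlk (f + 1) (insert x D) 1))

/-- `Team.eq_duplicate_iff` describes uniformity without mentioning the cardinality of `A`, which no
numerical term denotes. -/
theorem sat_isDuplicate (D : Finset ℕ) (x f : ℕ) (E : FunInterp A) (s : ℕ → A) :
    (isDuplicate (L := L) D x f).Sat E s ↔
      E.team (insert x D) (f + 1) = (E.team D f).duplicate x := by
  have h1 : D.erase x ⊆ insert x D := (Finset.erase_subset _ _).trans (Finset.subset_insert _ _)
  have hag : ∀ a b : Assignment (insert x D) A, (agree (L := L) (D.erase x) 0 1).Sat E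
      (setBlk (setBlk s 0 (insert x D) a.val) 1 (insert x D) b.val) ↔
      AgreeOn (D.erase x) b.val a.val := fun a b => sat_agree_of_subset h1
    (fun x hx => by rw [setBlk_of_ne zero_ne_one, setBlk_of_mem hx])
    (fun x hx => by rw [setBlk_of_mem hx])
  simp only [isDuplicate, Sat, sat_allBlk, sat_sameMarginals, sat_imp, hag, NumTerm.eval_appBlk,
    readBlk_setBlk, readBlk_setBlk_of_ne zero_ne_one, Team.eq_duplicate_iff]
  rfl

end SOFormula

/-! ### From team logic to second-order logic -/

namespace SOFormula

variable {L : FirstOrder.Language.{u, v}} {A : Type w} [Fintype A] [Nonempty A] [L.Structure A]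

/-- The formula holds for all assignments in the support of the team `f`. -/
noncomputable def onSupport (D : Finset ℕ) (f : ℕ) (χ : SOFormula L) : SOFormula L :=
  allBlk 0 D (imp (isZero (.appBlk f D 0)).neg χ)

theorem sat_onSupport {D : Finset ℕ} {f : ℕ} {χ : SOFormula L} {E : FunInterp A} {s : ℕ → A}
    {p : (ℕ → A) → Prop}
    (h : ∀ t : Assignment D A, χ.Sat E (setBlk s 0 D t.val) ↔ p t.val) :
    (onSupport D f χ).Sat E s ↔ ∀ t, E.team D f t ≠ 0 → p t.val := by
  simp only [onSupport, sat_allBlk, sat_imp, sat_neg, sat_isZero, NumTerm.eval_appBlk,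
    readBlk_setBlk, h]
  rfl

/-- The independence atom for the team `f`. -/
noncomputable def isIndep (D : Finset ℕ) (f : ℕ) (x y z : List ℕ) : SOFormula L :=
  exFun D.card (f + 1) <| exFun D.card (f + 2) <| exFun D.card (f + 3) <| exFun D.card (f + 4) <|
    and (marginal D (x ++ y).toFinset f (f + 1)) <|
    and (marginal D (x ++ z).toFinset f (f + 2)) <|
    and (marginal D (x ++ y ++ z).toFinset f (f + 3)) <|
    and (marginal D x.toFinset f (f + 4)) <|
    allBlk 0 D (numEq (.mul (.appBlk (f + 1) D 0) (.appBlk (f + 2) D 0))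
      (.mul (.appBlk (f + 3) D 0) (.appBlk (f + 4) D 0)))

/-- The four weights in the atom are marginals. Each is stored as a function of the whole assignment
of `D`, so one universally quantified block evaluates all of them. -/
theorem sat_isIndep (c : SplitConvention) (D : Finset ℕ) (f : ℕ) (x y z : List ℕ)
    (h : (x ++ y ++ z).toFinset ⊆ D) (E : FunInterp A) (s : ℕ → A) :
    (isIndep (L := L) D f x y z).Sat E s ↔
      (TeamFormula.indep (L := L) x y z).Sat c D (E.team D f) := by
  have s1 : (x ++ y).toFinset ⊆ D := by
    refine subset_trans (fun i hi => ?_) h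
    simp only [List.mem_toFinset, List.mem_append] at hi ⊢
    tauto
  have s2 : (x ++ z).toFinset ⊆ D := by
    refine subset_trans (fun i hi => ?_) h
    simp only [List.mem_toFinset, List.mem_append] at hi ⊢
    tauto
  have s3 : x.toFinset ⊆ D := by
    refine subset_trans (fun i hi => ?_) h
    simp only [List.mem_toFinset, List.mem_append] at hi ⊢
    tauto
  have e01 : f ≠ f + 1 := by omega
  have e02 : f ≠ f + 2 := by omega
  have e03 : f ≠ f + 3 := by omega
  have e04 : f ≠ f + 4 := by omega
  have e12 : f + 1 ≠ f + 2 := by omega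
  have e13 : f + 1 ≠ f + 3 := by omega
  have e14 : f + 1 ≠ f + 4 := by omega
  have e23 : f + 2 ≠ f + 3 := by omega
  have e24 : f + 2 ≠ f + 4 := by omega
  have e34 : f + 3 ≠ f + 4 := by omega
  simp only [isIndep, Sat, sat_allBlk, sat_marginal s1, sat_marginal s2, sat_marginal s3,
    sat_marginal h, NumTerm.eval, NumTerm.eval_appBlk, FunInterp.update_same,
    FunInterp.update_of_ne, ne_eq, e01, e02, e03, e04, e12, e13, e14, e23, e24, e34,
    not_false_eq_true, readBlk_setBlk, TeamFormula.Sat, Team.weight_map]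
  have hag : ∀ (S : Finset ℕ) (t : ℕ → A), S ⊆ D →
      AgreeOn S t = AgreeOn S (Assignment.ofFun D t).val := by
    intro S t hS
    refine AgreeOn.congr_left fun y hy => ?_
    rw [Assignment.val_ofFun (hS hy)]
  constructor
  · rintro ⟨g1, g2, g3, g4, h1, h2, h3, h4, h5⟩ t
    have := h5 (Assignment.ofFun D t)
    rw [h1, h2, h3, h4, ← hag _ _ s1, ← hag _ _ s2, ← hag _ _ s3, ← hag _ _ h] at this
    exact this
  · intro h5
    have hex := fun S => exists_tup_eq D fun t : Assignment D A =>
      (E.team D f).prob (AgreeOn S t.val)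
    choose g hg using hex
    refine ⟨g _, g _, g _, g _, hg _, hg _, hg _, hg _, fun t => ?_⟩
    rw [hg, hg, hg, hg]
    exact h5 t.val

/-- The requirement on a component of a scaled union. -/
def part (c : SplitConvention) (i : NumTerm) (φ : SOFormula L) : SOFormula L :=
  match c with
  | .strict => φ
  | .vacuous => or (isZero i) φ

theorem sat_part (c : SplitConvention) (i : NumTerm) (φ : SOFormula L) (E : FunInterp A)
    (s : ℕ → A) : (part c i φ).Sat E s ↔ c.part (i.eval E s) (φ.Sat E s) := by
  cases c <;> simp [part, SplitConvention.part, Sat]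

open NumTerm in
/-- The team `f` is a scaled union of teams `f + 1` satisfying `φ` and `f + 2` satisfying `ψ`. -/
noncomputable def isUnion (c : SplitConvention) (D : Finset ℕ) (f : ℕ) (φ ψ : SOFormula L) :
    SOFormula L :=
  exFun D.card (f + 1) <| exFun D.card (f + 2) <| exFun 0 (f + 3) <| exFun 0 (f + 4) <|
    and (isNonneg 0 (f + 3) Fin.elim0) <| and (isNonneg 0 (f + 4) Fin.elim0) <|
    and (isOne (add (app 0 (f + 3) Fin.elim0) (app 0 (f + 4) Fin.elim0))) <|
    and (isDist D (f + 1)) <| and (isDist D (f + 2)) <|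
    and (allBlk 0 D (numEq (add (mul (app 0 (f + 3) Fin.elim0) (appBlk (f + 1) D 0))
      (mul (app 0 (f + 4) Fin.elim0) (appBlk (f + 2) D 0))) (appBlk f D 0))) <|
    and (part c (app 0 (f + 3) Fin.elim0) φ) (part c (app 0 (f + 4) Fin.elim0) ψ)

/-- The scaling factors are 0-ary function variables, nonnegative with sum one. The hypotheses on
`φ` and `ψ` range over all interpretations, so values stored under other names do not matter as long
as the two component teams are kept. -/
theorem sat_isUnion (c : SplitConvention) (D : Finset ℕ) (f : ℕ) (φ ψ : SOFormula L)
    (E : FunInterp A) (s : ℕ → A) (P Q : Team D A → Prop)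
    (hφ : ∀ E' : FunInterp A, IsDistribution (E'.team D (f + 1)) →
      (φ.Sat E' s ↔ P (E'.team D (f + 1))))
    (hψ : ∀ E' : FunInterp A, IsDistribution (E'.team D (f + 2)) →
      (ψ.Sat E' s ↔ Q (E'.team D (f + 2)))) :
    (isUnion c D f φ ψ).Sat E s ↔ ∃ (k : ℝ) (Y Z : Team D A), 0 ≤ k ∧ k ≤ 1 ∧
      IsDistribution Y ∧ IsDistribution Z ∧ Team.scaledUnion k Y Z = E.team D f ∧
      c.part k (P Y) ∧ c.part (1 - k) (Q Z) := by
  have e01 : f ≠ f + 1 := by omega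
  have e02 : f ≠ f + 2 := by omega
  have e03 : f ≠ f + 3 := by omega
  have e04 : f ≠ f + 4 := by omega
  have e12 : f + 1 ≠ f + 2 := by omega
  have e13 : f + 1 ≠ f + 3 := by omega
  have e14 : f + 1 ≠ f + 4 := by omega
  have e23 : f + 2 ≠ f + 3 := by omega
  have e24 : f + 2 ≠ f + 4 := by omega
  have e34 : f + 3 ≠ f + 4 := by omega
  simp only [isUnion, Sat, sat_allBlk, sat_isNonneg, sat_isOne, sat_isDist, sat_part,
    NumTerm.eval, NumTerm.eval_appBlk, FunInterp.update_same,
    FunInterp.update_of_ne, ne_eq, e01, e02, e03, e04, e12, e13, e14, e23, e24, e34,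
    not_false_eq_true, readBlk_setBlk, team_update_of_ne]
  constructor
  · rintro ⟨Y, Z, k, k', hk, hk', h1, hY, hZ, hu, hp, hq⟩
    have hk1 : k' (fun i => s (Fin.elim0 i)) = 1 - k fun i => s (Fin.elim0 i) := by linarith
    refine ⟨k fun i => s (Fin.elim0 i), _, _, hk, by linarith, hY, hZ, ?_, ?_, ?_⟩
    · funext t
      have := hu t
      rw [Subsingleton.elim (fun i => setBlk s 0 D t.val (Fin.elim0 i)) fun i => s (Fin.elim0 i),
        hk1] at this
      simpa [Team.scaledUnion, FunInterp.team, FunInterp.update_of_ne _ _ e12] using this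
    · have h2 := hφ ((((E.update D.card (f + 1) Y).update D.card (f + 2) Z).update 0 (f + 3)
        k).update 0 (f + 4) k') (by simpa only [team_update_of_ne, ne_eq, e12, e13, e14,
          not_false_eq_true] using hY)
      rw [h2] at hp
      simpa only [team_update_of_ne, ne_eq, e12, e13, e14, not_false_eq_true] using hp
    · have h2 := hψ ((((E.update D.card (f + 1) Y).update D.card (f + 2) Z).update 0 (f + 3)
        k).update 0 (f + 4) k') (by simpa only [team_update_of_ne, ne_eq, e23, e24,
          not_false_eq_true] using hZ)
      rw [h2, hk1] at hq
      simpa only [team_update_of_ne, ne_eq, e23, e24, not_false_eq_true] using hq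
  · rintro ⟨k, Y, Z, hk, hk1, hY, hZ, hu, hp, hq⟩
    obtain ⟨gY, hgY⟩ := exists_update_team E D (f + 1) Y
    obtain ⟨gZ, hgZ⟩ := exists_update_team (E.update D.card (f + 1) gY) D (f + 2) Z
    refine ⟨gY, gZ, fun _ => k, fun _ => 1 - k, hk, sub_nonneg.2 hk1, by ring, hgY ▸ hY,
      hgZ ▸ hZ, fun t => ?_, ?_, ?_⟩
    · have := congrFun hu t
      rw [← hgY, ← hgZ] at this
      simpa [Team.scaledUnion, FunInterp.team] using this
    · rwa [hφ, team_update_of_ne _ e14, team_update_of_ne _ e13, team_update_of_ne _ e12, hgY]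
      rwa [team_update_of_ne _ e14, team_update_of_ne _ e13, team_update_of_ne _ e12, hgY]
    · rwa [hψ, team_update_of_ne _ e24, team_update_of_ne _ e23, hgZ]
      rwa [team_update_of_ne _ e24, team_update_of_ne _ e23, hgZ]

end SOFormula

/-- Satisfaction of a team formula is definable in second-order logic. -/
theorem TeamFormula.exists_soFormula {L : FirstOrder.Language.{u, v}} (c : SplitConvention)
    (φ : TeamFormula L) : ∀ (D : Finset ℕ), φ.freeVars ⊆ D → ∀ f : ℕ, ∃ ψ : SOFormula L,
      ∀ (A : Type w) [Fintype A] [Nonempty A] [L.Structure A] (E : FunInterp A) (s : ℕ → A),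
        IsDistribution (E.team D f) → (φ.Sat c D (E.team D f) ↔ ψ.Sat E s) := by
  induction φ with
  | eq x y =>
    intro D hD f
    have hx : x ∈ D := hD (by simp [freeVars])
    have hy : y ∈ D := hD (by simp [freeVars])
    refine ⟨.onSupport D f (.eq (Nat.pair 0 x) (Nat.pair 0 y)), fun A _ _ _ E s _ => ?_⟩
    rw [SOFormula.sat_onSupport (p := fun t => t x = t y) fun t => by
      simp [SOFormula.Sat, setBlk_of_mem, hx, hy]]
    rfl
  | neq x y =>
    intro D hD f
    have hx : x ∈ D := hD (by simp [freeVars])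
    have hy : y ∈ D := hD (by simp [freeVars])
    refine ⟨.onSupport D f (.neq (Nat.pair 0 x) (Nat.pair 0 y)), fun A _ _ _ E s _ => ?_⟩
    rw [SOFormula.sat_onSupport (p := fun t => t x ≠ t y) fun t => by
      simp [SOFormula.Sat, setBlk_of_mem, hx, hy]]
    rfl
  | rel R x =>
    intro D hD f
    have hx : ∀ i, x i ∈ D := fun i => hD (by simp [freeVars])
    refine ⟨.onSupport D f (.rel R fun i => Nat.pair 0 (x i)), fun A _ _ _ E s _ => ?_⟩
    rw [SOFormula.sat_onSupport (p := fun t => FirstOrder.Language.Structure.RelMap R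
      fun i => t (x i)) fun t => by simp [SOFormula.Sat, setBlk_of_mem, hx]]
    rfl
  | nrel R x =>
    intro D hD f
    have hx : ∀ i, x i ∈ D := fun i => hD (by simp [freeVars])
    refine ⟨.onSupport D f (.nrel R fun i => Nat.pair 0 (x i)), fun A _ _ _ E s _ => ?_⟩
    rw [SOFormula.sat_onSupport (p := fun t => ¬ FirstOrder.Language.Structure.RelMap R
      fun i => t (x i)) fun t => by simp [SOFormula.Sat, setBlk_of_mem, hx]]
    rfl
  | indep x y z =>
    intro D hD f
    exact ⟨.isIndep D f x y z, fun A _ _ _ E s _ => (SOFormula.sat_isIndep c D f x y z hD E s).symm⟩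
  | bneg φ ih =>
    intro D hD f
    obtain ⟨ψ, hψ⟩ := ih D hD f
    exact ⟨ψ.neg, fun A _ _ _ E s hX => by rw [SOFormula.sat_neg, ← hψ A E s hX]; rfl⟩
  | and φ₁ φ₂ ih₁ ih₂ =>
    intro D hD f
    obtain ⟨ψ₁, h₁⟩ := ih₁ D (Finset.union_subset_left hD) f
    obtain ⟨ψ₂, h₂⟩ := ih₂ D (Finset.union_subset_right hD) f
    exact ⟨ψ₁.and ψ₂, fun A _ _ _ E s hX => by
      rw [SOFormula.Sat, ← h₁ A E s hX, ← h₂ A E s hX]; rfl⟩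
  | or φ₁ φ₂ ih₁ ih₂ =>
    intro D hD f
    -- The components get the names `f + 1` and `f + 2`, as `SOFormula.isUnion` prescribes. Each
    -- translation depends on its own team only, so clashes with names used inside do no harm.
    obtain ⟨ψ₁, h₁⟩ := ih₁ D (Finset.union_subset_left hD) (f + 1)
    obtain ⟨ψ₂, h₂⟩ := ih₂ D (Finset.union_subset_right hD) (f + 2)
    refine ⟨.isUnion c D f ψ₁ ψ₂, fun A _ _ _ E s hX => ?_⟩
    rw [SOFormula.sat_isUnion c D f ψ₁ ψ₂ E s (φ₁.Sat c D) (φ₂.Sat c D)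
      (fun E' h => (h₁ A E' s h).symm) (fun E' h => (h₂ A E' s h).symm)]
    rfl
  | ex x φ ih =>
    intro D hD f
    -- The new team needs a name different from `f`: both teams are compared, and their arities
    -- coincide if `x ∈ D`.
    obtain ⟨ψ, hψ⟩ := ih (insert x D) (Finset.subset_insert_iff.2 hD) (f + 1)
    refine ⟨.exFun (insert x D).card (f + 1) (.and (.isSupplement D x f) ψ),
      fun A _ _ _ E s hX => ?_⟩
    have hE : ∀ g, (E.update (insert x D).card (f + 1) g).team D f = E.team D f := fun g =>
      SOFormula.team_update_of_ne E (by omega) g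
    constructor
    · rintro ⟨F, hF, h⟩
      obtain ⟨g, hg⟩ := SOFormula.exists_update_team E (insert x D) (f + 1)
        ((E.team D f).supplement x F)
      refine ⟨g, ?_, ?_⟩
      · rw [SOFormula.sat_isSupplement _ _ _ _ _ (by rwa [hE])]
        exact ⟨F, hF, by rw [hE, hg]⟩
      · rw [← hψ A _ s (by rw [hg]; exact hX.supplement x hF), hg]
        exact h
    · rintro ⟨g, h1, h2⟩
      rw [SOFormula.sat_isSupplement _ _ _ _ _ (by rwa [hE])] at h1
      obtain ⟨F, hF, h1⟩ := h1
      rw [hE] at h1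
      refine ⟨F, hF, ?_⟩
      rw [h1, hψ A _ s]
      · exact h2
      · rw [← h1]
        exact hX.supplement x hF
  | all x φ ih =>
    intro D hD f
    obtain ⟨ψ, hψ⟩ := ih (insert x D) (Finset.subset_insert_iff.2 hD) (f + 1)
    refine ⟨.exFun (insert x D).card (f + 1) (.and (.isDuplicate D x f) ψ),
      fun A _ _ _ E s hX => ?_⟩
    have hE : ∀ g, (E.update (insert x D).card (f + 1) g).team D f = E.team D f := fun g =>
      SOFormula.team_update_of_ne E (by omega) g
    constructor
    · intro h
      obtain ⟨g, hg⟩ := SOFormula.exists_update_team E (insert x D) (f + 1)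
        ((E.team D f).duplicate x)
      refine ⟨g, ?_, ?_⟩
      · rw [SOFormula.sat_isDuplicate, hE, hg]
      · rw [← hψ A _ s (by rw [hg]; exact hX.duplicate x), hg]
        exact h
    · rintro ⟨g, h1, h2⟩
      rw [SOFormula.sat_isDuplicate, hE] at h1
      rw [← hψ A _ s (by rw [h1]; exact hX.duplicate x), h1] at h2
      exact h2

/-! ### Closing formulas by vacuous quantification -/

namespace SOFormula

variable {L : FirstOrder.Language.{u, v}}

/-- Existential quantification over a list of first-order variables. -/
def exVars (l : List ℕ) (φ : SOFormula L) : SOFormula L := l.foldr ex φ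

/-- Existential quantification over a list of function variables. -/
def exFuns (l : List (ℕ × ℕ)) (φ : SOFormula L) : SOFormula L :=
  l.foldr (fun p ψ => exFun p.1 p.2 ψ) φ

theorem freeVars_exVars (l : List ℕ) (φ : SOFormula L) :
    (exVars l φ).freeVars = φ.freeVars \ l.toFinset := by
  induction l with
  | nil => simp [exVars]
  | cons x l ih =>
    have : exVars (x :: l) φ = ex x (exVars l φ) := rfl
    rw [this, freeVars, ih]
    ext y
    simp only [Finset.mem_erase, Finset.mem_sdiff, List.toFinset_cons, Finset.mem_insert]
    tauto

theorem freeFuns_exVars (l : List ℕ) (φ : SOFormula L) :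
    (exVars l φ).freeFuns = φ.freeFuns := by
  induction l with
  | nil => rfl
  | cons x l ih => exact ih

theorem freeVars_exFuns (l : List (ℕ × ℕ)) (φ : SOFormula L) :
    (exFuns l φ).freeVars = φ.freeVars := by
  induction l with
  | nil => rfl
  | cons x l ih => exact ih

theorem freeFuns_exFuns (l : List (ℕ × ℕ)) (φ : SOFormula L) :
    (exFuns l φ).freeFuns = φ.freeFuns \ l.toFinset := by
  induction l with
  | nil => simp [exFuns]
  | cons x l ih =>
    have : exFuns (x :: l) φ = exFun x.1 x.2 (exFuns l φ) := rfl
    rw [this, freeFuns, ih]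
    ext y
    simp only [Finset.mem_erase, Finset.mem_sdiff, List.toFinset_cons, Finset.mem_insert]
    tauto

theorem sat_exVars {A : Type w} [Nonempty A] [L.Structure A] {l : List ℕ} {φ : SOFormula L}
    {E : FunInterp A} {P : Prop} (h : ∀ s, φ.Sat E s ↔ P) (s : ℕ → A) :
    (exVars l φ).Sat E s ↔ P := by
  induction l generalizing s with
  | nil => exact h s
  | cons x l ih =>
    have : exVars (x :: l) φ = ex x (exVars l φ) := rfl
    simp [this, Sat, ih]

theorem sat_exFuns {A : Type w} [L.Structure A] {l : List (ℕ × ℕ)} {φ : SOFormula L}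
    {s : ℕ → A} {K : FunInterp A → Prop} {P : Prop}
    (hK : ∀ E, K E → ∀ p ∈ l, ∀ g, K (E.update p.1 p.2 g))
    (h : ∀ E, K E → (φ.Sat E s ↔ P)) (E : FunInterp A) (hE : K E) :
    (exFuns l φ).Sat E s ↔ P := by
  induction l generalizing E with
  | nil => exact h E hE
  | cons x l ih =>
    have h1 : exFuns (x :: l) φ = exFun x.1 x.2 (exFuns l φ) := rfl
    have h2 : ∀ g, (exFuns l φ).Sat (E.update x.1 x.2 g) s ↔ P := fun g =>
      ih (fun E hE p hp => hK E hE p (by simp [hp])) _ (hK E hE x (by simp) g)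
    simp [h1, Sat, h2]

/-- Variables that do not influence the truth of a formula can be quantified away. -/
theorem exists_closed (ψ : SOFormula L) (S : Finset (ℕ × ℕ)) :
    ∃ ψ' : SOFormula L, ψ'.freeVars = ∅ ∧ ψ'.freeFuns ⊆ S ∧
      ∀ (A : Type w) [Nonempty A] [L.Structure A] (E : FunInterp A) (s : ℕ → A) (P : Prop),
        (∀ (E' : FunInterp A) (s' : ℕ → A), (∀ p ∈ S, E' p.1 p.2 = E p.1 p.2) →
          (ψ.Sat E' s' ↔ P)) → (ψ'.Sat E s ↔ P) := by
  -- Existential quantifiers are harmless here, since the truth value is assumed to be the same for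
  -- every choice and the domain is nonempty.
  refine ⟨exFuns (ψ.freeFuns \ S).toList (exVars ψ.freeVars.toList ψ), ?_, ?_, ?_⟩
  · rw [freeVars_exFuns, freeVars_exVars]
    simp
  · rw [freeFuns_exFuns, freeFuns_exVars]
    simp
  · intro A _ _ E s P h
    refine sat_exFuns (K := fun E' => ∀ p ∈ S, E' p.1 p.2 = E p.1 p.2) ?_ ?_ E fun _ _ => rfl
    · intro E' hE' p hp g q hq
      rw [← hE' q hq]
      have hpq : q ≠ p := by
        rintro rfl
        simp [hq] at hp
      by_cases h2 : q.2 = p.2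
      · have h1 : q.1 ≠ p.1 := fun h1 => hpq (Prod.ext h1 h2)
        simp [FunInterp.update, h1]
      · exact FunInterp.update_of_ne _ _ h2
    · exact fun E' hE' => sat_exVars (fun s' => h E' s' hE') s

end SOFormula

theorem isDistribution_trivial (A : Type w) [Fintype A] : IsDistribution (Team.trivial A) :=
  ⟨fun _ => zero_le_one, by simp [Team.trivial]⟩

/-- The trivial team is definable as the 0-ary function with value one, so it can be quantified; the
remaining free variables are removed by `SOFormula.exists_closed`. -/
theorem exists_soFormula_of_sentence {L : FirstOrder.Language.{u, v}} (c : SplitConvention)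
    (φ : TeamFormula L) (hφ : φ.freeVars = ∅) :
    ∃ ψ : SOFormula L, ψ.freeVars = ∅ ∧ ψ.freeFuns = ∅ ∧ EquivSentences.{u, v, w} c φ ψ := by
  obtain ⟨ψ, hψ⟩ := φ.exists_soFormula c ∅ hφ.le 0
  obtain ⟨ψ', h1, h2, h3⟩ := SOFormula.exists_closed.{u, v, w}
    (.exFun (∅ : Finset ℕ).card 0 (.and (.allBlk 0 ∅ (.isOne (.appBlk 0 ∅ 0))) ψ)) ∅
  refine ⟨ψ', h1, Finset.subset_empty.1 h2, fun A _ _ _ E s =>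
    (h3 A E s _ fun E' s' _ => ?_).symm⟩
  have key : ∀ g, (E'.update (∅ : Finset ℕ).card 0 g).team ∅ 0 = Team.trivial A →
      (φ.Sat c ∅ (Team.trivial A) ↔ ψ.Sat (E'.update (∅ : Finset ℕ).card 0 g) s') := by
    intro g hg
    rw [← hψ A _ s' (by rw [hg]; exact isDistribution_trivial A), hg]
  simp only [SOFormula.Sat, SOFormula.sat_allBlk, SOFormula.sat_isOne, NumTerm.eval_appBlk,
    readBlk_setBlk]
  constructor
  · rintro ⟨g, hg, h⟩
    exact (key g (funext hg)).2 h
  · intro h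
    obtain ⟨g, hg⟩ := SOFormula.exists_update_team E' ∅ 0 (Team.trivial A)
    exact ⟨g, congrFun hg, (key g hg).1 h⟩

/-- The function `f` lists its arguments in the order of `x`, the recursion in increasing order of
the variables. A quantified copy named `f + 1` mediates between the two. -/
theorem exists_soFormula_of_formula {L : FirstOrder.Language.{u, v}} (c : SplitConvention)
    {k : ℕ} (x : Fin k ↪ ℕ) (f : ℕ) (φ : TeamFormula L) (hφ : φ.freeVars ⊆ Finset.univ.map x) :
    ∃ ψ : SOFormula L, ψ.freeVars = ∅ ∧ ψ.freeFuns = {(k, f)} ∧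
      EquivFormulas.{u, v, w} c x f φ ψ := by
  obtain ⟨ψ, hψ⟩ := φ.exists_soFormula c _ hφ (f + 1)
  set D := Finset.univ.map x with hD
  obtain ⟨ψ', h1, h2, h3⟩ := SOFormula.exists_closed.{u, v, w}
    (.exFun D.card (f + 1) (.and (.allBlk 0 D
      (.numEq (.appBlk (f + 1) D 0) (.app k f fun i => Nat.pair 0 (x i)))) ψ)) {(k, f)}
  -- The set of free function variables has to be exactly `{(k, f)}`, so a tautology mentioning `f`
  -- is conjoined.
  refine ⟨.and ψ' (.all 0 (.numEq (.app k f fun _ => 0) (.app k f fun _ => 0))), ?_, ?_, ?_⟩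
  · simp only [SOFormula.freeVars, NumTerm.vars, h1, Finset.empty_union, Finset.union_idempotent]
    ext y
    simp only [Finset.mem_erase, Finset.mem_image, Finset.notMem_empty, iff_false, not_and]
    rintro hy ⟨_, _, rfl⟩
    exact hy rfl
  · simp only [SOFormula.freeFuns, NumTerm.funs, Finset.union_idempotent]
    exact Finset.union_eq_right.2 h2
  · intro A _ _ _ X hX E s hE
    have hdummy : ∀ P : Prop, (P ↔ ψ'.Sat E s) → (P ↔ SOFormula.Sat (.and ψ'
        (.all 0 (.numEq (.app k f fun _ => 0) (.app k f fun _ => 0)))) E s) := by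
      intro P hP
      simp [SOFormula.Sat, hP]
    refine hdummy _ (h3 A E s _ fun E' s' hE' => ?_).symm
    have hk : E' k f = E k f := hE' (k, f) (by simp)
    have key : ∀ g, (E'.update D.card (f + 1) g).team D (f + 1) = X →
        (φ.Sat c D X ↔ ψ.Sat (E'.update D.card (f + 1) g) s') := by
      intro g hg
      rw [← hψ A _ s' (by rw [hg]; exact hX), hg]
    have hx : ∀ i, x i ∈ D := fun i => by simp [hD]
    simp only [SOFormula.Sat, SOFormula.sat_allBlk, NumTerm.eval, NumTerm.eval_appBlk,
      readBlk_setBlk, FunInterp.update_of_ne _ _ (Nat.succ_ne_self f).symm, setBlk_of_mem (hx _),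
      hk, hE]
    constructor
    · rintro ⟨g, hg, h⟩
      exact (key g (funext hg)).2 h
    · intro h
      obtain ⟨g, hg⟩ := SOFormula.exists_update_team E' D (f + 1) X
      exact ⟨g, congrFun hg, (key g hg).1 h⟩

/-! ### Extensions of teams -/

section Extends

variable {A : Type w} [Fintype A] [Nonempty A] {D D' D'' : Finset ℕ}

/-- `X` is the marginal of `X'` on a smaller set of variables. -/
def Team.Extends (X' : Team D' A) (X : Team D A) : Prop :=
  D ⊆ D' ∧ ∀ p : (ℕ → A) → Prop, DependsOn p (D : Set ℕ) → X'.prob p = X.prob p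

theorem Team.Extends.refl (X : Team D A) : X.Extends X := ⟨subset_rfl, fun _ _ => rfl⟩

theorem Team.prob_agreeOn_self (X : Team D A) (t : Assignment D A) :
    X.prob (AgreeOn D t.val) = X t := by
  rw [Team.prob, Finset.sum_eq_single t]
  · exact if_pos fun _ _ => rfl
  · exact fun s _ hs => if_neg fun h => hs (Assignment.ext_val h)
  · simp

theorem Team.Extends.eq {X' X : Team D A} (h : X'.Extends X) : X' = X := by
  funext t
  rw [← X.prob_agreeOn_self, ← X'.prob_agreeOn_self, h.2 _ (dependsOn_agreeOn _ _)]

theorem Team.Extends.trans {X'' : Team D'' A} {X' : Team D' A} {X : Team D A}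
    (h' : X''.Extends X') (h : X'.Extends X) : X''.Extends X :=
  ⟨h.1.trans h'.1, fun p hp => (h'.2 p (hp.mono_finset h.1)).trans (h.2 p hp)⟩

/-- Holding on the support means having probability one, and extensions preserve the probabilities
of events over `D`. -/
theorem Team.Extends.forces_iff {X' : Team D' A} {X : Team D A} (h : X'.Extends X)
    (hX' : IsDistribution X') (hX : IsDistribution X) {p : (ℕ → A) → Prop}
    (hp : DependsOn p (D : Set ℕ)) : X'.Forces p ↔ X.Forces p := by
  rw [← Team.prob_eq_one_iff hX', ← Team.prob_eq_one_iff hX, h.2 p hp]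

/-- The extension of a team by variables that are chosen at random, given the team. -/
theorem Team.extends_law {Ω : Type*} [Fintype Ω] (X : Team D A) (m : Ω → ℝ)
    (U : Ω → ℕ → A) (h : D ⊆ D') (T : Ω → Assignment D A)
    (hU : ∀ ω, ∀ x ∈ D, U ω x = (T ω).val x)
    (hm : ∀ t, (∑ ω, if T ω = t then m ω else 0) = X t) : (Team.law D' m U).Extends X := by
  refine ⟨h, fun p hp => ?_⟩
  have h1 : ∀ ω, p (U ω) ↔ p (T ω).val := fun ω => by rw [hp (hU ω)]
  rw [Team.prob_law (hp.mono_finset h), Team.prob]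
  simp only [← hm, h1]
  have h2 : ∀ t : Assignment D A, (if p t.val then ∑ ω, (if T ω = t then m ω else 0) else 0) =
      ∑ ω, if T ω = t then (if p (T ω).val then m ω else 0) else 0 := by
    intro t
    by_cases ht : p t.val
    · rw [if_pos ht]
      refine Finset.sum_congr rfl fun ω _ => ?_
      split_ifs with h3 h4
      · rfl
      · exact absurd (h3 ▸ ht) h4
      · rfl
    · rw [if_neg ht, eq_comm]
      refine Finset.sum_eq_zero fun ω _ => ?_
      split_ifs with h3 h4
      · exact absurd (h3 ▸ h4) ht
      · rfl
      · rfl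
  rw [Finset.sum_congr rfl fun t _ => h2 t, Finset.sum_comm]
  simp

theorem Team.extends_law_val {X : Team D A} {U : Assignment D A → ℕ → A} (h : D ⊆ D')
    (hU : ∀ t, ∀ x ∈ D, U t x = t.val x) : (Team.law D' X U).Extends X :=
  Team.extends_law X X U h id hU fun t => by simp

/-- The variables `D` together with the variables of a list. -/
def addVars (D : Finset ℕ) : List ℕ → Finset ℕ
  | [] => D
  | y :: l => addVars (insert y D) l

theorem mem_addVars {l : List ℕ} {y : ℕ} : y ∈ addVars D l ↔ y ∈ D ∨ y ∈ l := by
  induction l generalizing D with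
  | nil => simp [addVars]
  | cons x l ih =>
    simp only [addVars, ih, Finset.mem_insert, List.mem_cons]
    tauto

theorem subset_addVars (D : Finset ℕ) (l : List ℕ) : D ⊆ addVars D l :=
  fun _ hx => mem_addVars.2 (Or.inl hx)

end Extends

namespace TeamFormula

variable {L : FirstOrder.Language.{u, v}} {A : Type w} [Fintype A] [Nonempty A] [L.Structure A]
  {c : SplitConvention} {D : Finset ℕ} {X : Team D A}

/-- For a new variable, `exists_supplement_eq` says that the teams `X(F/y)` are precisely the
distributions with marginal `X`. Later existence proofs can therefore construct extensions instead
of kernels. -/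
theorem sat_ex_iff (hX : IsDistribution X) {y : ℕ} (hy : y ∉ D) (φ : TeamFormula L) :
    (ex y φ).Sat c D X ↔ ∃ X' : Team (insert y D) A, IsDistribution X' ∧ X'.Extends X ∧
      φ.Sat c (insert y D) X' := by
  constructor
  · rintro ⟨F, hF, h⟩
    refine ⟨_, hX.supplement y hF, ⟨Finset.subset_insert _ _, fun p hp => ?_⟩, h⟩
    exact Team.prob_supplement_of_erase hF (by rwa [Finset.erase_eq_of_notMem hy])
  · rintro ⟨X', hX', hext, h⟩
    obtain ⟨F, hF, h1⟩ := exists_supplement_eq hX hX'.1 fun t => hext.2 _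
      ((dependsOn_agreeOn _ _).mono_finset (Finset.erase_subset y D))
    exact ⟨F, hF, by rwa [h1]⟩

/-- Existential quantification over a list of variables. -/
def exList : List ℕ → TeamFormula L → TeamFormula L
  | [], φ => φ
  | y :: l, φ => ex y (exList l φ)

theorem sat_exList (hX : IsDistribution X) {l : List ℕ} (hl : l.Nodup) (hD : ∀ y ∈ l, y ∉ D)
    (φ : TeamFormula L) : (exList l φ).Sat c D X ↔ ∃ X' : Team (addVars D l) A,
      IsDistribution X' ∧ X'.Extends X ∧ φ.Sat c (addVars D l) X' := by
  induction l generalizing D with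
  | nil =>
    refine ⟨fun h => ⟨X, hX, Team.Extends.refl X, h⟩, fun ⟨X', hX', h, hs⟩ => ?_⟩
    have : X' = X := h.eq
    exact this ▸ hs
  | cons y l ih =>
    have hyl := List.nodup_cons.1 hl
    have hyD := hD y (by simp)
    have hD' : ∀ z ∈ l, z ∉ insert y D := by
      intro z hz
      rw [Finset.mem_insert, not_or]
      exact ⟨fun h => hyl.1 (h ▸ hz), hD z (by simp [hz])⟩
    rw [exList, sat_ex_iff hX hyD]
    constructor
    · rintro ⟨X₁, hX₁, h₁, hs⟩
      obtain ⟨X₂, hX₂, h₂, hs⟩ := (ih hX₁ hyl.2 hD').1 hs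
      exact ⟨X₂, hX₂, h₂.trans h₁, hs⟩
    · rintro ⟨X₂, hX₂, h₂, hs⟩
      have hsub : insert y D ⊆ addVars D (y :: l) := subset_addVars (insert y D) l
      have h21 : ∀ p : (ℕ → A) → Prop, DependsOn p ((insert y D : Finset ℕ) : Set ℕ) →
          (Team.law (insert y D) X₂ Assignment.val).prob p = X₂.prob p := fun p hp => by
        rw [Team.prob_law hp, Team.prob]
      -- The intermediate team is the marginal of `X₂` on `insert y D`.
      refine ⟨Team.law (insert y D) X₂ Assignment.val, hX₂.law _,
        ⟨Finset.subset_insert _ _, fun p hp => ?_⟩, (ih (hX₂.law _) hyl.2 hD').2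
        ⟨X₂, hX₂, ⟨hsub, fun p hp => (h21 p hp).symm⟩, hs⟩⟩
      rw [h21 p (hp.mono_finset (Finset.subset_insert _ _)), h₂.2 p hp]

theorem freeVars_exList {l : List ℕ} {φ : TeamFormula L} (h : φ.freeVars ⊆ addVars D l) :
    (exList l φ).freeVars ⊆ D := by
  induction l generalizing D with
  | nil => exact h
  | cons y l ih => exact Finset.subset_insert_iff.1 (ih h)

/-! ### Classical connectives and quantifier-free conditions -/

/-- Boolean disjunction. -/
def bor (φ ψ : TeamFormula L) : TeamFormula L := bneg (and (bneg φ) (bneg ψ))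

@[simp] theorem sat_bor (φ ψ : TeamFormula L) :
    (bor φ ψ).Sat c D X ↔ φ.Sat c D X ∨ ψ.Sat c D X := by
  simp only [bor, Sat]
  tauto

@[simp] theorem freeVars_bor (φ ψ : TeamFormula L) :
    (bor φ ψ).freeVars = φ.freeVars ∪ ψ.freeVars := rfl

/-- Pointwise disjunction of flat formulas, for both conventions on split disjunction. -/
def por (φ ψ : TeamFormula L) : TeamFormula L := bor (bor φ ψ) (or φ ψ)

/-- If neither disjunct holds on the whole support, then `p` and `¬ p` both have positive
probability, and conditioning on them splits the team. If one disjunct holds everywhere, there may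
be no distribution for the other component under the strict convention; the Boolean disjuncts cover
this case. -/
theorem sat_por (hX : IsDistribution X) {φ ψ : TeamFormula L} {p q : (ℕ → A) → Prop}
    (hφ : ∀ Y : Team D A, IsDistribution Y → (φ.Sat c D Y ↔ Y.Forces p))
    (hψ : ∀ Y : Team D A, IsDistribution Y → (ψ.Sat c D Y ↔ Y.Forces q)) :
    (por φ ψ).Sat c D X ↔ X.Forces fun s => p s ∨ q s := by
  rw [por, sat_bor, sat_bor, hφ X hX, hψ X hX]
  constructor
  · rintro ((h | h) | ⟨k, Y, Z, _, _, hY, hZ, rfl, hp, hq⟩)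
    · exact h.mono fun _ => Or.inl
    · exact h.mono fun _ => Or.inr
    · rw [hφ Y hY] at hp
      rw [hψ Z hZ] at hq
      have hp' : k ≠ 0 → Y.Forces p := fun h => by
        cases c
        · exact hp
        · exact hp.resolve_left h
      have hq' : 1 - k ≠ 0 → Z.Forces q := fun h => by
        cases c
        · exact hq
        · exact hq.resolve_left h
      intro s hs
      -- An assignment in the support of the union lies in the support of a component with nonzero
      -- factor, and for such a component both conventions agree.
      by_cases h1 : k * Y s = 0
      · have h2 : (1 - k) * Z s ≠ 0 := fun h2 => hs (by simp [Team.scaledUnion, h1, h2])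
        exact Or.inr (hq' (left_ne_zero_of_mul h2) s (right_ne_zero_of_mul h2))
      · exact Or.inl (hp' (left_ne_zero_of_mul h1) s (right_ne_zero_of_mul h1))
  · intro h
    by_cases h1 : X.Forces p
    · exact Or.inl (Or.inl h1)
    by_cases h2 : X.Forces q
    · exact Or.inl (Or.inr h2)
    right
    have hcond : ∀ r : (ℕ → A) → Prop, X.prob r ≠ 0 →
        IsDistribution fun s : Assignment D A => if r s.val then X s / X.prob r else 0 := by
      intro r hr
      refine ⟨fun s => ?_, ?_⟩
      · dsimp only
        split_ifs
        · exact div_nonneg (hX.1 s) (Team.prob_nonneg hX r)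
        · exact le_rfl
      · rw [← div_self hr]
        nth_rw 2 [Team.prob]
        rw [Finset.sum_div]
        refine Finset.sum_congr rfl fun s _ => ?_
        dsimp only
        split_ifs <;> simp
    have hk : X.prob p ≠ 0 := by
      intro h3
      rw [Team.prob_eq_zero_iff hX] at h3
      exact h2 fun s hs => (h s hs).resolve_left (h3 s hs)
    have hn := Team.prob_not hX p
    have hk' : X.prob (fun s => ¬ p s) ≠ 0 := by
      intro h3
      rw [Team.prob_eq_zero_iff hX] at h3
      exact h1 fun s hs => not_not.1 (h3 s hs)
    have hpart : ∀ (k : ℝ) (P : Prop), P → c.part k P := fun k P hP => by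
      cases c
      · exact hP
      · exact Or.inr hP
    refine ⟨X.prob p, _, _, Team.prob_nonneg hX p, ?_, hcond _ hk, hcond _ hk', ?_,
      hpart _ _ ((hφ _ (hcond _ hk)).2 ?_), hpart _ _ ((hψ _ (hcond _ hk')).2 ?_)⟩
    · have := Team.prob_nonneg hX fun s => ¬ p s
      linarith
    · funext s
      rw [Team.scaledUnion, ← hn]
      by_cases hs : p s.val
      · simp only [hs, if_true, not_true_eq_false, if_false, mul_zero, add_zero]
        exact mul_div_cancel₀ _ hk
      · simp only [hs, if_false, not_false_eq_true, if_true, mul_zero, zero_add]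
        exact mul_div_cancel₀ _ hk'
    · intro s hs
      by_contra h3
      simp [h3] at hs
    · intro s hs
      by_cases h3 : p s.val
      · simp [h3] at hs
      · have h4 : X s ≠ 0 := fun h4 => hs (by simp [h4])
        exact (h s h4).resolve_left h3

end TeamFormula

/-- Quantifier-free conditions on assignments. -/
inductive Cond : Type
  | eq (x y : ℕ) : Cond
  | not (θ : Cond) : Cond
  | and (θ η : Cond) : Cond

namespace Cond

/-- The truth of a condition under a total assignment. -/
def Holds {A : Type w} : Cond → (ℕ → A) → Prop
  | eq x y, s => s x = s y
  | not θ, s => ¬ θ.Holds s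
  | and θ η, s => θ.Holds s ∧ η.Holds s

/-- The variables of a condition. -/
def vars : Cond → Finset ℕ
  | eq x y => {x, y}
  | not θ => θ.vars
  | and θ η => θ.vars ∪ η.vars

/-- Disjunction. -/
def or (θ η : Cond) : Cond := not (and (not θ) (not η))

@[simp] theorem holds_or {A : Type w} (θ η : Cond) (s : ℕ → A) :
    (θ.or η).Holds s ↔ θ.Holds s ∨ η.Holds s := by
  simp only [or, Holds]
  tauto

@[simp] theorem vars_or (θ η : Cond) : (θ.or η).vars = θ.vars ∪ η.vars := rfl

theorem dependsOn_holds {A : Type w} (θ : Cond) :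
    DependsOn (θ.Holds : (ℕ → A) → Prop) (θ.vars : Set ℕ) := by
  induction θ with
  | eq x y =>
    intro s t h
    have h1 := h x (by simp [vars])
    have h2 := h y (by simp [vars])
    simp [Holds, h1, h2]
  | not θ ih =>
    intro s t h
    have := ih h
    simp [Holds, this]
  | and θ η ih₁ ih₂ =>
    intro s t h
    have h1 := ih₁ fun i hi => h i (by simp only [vars, Finset.coe_union]; exact Or.inl hi)
    have h2 := ih₂ fun i hi => h i (by simp only [vars, Finset.coe_union]; exact Or.inr hi)
    simp [Holds, h1, h2]

variable {L : FirstOrder.Language.{u, v}}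

/-- The team formula stating that a condition is everywhere true or everywhere false. -/
def flat : Bool → Cond → TeamFormula L
  | true, eq x y => .eq x y
  | false, eq x y => .neq x y
  | b, not θ => flat (!b) θ
  | true, and θ η => .and (flat true θ) (flat true η)
  | false, and θ η => .por (flat false θ) (flat false η)

/-- Boolean negation of a formula is not pointwise negation of a condition. Hence both polarities
are treated together, negations are pushed to the literals, and the failure of a conjunction becomes
a pointwise disjunction. -/
theorem sat_flat {A : Type w} [Fintype A] [Nonempty A] [L.Structure A] {c : SplitConvention}
    {D : Finset ℕ} {X : Team D A} (hX : IsDistribution X) (b : Bool) (θ : Cond) :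
    (flat (L := L) b θ).Sat c D X ↔ X.Forces fun s => θ.Holds s ↔ b = true := by
  induction θ generalizing b X with
  | eq x y => cases b <;> simp [flat, TeamFormula.Sat, Holds, Team.Forces]
  | not θ ih =>
    rw [flat, ih hX]
    · refine Team.Forces.congr fun s _ => ?_
      cases b <;> simp [Holds]
  | and θ η ih₁ ih₂ =>
    cases b
    · rw [flat, TeamFormula.sat_por hX (fun Y hY => ih₁ hY false) (fun Y hY => ih₂ hY false)]
      refine Team.Forces.congr fun s _ => ?_
      simp only [Holds, Bool.false_eq_true, iff_false]
      tauto
    · rw [flat, TeamFormula.Sat, ih₁ hX, ih₂ hX]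
      simp only [Holds, iff_true]
      exact ⟨fun h => h.1.and h.2, fun h => ⟨h.mono fun _ h => h.1, h.mono fun _ h => h.2⟩⟩

theorem freeVars_flat (b : Bool) (θ : Cond) : (flat (L := L) b θ).freeVars = θ.vars := by
  induction θ generalizing b with
  | eq x y => cases b <;> rfl
  | not θ ih => rw [flat, ih, vars]
  | and θ η ih₁ ih₂ =>
    cases b <;> simp [flat, TeamFormula.por, TeamFormula.freeVars, ih₁, ih₂, vars]

end Cond

/-! ### Independence and constants -/

section Indep

variable {A : Type w} [Fintype A] [Nonempty A] {D D' : Finset ℕ} {X : Team D A}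

/-- Independence of two sets of variables. -/
def Team.Indep (X : Team D A) (S T : Finset ℕ) : Prop :=
  ∀ p q : (ℕ → A) → Prop, DependsOn p (S : Set ℕ) → DependsOn q (T : Set ℕ) →
    X.prob (fun s => p s ∧ q s) = X.prob p * X.prob q

theorem _root_.DependsOn.and {p q : (ℕ → A) → Prop} {S : Set ℕ} (hp : DependsOn p S)
    (hq : DependsOn q S) : DependsOn (fun s => p s ∧ q s) S := fun x y h => by
  dsimp only
  rw [hp h, hq h]

theorem _root_.DependsOn.not {p : (ℕ → A) → Prop} {S : Set ℕ} (hp : DependsOn p S) :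
    DependsOn (fun s => ¬ p s) S := fun x y h => by
  dsimp only
  rw [hp h]

theorem _root_.DependsOn.or {p q : (ℕ → A) → Prop} {S : Set ℕ} (hp : DependsOn p S)
    (hq : DependsOn q S) : DependsOn (fun s => p s ∨ q s) S := fun x y h => by
  dsimp only
  rw [hp h, hq h]

theorem dependsOn_eq {S : Finset ℕ} {x : ℕ} (hx : x ∈ S) (a : A) :
    DependsOn (fun s : ℕ → A => s x = a) (S : Set ℕ) := fun s t h => by
  dsimp only
  rw [h x hx]

theorem Team.prob_eq_add (X : Team D A) (p q : (ℕ → A) → Prop) :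
    X.prob q = X.prob (fun s => p s ∧ q s) + X.prob fun s => ¬ p s ∧ q s := by
  rw [← Team.prob_or fun s h => by tauto]
  congr 1
  funext s
  by_cases h : p s <;> simp [h]

/-- The values on `S` partition an event over `S` into finitely many atoms `AgreeOn S a`. -/
theorem Team.prob_and_eq_sum {S : Finset ℕ} {p : (ℕ → A) → Prop}
    (hp : DependsOn p (S : Set ℕ)) (r : (ℕ → A) → Prop) :
    X.prob (fun s => p s ∧ r s) = ∑ a : Assignment S A,
      if p a.val then X.prob (fun s => AgreeOn S a.val s ∧ r s) else 0 := by
  rw [Team.prob_eq_sum X _ (Assignment.ofFun S)]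
  refine Finset.sum_congr rfl fun a _ => ?_
  simp only [Assignment.ofFun_eq_iff]
  split_ifs with h
  · refine Team.prob_congr fun s _ => ⟨fun h1 => ⟨h1.2, h1.1.2⟩, fun h1 => ⟨⟨?_, h1.2⟩, h1.1⟩⟩
    rwa [hp h1.1]
  · refine Finset.sum_eq_zero fun s _ => if_neg fun h1 => h ?_
    rw [← hp h1.2]
    exact h1.1.1

theorem Team.prob_eq_sum_agreeOn {S : Finset ℕ} {p : (ℕ → A) → Prop}
    (hp : DependsOn p (S : Set ℕ)) :
    X.prob p = ∑ a : Assignment S A, if p a.val then X.prob (AgreeOn S a.val) else 0 := by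
  simpa using X.prob_and_eq_sum hp fun _ => True

/-- Events over `S` and over `T` are disjoint unions of atoms, so independence need only be checked
on atoms, which is what the independence atom asserts. -/
theorem Team.indep_of_agreeOn {S T : Finset ℕ} (hd : Disjoint S T)
    (h : ∀ t : ℕ → A, X.prob (AgreeOn S t) * X.prob (AgreeOn T t) =
      X.prob fun s => AgreeOn S t s ∧ AgreeOn T t s) : X.Indep S T := by
  intro p q hp hq
  have key : ∀ (a : Assignment S A) (b : Assignment T A),
      X.prob (fun s => AgreeOn T b.val s ∧ AgreeOn S a.val s) =
        X.prob (AgreeOn S a.val) * X.prob (AgreeOn T b.val) := by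
    intro a b
    -- Disjointness of `S` and `T` allows an arbitrary pair of atoms to be given by one assignment.
    have h1 := h fun x => if x ∈ S then a.val x else b.val x
    rw [(AgreeOn.congr_left (S := S) (t' := a.val) fun x hx => by simp [hx]),
      (AgreeOn.congr_left (S := T) (t' := b.val) fun x hx => by
        simp [Finset.disjoint_right.1 hd hx])] at h1
    rw [h1]
    congr 1
    funext s
    exact propext and_comm
  rw [Team.prob_and_eq_sum hp, Team.prob_eq_sum_agreeOn hp, Finset.sum_mul]
  refine Finset.sum_congr rfl fun a _ => ?_
  split_ifs
  · rw [show (fun s => AgreeOn S a.val s ∧ q s) = fun s => q s ∧ AgreeOn S a.val s from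
      funext fun s => propext and_comm, Team.prob_and_eq_sum hq, Team.prob_eq_sum_agreeOn hq,
      Finset.mul_sum]
    refine Finset.sum_congr rfl fun b _ => ?_
    split_ifs
    · exact key a b
    · simp
  · simp

theorem Team.Indep.of_extends {X' : Team D' A} {S T : Finset ℕ} (h : X.Indep S T)
    (hX : X'.Extends X) (hS : S ⊆ D) (hT : T ⊆ D) : X'.Indep S T := fun p q hp hq => by
  rw [hX.2 _ ((hp.mono_finset hS).and (hq.mono_finset hT)), hX.2 _ (hp.mono_finset hS),
    hX.2 _ (hq.mono_finset hT), h p q hp hq]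

theorem Team.forces_law {Ω : Type*} [Fintype Ω] {m : Ω → ℝ} {U : Ω → ℕ → A}
    {p : (ℕ → A) → Prop} (hp : DependsOn p (D : Set ℕ)) (h : ∀ ω, m ω ≠ 0 → p (U ω)) :
    (Team.law D m U).Forces p := by
  intro s hs
  obtain ⟨ω, -, hω⟩ := Finset.exists_ne_zero_of_sum_ne_zero hs
  rw [ne_eq, ite_eq_right_iff, Classical.not_imp] at hω
  have h1 := h ω hω.2
  rwa [hp fun x hx => Assignment.ofFun_eq_iff.1 hω.1 x hx] at h1

theorem exists_const_extension (hX : IsDistribution X) {y : ℕ} (hy : y ∉ D) (a : A) :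
    ∃ X' : Team (insert y D) A, IsDistribution X' ∧ X'.Extends X ∧
      X'.Forces fun s => s y = a := by
  refine ⟨Team.law (insert y D) X fun t => Function.update t.val y a, hX.law _,
    Team.extends_law_val (Finset.subset_insert _ _) fun t x hx => ?_,
    Team.forces_law (dependsOn_eq (Finset.mem_insert_self _ _) a) fun t _ => by simp⟩
  rw [Function.update_of_ne]
  rintro rfl
  exact hy hx

/-- The value of `y` is drawn uniformly and independently of `D`. -/
theorem Team.prob_duplicate {y : ℕ} (hy : y ∉ D) {p : (ℕ → A) → Prop}
    (hp : DependsOn p (D : Set ℕ)) (a : A) :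
    (X.duplicate y).prob (fun s => p s ∧ s y = a) = X.prob p / Fintype.card A := by
  rw [Team.duplicate, Team.prob_supplement ((hp.mono_finset (Finset.subset_insert _ _)).and
    (dependsOn_eq (Finset.mem_insert_self _ _) a)), Team.prob, Finset.sum_div]
  refine Finset.sum_congr rfl fun t _ => ?_
  simp only [hp.update_iff hy, Function.update_self]
  by_cases h : p t.val
  · simp [h, div_eq_mul_inv]
  · simp [h]

theorem Team.extends_duplicate {y : ℕ} (hy : y ∉ D) : (X.duplicate y).Extends X :=
  ⟨Finset.subset_insert _ _, fun p hp => Team.prob_supplement_of_erase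
    (fun _ => isDistribution_uniform) (by rwa [Finset.erase_eq_of_notMem hy])⟩

end Indep

namespace TeamFormula

variable {L : FirstOrder.Language.{u, v}} {A : Type w} [Fintype A] [Nonempty A] [L.Structure A]
  {c : SplitConvention} {D : Finset ℕ} {X : Team D A}

theorem sat_indep_iff (hX : IsDistribution X) (y z : List ℕ) :
    (indep (L := L) [] y z).Sat c D X ↔ ∀ t : ℕ → A,
      X.prob (AgreeOn y.toFinset t) * X.prob (AgreeOn z.toFinset t) =
        X.prob fun s => AgreeOn y.toFinset t s ∧ AgreeOn z.toFinset t s := by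
  have h1 : ∀ t : ℕ → A, X.prob (AgreeOn (([] : List ℕ)).toFinset t) = 1 := fun t => by
    rw [← Team.prob_true hX]
    congr 1
    funext s
    simp [AgreeOn]
  have h2 : ∀ t : ℕ → A, AgreeOn (y ++ z).toFinset t =
      fun s => AgreeOn y.toFinset t s ∧ AgreeOn z.toFinset t s := fun t => by
    funext s
    simp [AgreeOn, or_imp, forall_and]
  simp only [Sat, Team.weight_map, h1, h2, mul_one, List.nil_append]

theorem sat_indep_iff_indep (hX : IsDistribution X) (y z : List ℕ)
    (h : Disjoint y.toFinset z.toFinset) :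
    (indep (L := L) [] y z).Sat c D X ↔ X.Indep y.toFinset z.toFinset := by
  rw [sat_indep_iff hX]
  exact ⟨Team.indep_of_agreeOn h, fun h t =>
    (h _ _ (dependsOn_agreeOn _ _) (dependsOn_agreeOn _ _)).symm⟩

/-- Independence of `y` from itself gives `p * p = p` for the probability `p` of each value; a value
in the support has `p ≠ 0`, hence `p = 1`. -/
theorem sat_indep_self (hX : IsDistribution X) (y : ℕ) :
    (indep (L := L) [] [y] [y]).Sat c D X ↔ ∃ a, X.Forces fun s => s y = a := by
  have hag : ∀ t : ℕ → A, AgreeOn [y].toFinset t = fun s => s y = t y := fun t => by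
    funext s
    simp [AgreeOn]
  rw [sat_indep_iff hX]
  simp only [hag, and_self]
  constructor
  · intro h
    obtain ⟨s, hs⟩ := hX.exists_ne_zero
    refine ⟨s.val y, (Team.prob_eq_one_iff hX).1 ?_⟩
    refine mul_left_cancel₀ (a := X.prob fun r => r y = s.val y) ?_ ?_
    · intro h0
      exact (Team.prob_eq_zero_iff hX).1 h0 s hs rfl
    · rw [h s.val, mul_one]
  · rintro ⟨a, ha⟩ t
    by_cases h : a = t y
    · subst h
      rw [(Team.prob_eq_one_iff hX).2 ha, mul_one]
    · have : X.prob (fun s => s y = t y) = 0 :=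
        (Team.prob_eq_zero_iff hX).2 (ha.mono fun s hs h1 => h (hs.symm.trans h1))
      rw [this, mul_zero]

/-- Quantification over elements, represented by constant variables. -/
def exConst (y : ℕ) (φ : TeamFormula L) : TeamFormula L := ex y (and (indep [] [y] [y]) φ)

theorem sat_exConst (hX : IsDistribution X) {y : ℕ} (hy : y ∉ D) (φ : TeamFormula L) :
    (exConst y φ).Sat c D X ↔ ∃ a, ∃ X' : Team (insert y D) A, IsDistribution X' ∧
      X'.Extends X ∧ (X'.Forces fun s => s y = a) ∧ φ.Sat c (insert y D) X' := by
  rw [exConst, sat_ex_iff hX hy]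
  constructor
  · rintro ⟨X', hX', h1, h2, h3⟩
    obtain ⟨a, ha⟩ := (sat_indep_self hX' y).1 h2
    exact ⟨a, X', hX', h1, ha, h3⟩
  · rintro ⟨a, X', hX', h1, ha, h3⟩
    exact ⟨X', hX', h1, (sat_indep_self hX' y).2 ⟨a, ha⟩, h3⟩

theorem freeVars_exConst {y : ℕ} {φ : TeamFormula L} (h : φ.freeVars ⊆ insert y D) :
    (exConst y φ).freeVars ⊆ D := by
  refine Finset.subset_insert_iff.1 (Finset.union_subset ?_ h)
  simp [freeVars]

/-! ### Equality of probabilities -/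

end TeamFormula

/-- A variable that is not in `D`. -/
def fresh (D : Finset ℕ) : ℕ := D.sup id + 1

theorem lt_fresh {D : Finset ℕ} {x : ℕ} (hx : x ∈ D) : x < fresh D :=
  Nat.lt_succ_of_le (Finset.le_sup (f := id) hx)

theorem fresh_notMem (D : Finset ℕ) : fresh D ∉ D := fun h => (lt_fresh h).false

/-- The condition that `θ` or `η` holds, depending on whether `q` and `z` agree. -/
def Cond.select (q z : ℕ) (θ η : Cond) : Cond :=
  .or (.and (.eq q z) θ) (.and (.not (.eq q z)) η)

/-- The condition that `m` equals `z₀` or `z₁`, depending on whether `θ` holds. -/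
def Cond.indicator (m z₀ z₁ : ℕ) (θ : Cond) : Cond :=
  .or (.and θ (.eq m z₀)) (.and (.not θ) (.eq m z₁))

namespace TeamFormula

variable {L : FirstOrder.Language.{u, v}} {A : Type w} [Fintype A] [Nonempty A] [L.Structure A]
  {c : SplitConvention} {D : Finset ℕ} {X : Team D A}

/-- Two conditions on the variables in `D` have the same probability. -/
def probEq (z₀ z₁ : ℕ) (D : Finset ℕ) (α β : Cond) : TeamFormula L :=
  all (fresh D) <| ex (fresh (insert (fresh D) D)) <|
    and (Cond.flat true (.indicator (fresh (insert (fresh D) D)) z₀ z₁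
      (.select (fresh D) z₀ α β)))
    (indep [] [fresh (insert (fresh D) D)] [fresh D])

theorem freeVars_probEq {z₀ z₁ : ℕ} (h₀ : z₀ ∈ D) (h₁ : z₁ ∈ D) {α β : Cond} (hα : α.vars ⊆ D)
    (hβ : β.vars ⊆ D) : (probEq (L := L) z₀ z₁ D α β).freeVars ⊆ D := by
  refine Finset.subset_insert_iff.1 (Finset.subset_insert_iff.1 (Finset.union_subset ?_ ?_))
  · rw [Cond.freeVars_flat]
    intro x hx
    simp only [Cond.indicator, Cond.select, Cond.vars_or, Cond.vars, Finset.mem_union,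
      Finset.mem_insert, Finset.mem_singleton] at hx
    have hα' := @hα x
    have hβ' := @hβ x
    simp only [Finset.mem_insert]
    have : x = z₀ → x ∈ D := fun h => h ▸ h₀
    have : x = z₁ → x ∈ D := fun h => h ▸ h₁
    tauto
  · intro x hx
    simp only [freeVars, List.nil_append, List.toFinset_append, List.toFinset_cons,
      List.toFinset_nil, Finset.mem_union, Finset.mem_insert, Finset.notMem_empty, or_false] at hx
    simp only [Finset.mem_insert]
    tauto

/-- Let `q` be uniform and let `m` indicate the event `r` that is `α` for `q = a₀` and `β`
otherwise. Given `q = a₀` its probability is `P(α)`, given any other value it is `P(β)`; as `q` has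
at least two values, `r` is independent of `q` iff the two coincide. The constants serve as the
values of `m`, and one of them singles out a value of `q`. -/
theorem sat_probEq (hX : IsDistribution X) {z₀ z₁ : ℕ} {a₀ a₁ : A} (ha : a₀ ≠ a₁) (h₀ : z₀ ∈ D)
    (h₁ : z₁ ∈ D) (hz : X.Forces fun s => s z₀ = a₀ ∧ s z₁ = a₁) {α β : Cond}
    (hα : α.vars ⊆ D) (hβ : β.vars ⊆ D) :
    (probEq (L := L) z₀ z₁ D α β).Sat c D X ↔ X.prob α.Holds = X.prob β.Holds := by
  have hq := fresh_notMem D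
  have hm := fresh_notMem (insert (fresh D) D)
  rw [probEq]
  set q := fresh D
  set m := fresh (insert q D)
  have hmq : m ≠ q := fun h => hm (by simp [h])
  have hX₁ := hX.duplicate q
  have hE₁ : (X.duplicate q).Extends X := Team.extends_duplicate hq
  have hαD : DependsOn (α.Holds : (ℕ → A) → Prop) (D : Set ℕ) := α.dependsOn_holds.mono_finset hα
  have hβD : DependsOn (β.Holds : (ℕ → A) → Prop) (D : Set ℕ) := β.dependsOn_holds.mono_finset hβ
  have hPα := fun a => Team.prob_duplicate (X := X) hq hαD a
  have hPβ := fun a => Team.prob_duplicate (X := X) hq hβD a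
  have hP1 := fun a => Team.prob_duplicate (X := X) hq (p := fun _ => True) (fun _ _ _ => rfl) a
  have hβ' := hE₁.2 _ hβD
  have hz₁ := (hE₁.forces_iff hX₁ hX ((dependsOn_eq h₀ a₀).and (dependsOn_eq h₁ a₁))).2 hz
  rw [Sat]
  set X₁ := X.duplicate q
  set N : ℝ := (Fintype.card A : ℝ)
  have hN : 1 < N := by
    have : Nontrivial A := ⟨a₀, a₁, ha⟩
    exact Nat.one_lt_cast.2 (Fintype.one_lt_card (α := A))
  have hN0 : N ≠ 0 := by positivity
  let r : (ℕ → A) → Prop := fun s => (s q = a₀ ∧ α.Holds s) ∨ (¬ s q = a₀ ∧ β.Holds s)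
  have hqD := Finset.mem_insert_self q D
  have hD₁ : D ⊆ insert q D := Finset.subset_insert q D
  have hD₂ : insert q D ⊆ insert m (insert q D) := Finset.subset_insert _ _
  have hrD : DependsOn r ((insert q D : Finset ℕ) : Set ℕ) :=
    ((dependsOn_eq hqD a₀).and (hαD.mono_finset hD₁)).or
      ((dependsOn_eq hqD a₀).not.and (hβD.mono_finset hD₁))
  have hr : X₁.prob r = X.prob α.Holds / N + (X.prob β.Holds - X.prob β.Holds / N) := by
    rw [Team.prob_or fun s h => by tauto]
    congr 1
    · rw [← hPα a₀]
      congr 1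
      funext s
      exact propext and_comm
    · rw [← hPβ a₀, ← hβ', X₁.prob_eq_add (fun s => s q = a₀) β.Holds, add_comm,
        show (fun s : ℕ → A => s q = a₀ ∧ β.Holds s) = fun s => β.Holds s ∧ s q = a₀ from
          funext fun s => propext and_comm]
      ring
  have hrq : ∀ b, X₁.prob (fun s => r s ∧ s q = b) =
      (if b = a₀ then X.prob α.Holds else X.prob β.Holds) / N := by
    intro b
    split_ifs with hb
    · rw [← hPα b]
      refine Team.prob_congr fun s _ => ?_
      dsimp only [r]
      rw [hb]
      tauto
    · rw [← hPβ b]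
      refine Team.prob_congr fun s _ => ?_
      dsimp only [r]
      constructor
      · rintro ⟨⟨h1, -⟩ | ⟨-, h1⟩, h2⟩
        · exact absurd (h2.symm.trans h1) hb
        · exact ⟨h1, h2⟩
      · rintro ⟨h1, h2⟩
        exact ⟨Or.inr ⟨fun h3 => hb (h2.symm.trans h3), h1⟩, h2⟩
  have hflat : ∀ s : ℕ → A, s z₀ = a₀ ∧ s z₁ = a₁ →
      ((Cond.indicator m z₀ z₁ (.select q z₀ α β)).Holds s ↔
        (r s ∧ s m = a₀) ∨ (¬ r s ∧ s m = a₁)) := by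
    rintro s ⟨hs₀, hs₁⟩
    simp only [Cond.indicator, Cond.select, Cond.holds_or, Cond.Holds, hs₀, hs₁, r]
  rw [sat_ex_iff hX₁ hm]
  have hdis : Disjoint [m].toFinset [q].toFinset := by simpa using hmq
  constructor
  · rintro ⟨X₂, hX₂, hE₂, hs₁, hs₂⟩
    rw [Cond.sat_flat hX₂] at hs₁
    rw [sat_indep_iff_indep hX₂ _ _ hdis] at hs₂
    have hz₂ := (hE₂.forces_iff hX₂ hX₁ (((dependsOn_eq h₀ a₀).and
      (dependsOn_eq h₁ a₁)).mono_finset hD₁)).2 hz₁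
    have hmr : X₂.Forces fun s => s m = a₀ ↔ r s := by
      intro s hs
      have h2 := ((hflat _ (hz₂ s hs)).1 ((hs₁ s hs).2 rfl))
      constructor
      · intro h3
        refine h2.elim And.left fun h4 => absurd (h3.symm.trans h4.2) ha
      · intro h3
        exact h2.elim And.right fun h4 => absurd h3 h4.1
    have h3 := hs₂ (fun s => s m = a₀) (fun s => s q = a₀) (dependsOn_eq (by simp) _)
      (dependsOn_eq (by simp) _)
    rw [Team.prob_congr (q := fun s => r s ∧ s q = a₀) (fun s hs => and_congr_left' (hmr s hs)),
      Team.prob_congr hmr, hE₂.2 _ (hrD.and (dependsOn_eq hqD a₀)), hE₂.2 _ hrD,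
      hE₂.2 _ (dependsOn_eq hqD a₀), hrq, if_pos rfl, hr] at h3
    have h4 := hP1 a₀
    simp only [true_and, Team.prob_true hX] at h4
    rw [h4] at h3
    field_simp at h3
    -- Independence at the single pair `m = a₀`, `q = a₀` already yields equality, because `N ≠ 1`.
    have h5 : (N - 1) * (X.prob α.Holds - X.prob β.Holds) = 0 := by linarith
    have h6 : N - 1 ≠ 0 := by linarith
    exact sub_eq_zero.1 ((mul_eq_zero.1 h5).resolve_left h6)
  · intro hαβ
    have hmem := Finset.mem_insert_self m (insert q D)
    -- Conversely `m` is taken to be the indicator of `r`. Independence is then checked for the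
    -- values `a₀` and `a₁` of `m`; all other values have probability zero.
    let U : Assignment (insert q D) A → ℕ → A := fun t =>
      Function.update t.val m (if r t.val then a₀ else a₁)
    have hU : ∀ t, ∀ x ∈ insert q D, U t x = t.val x := by
      intro t x hx
      refine Function.update_of_ne ?_ _ _
      rintro rfl
      exact hm hx
    have hX₂ : IsDistribution (Team.law (insert m (insert q D)) X₁ U) := hX₁.law U
    have hE₂ : (Team.law (insert m (insert q D)) X₁ U).Extends X₁ :=
      Team.extends_law_val hD₂ hU
    have hUm : ∀ t, (r (U t) ∧ U t m = a₀) ∨ (¬ r (U t) ∧ U t m = a₁) := by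
      intro t
      have h1 : r (U t) ↔ r t.val := by rw [hrD (hU t)]
      rw [h1]
      by_cases h : r t.val <;> simp [U, h]
    have hmr : (Team.law (insert m (insert q D)) X₁ U).Forces fun s =>
        (r s ∧ s m = a₀) ∨ (¬ r s ∧ s m = a₁) :=
      Team.forces_law (((hrD.mono_finset hD₂).and (dependsOn_eq hmem a₀)).or
        ((hrD.mono_finset hD₂).not.and (dependsOn_eq hmem a₁))) fun t _ => hUm t
    have hz₂ := (hE₂.forces_iff hX₂ hX₁ (((dependsOn_eq h₀ a₀).and
      (dependsOn_eq h₁ a₁)).mono_finset hD₁)).2 hz₁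
    set X₂ := Team.law (insert m (insert q D)) X₁ U
    refine ⟨X₂, hX₂, hE₂, ?_, ?_⟩
    · rw [Cond.sat_flat hX₂]
      intro s hs
      simp only [iff_true]
      exact (hflat _ (hz₂ s hs)).2 (hmr s hs)
    · rw [sat_indep_iff_indep hX₂ _ _ hdis]
      refine Team.indep_of_agreeOn hdis fun t => ?_
      have hag : ∀ y, AgreeOn [y].toFinset t = fun s => s y = t y := fun y => by
        funext s
        simp [AgreeOn]
      simp only [hag]
      have hQ : X₂.prob (fun s => s q = t q) = 1 / N := by
        have h4 := hP1 (t q)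
        simp only [true_and, Team.prob_true hX] at h4
        rw [hE₂.2 _ (dependsOn_eq hqD _), h4]
      have hR : X₂.prob r = X.prob β.Holds := by
        rw [hE₂.2 _ hrD, hr, hαβ]
        ring
      have hRQ : X₂.prob (fun s => r s ∧ s q = t q) = X.prob β.Holds / N := by
        rw [hE₂.2 _ (hrD.and (dependsOn_eq hqD _)), hrq, hαβ, ite_self]
      by_cases e₀ : t m = a₀
      · have h1 : X₂.Forces fun s => s m = t m ↔ r s := by
          rw [e₀]
          refine hmr.mono fun s h2 => ⟨fun h3 => ?_, fun h3 => ?_⟩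
          · exact h2.elim And.left fun h4 => absurd (h3.symm.trans h4.2) ha
          · exact h2.elim And.right fun h4 => absurd h3 h4.1
        rw [Team.prob_congr (p := fun s => s m = t m ∧ s q = t q)
          (q := fun s => r s ∧ s q = t q) (fun s hs => and_congr_left' (h1 s hs)), Team.prob_congr h1, hQ,
          hR, hRQ]
        ring
      by_cases e₁ : t m = a₁
      · have h1 : X₂.Forces fun s => s m = t m ↔ ¬ r s := by
          rw [e₁]
          refine hmr.mono fun s h2 => ⟨fun h3 => ?_, fun h3 => ?_⟩
          · exact h2.elim (fun h4 => absurd (h4.2.symm.trans h3) ha) And.left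
          · exact h2.elim (fun h4 => absurd h4.1 h3) And.right
        have h2 := X₂.prob_eq_add r fun s => s q = t q
        rw [Team.prob_congr (p := fun s => s m = t m ∧ s q = t q)
          (q := fun s => ¬ r s ∧ s q = t q) (fun s hs => and_congr_left' (h1 s hs)), Team.prob_congr h1,
          Team.prob_not hX₂, hR, hQ]
        rw [hQ, hRQ] at h2
        linear_combination h2
      · have h1 : X₂.Forces fun s => ¬ s m = t m :=
          hmr.mono fun s h2 h3 => h2.elim (fun h4 => e₀ (h3.symm.trans h4.2))
            fun h4 => e₁ (h3.symm.trans h4.2)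
        rw [(Team.prob_eq_zero_iff hX₂).2 h1, zero_mul, eq_comm, Team.prob_eq_zero_iff hX₂]
        exact h1.mono fun s h2 h3 => h2 h3.1

end TeamFormula

/-! ### Real functions coded by blocks of variables

A block for an `n`-ary function consists of two variables for a tag and `n` variables for the
arguments.  The tags distinguish the positive part, the negative part, and the denominator. -/

/-- The tags. -/
inductive Tag : Type
  | pos : Tag
  | neg : Tag
  | den : Tag

/-- The first symbol of a tag. -/
def Tag.fst {B : Type*} (b₀ b₁ : B) : Tag → B
  | pos => b₀
  | neg => b₀
  | den => b₁

/-- The second symbol of a tag. -/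
def Tag.snd {B : Type*} (b₀ b₁ : B) : Tag → B
  | pos => b₀
  | neg => b₁
  | den => b₀

section Blocks

variable {A : Type w} [Fintype A] [Nonempty A] {D D' : Finset ℕ} {X : Team D A} {n : ℕ}
  {a₀ a₁ : A} {B : ℕ → ℕ}

/-- The block has a given tag. -/
def HasTag (a₀ a₁ : A) (B : ℕ → ℕ) (τ : Tag) (s : ℕ → A) : Prop :=
  s (B 0) = τ.fst a₀ a₁ ∧ s (B 1) = τ.snd a₀ a₁

/-- The block has given arguments. -/
def HasArgs (B : ℕ → ℕ) (a : Fin n → A) (s : ℕ → A) : Prop :=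
  ∀ i : Fin n, s (B (i + 2)) = a i

/-- The variables of a block. -/
def blockVars (B : ℕ → ℕ) (n : ℕ) : Finset ℕ := (Finset.range (n + 2)).image B

theorem mem_blockVars {B : ℕ → ℕ} {i : ℕ} (h : i < n + 2) : B i ∈ blockVars B n :=
  Finset.mem_image_of_mem _ (Finset.mem_range.2 h)

theorem dependsOn_hasTag (τ : Tag) :
    DependsOn (HasTag a₀ a₁ B τ) (blockVars B n : Set ℕ) :=
  (dependsOn_eq (mem_blockVars (by omega)) _).and (dependsOn_eq (mem_blockVars (by omega)) _)

theorem dependsOn_hasArgs (a : Fin n → A) :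
    DependsOn (HasArgs B a) (blockVars B n : Set ℕ) := fun s t h => by
  refine propext (forall_congr' fun i => ?_)
  rw [h (B (i + 2)) (mem_blockVars (by omega))]

/-- Tags are three of the four pairs over two distinct symbols, so they exclude each other. -/
theorem HasTag.unique (ha : a₀ ≠ a₁) {τ τ' : Tag} {s : ℕ → A} (h : HasTag a₀ a₁ B τ s)
    (h' : HasTag a₀ a₁ B τ' s) : τ = τ' := by
  have h1 := h.1.symm.trans h'.1
  have h2 := h.2.symm.trans h'.2
  cases τ <;> cases τ' <;> first
    | rfl
    | exact absurd h1 ha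
    | exact absurd h1.symm ha
    | exact absurd h2 ha
    | exact absurd h2.symm ha

/-- The block codes the function `h`. -/
def Team.Codes (X : Team D A) (a₀ a₁ : A) (B : ℕ → ℕ) (h : (Fin n → A) → ℝ) : Prop :=
  0 < X.prob (HasTag a₀ a₁ B .den) ∧ ∀ a : Fin n → A,
    X.prob (fun s => HasTag a₀ a₁ B .pos s ∧ HasArgs B a s) -
      X.prob (fun s => HasTag a₀ a₁ B .neg s ∧ HasArgs B a s) =
        h a * X.prob (HasTag a₀ a₁ B .den)

/-- A positive denominator is all that decoding needs; quantification over blocks thus reaches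
functions without further constraints on the weights. -/
theorem Team.exists_codes (h : 0 < X.prob (HasTag a₀ a₁ B .den)) (n : ℕ) :
    ∃ g : (Fin n → A) → ℝ, X.Codes a₀ a₁ B g :=
  ⟨fun a => (X.prob (fun s => HasTag a₀ a₁ B .pos s ∧ HasArgs B a s) -
      X.prob (fun s => HasTag a₀ a₁ B .neg s ∧ HasArgs B a s)) /
        X.prob (HasTag a₀ a₁ B .den), h, fun _ => (div_mul_cancel₀ _ h.ne').symm⟩

theorem Team.Codes.of_extends {X' : Team D' A} {h : (Fin n → A) → ℝ} (hX : X.Codes a₀ a₁ B h)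
    (hE : X'.Extends X) (hB : blockVars B n ⊆ D) : X'.Codes a₀ a₁ B h := by
  have hd := fun τ => (dependsOn_hasTag (a₀ := a₀) (a₁ := a₁) (n := n) (B := B) τ).mono_finset hB
  have ha := fun a : Fin n → A => (dependsOn_hasArgs (B := B) a).mono_finset hB
  refine ⟨by rw [hE.2 _ (hd _)]; exact hX.1, fun a => ?_⟩
  rw [hE.2 _ ((hd _).and (ha _)), hE.2 _ ((hd _).and (ha _)), hE.2 _ (hd _)]
  exact hX.2 a

/-- The variables of a fresh block. -/
def freshBlock (D : Finset ℕ) (i : ℕ) : ℕ := fresh D + i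

/-- The list of the variables of a fresh block. -/
def freshList (D : Finset ℕ) (n : ℕ) : List ℕ := (List.range (n + 2)).map (freshBlock D)

/-- The variables `D` and a fresh block. -/
def addBlock (D : Finset ℕ) (n : ℕ) : Finset ℕ := addVars D (freshList D n)

theorem toFinset_freshList (D : Finset ℕ) (n : ℕ) :
    (freshList D n).toFinset = blockVars (freshBlock D) n := by
  ext x
  simp [freshList, blockVars]

theorem subset_addBlock (D : Finset ℕ) (n : ℕ) : D ⊆ addBlock D n := subset_addVars _ _

theorem blockVars_subset_addBlock (D : Finset ℕ) (n : ℕ) :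
    blockVars (freshBlock D) n ⊆ addBlock D n := fun x hx => by
  rw [← toFinset_freshList, List.mem_toFinset] at hx
  exact mem_addVars.2 (Or.inr hx)

theorem freshBlock_notMem (D : Finset ℕ) (i : ℕ) : freshBlock D i ∉ D := fun h => by
  have := lt_fresh h
  simp only [freshBlock] at this
  omega

theorem disjoint_blockVars (D : Finset ℕ) (n : ℕ) :
    Disjoint (blockVars (freshBlock D) n) D := by
  rw [Finset.disjoint_left]
  intro x hx
  obtain ⟨i, -, rfl⟩ := Finset.mem_image.1 hx
  exact freshBlock_notMem D i

theorem nodup_freshList (D : Finset ℕ) (n : ℕ) : (freshList D n).Nodup :=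
  List.Nodup.map (fun i j h => by simpa [freshBlock] using h) List.nodup_range

/-- The values of the block variables for the denominator (`none`) and for the positive or
negative part of the value at a tuple. -/
def blockVal (a₀ a₁ : A) : Option ((Fin n → A) × Bool) → ℕ → A
  | none, 0 => a₁
  | none, _ + 1 => a₀
  | some (_, _), 0 => a₀
  | some (_, b), 1 => if b then a₀ else a₁
  | some (a, _), i + 2 => if h : i < n then a ⟨i, h⟩ else a₀

/-- The unnormalized weights that code a function. -/
noncomputable def blockWeight (h : (Fin n → A) → ℝ) : Option ((Fin n → A) × Bool) → ℝ
  | none => 1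
  | some (a, true) => max (h a) 0
  | some (a, false) => max (-h a) 0

theorem blockWeight_nonneg (h : (Fin n → A) → ℝ) (o : Option ((Fin n → A) × Bool)) :
    0 ≤ blockWeight h o := by
  rcases o with _ | ⟨a, _ | _⟩
  · exact zero_le_one
  · exact le_max_right _ _
  · exact le_max_right _ _

theorem sum_blockWeight_pos (h : (Fin n → A) → ℝ) : 0 < ∑ o, blockWeight h o := by
  rw [Fintype.sum_option]
  exact add_pos_of_pos_of_nonneg zero_lt_one (Finset.sum_nonneg fun _ _ => blockWeight_nonneg _ _)

theorem isDistribution_blockWeight (h : (Fin n → A) → ℝ) :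
    IsDistribution fun o => blockWeight h o / ∑ o, blockWeight h o := by
  refine ⟨fun o => div_nonneg (blockWeight_nonneg h o) (sum_blockWeight_pos h).le, ?_⟩
  rw [← Finset.sum_div, div_self (sum_blockWeight_pos h).ne']

/-- The denominator event contains the single block value `none`, and a sign tag together with given
arguments also singles out one block value, so each sum has one term. -/
theorem sum_blockWeight_hasTag (ha : a₀ ≠ a₁) (h : (Fin n → A) → ℝ) (V : _ → ℕ → A)
    (hV : ∀ o, ∀ i < n + 2, V o (B i) = blockVal a₀ a₁ o i) (C : ℝ) :
    (∑ o, if HasTag a₀ a₁ B .den (V o) then blockWeight h o / C else 0) = 1 / C ∧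
    ∀ a : Fin n → A, (∑ o, if HasTag a₀ a₁ B .pos (V o) ∧ HasArgs B a (V o) then
      blockWeight h o / C else 0) = max (h a) 0 / C ∧
      (∑ o, if HasTag a₀ a₁ B .neg (V o) ∧ HasArgs B a (V o) then
      blockWeight h o / C else 0) = max (-h a) 0 / C := by
  have h0 : ∀ o, V o (B 0) = blockVal a₀ a₁ o 0 := fun o => hV o 0 (by omega)
  have h1 : ∀ o, V o (B 1) = blockVal a₀ a₁ o 1 := fun o => hV o 1 (by omega)
  have h2 : ∀ o a, HasArgs B a (V o) ↔ ∀ i : Fin n, blockVal a₀ a₁ o (i + 2) = a i :=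
    fun o a => forall_congr' fun i => by rw [hV o (i + 2) (by omega)]
  have h3 : ∀ a a' : Fin n → A, (∀ i, a i = a' i) ↔ a = a' := fun a a' => funext_iff.symm
  refine ⟨?_, fun a => ⟨?_, ?_⟩⟩
  · simp [Fintype.sum_option, HasTag, h0, h1, blockVal, Tag.fst, Tag.snd, ha, blockWeight]
  · simp [Fintype.sum_option, Fintype.sum_prod_type, HasTag, h0, h1, h2, blockVal, Tag.fst,
      Tag.snd, ha.symm, blockWeight, h3]
  · simp [Fintype.sum_option, Fintype.sum_prod_type, HasTag, h0, h1, h2, blockVal, Tag.fst,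
      Tag.snd, ha, ha.symm, blockWeight, h3]

/-- Every function is coded by a fresh independent block. -/
theorem exists_block_extension (hX : IsDistribution X) (ha : a₀ ≠ a₁) (h : (Fin n → A) → ℝ) :
    ∃ X' : Team (addBlock D n) A, IsDistribution X' ∧ X'.Extends X ∧
      X'.Codes a₀ a₁ (freshBlock D) h ∧ X'.Indep (blockVars (freshBlock D) n) D := by
  set C := ∑ o, blockWeight h o
  have hC : 0 < C := sum_blockWeight_pos h
  set μ : Option ((Fin n → A) × Bool) → ℝ := fun o => blockWeight h o / C
  have hμ : IsDistribution μ := isDistribution_blockWeight h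
  -- Subtracting `fresh D` recovers the index of a variable within the fresh block.
  let V : Option ((Fin n → A) × Bool) → ℕ → A := fun o x => blockVal a₀ a₁ o (x - fresh D)
  let U : Assignment D A × Option ((Fin n → A) × Bool) → ℕ → A := fun ω x =>
    if x ∈ D then ω.1.val x else V ω.2 x
  let X' : Team (addBlock D n) A := Team.law (addBlock D n) (fun ω => X ω.1 * μ ω.2) U
  have hUB : ∀ ω, ∀ x ∈ blockVars (freshBlock D) n, U ω x = V ω.2 x := fun ω x hx =>
    if_neg (Finset.disjoint_left.1 (disjoint_blockVars D n) hx)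
  have hUD : ∀ ω, ∀ x ∈ D, U ω x = ω.1.val x := fun ω x hx => if_pos hx
  -- The new team is a product distribution, so probabilities of events over the block and over `D`
  -- multiply; the marginal and independence statements are instances.
  have hprob : ∀ p q : (ℕ → A) → Prop, DependsOn p (blockVars (freshBlock D) n : Set ℕ) →
      DependsOn q (D : Set ℕ) → X'.prob (fun s => p s ∧ q s) =
        (∑ o, if p (V o) then μ o else 0) * X.prob q := by
    intro p q hp hq
    rw [Team.prob_law ((hp.mono_finset (blockVars_subset_addBlock D n)).and
      (hq.mono_finset (subset_addBlock D n))), Fintype.sum_prod_type, mul_comm, Team.prob,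
      Finset.sum_mul_sum]
    refine Finset.sum_congr rfl fun t _ => Finset.sum_congr rfl fun o _ => ?_
    have h1 : p (U (t, o)) ↔ p (V o) := by rw [hp (hUB (t, o))]
    have h2 : q (U (t, o)) ↔ q t.val := by rw [hq (hUD (t, o))]
    by_cases h3 : p (V o) <;> by_cases h4 : q t.val <;> simp [h1, h2, h3, h4]
  have hpB : ∀ p : (ℕ → A) → Prop, DependsOn p (blockVars (freshBlock D) n : Set ℕ) →
      X'.prob p = ∑ o, if p (V o) then μ o else 0 := fun p hp => by
    simpa [Team.prob_true hX] using hprob p (fun _ => True) hp fun _ _ _ => rfl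
  have hpD : ∀ q : (ℕ → A) → Prop, DependsOn q (D : Set ℕ) → X'.prob q = X.prob q :=
    fun q hq => by simpa [hμ.2] using hprob (fun _ => True) q (fun _ _ _ => rfl) hq
  have hm : IsDistribution fun ω : Assignment D A × Option ((Fin n → A) × Bool) =>
      X ω.1 * μ ω.2 := by
    refine ⟨fun ω => mul_nonneg (hX.1 _) (hμ.1 _), ?_⟩
    simp only [Fintype.sum_prod_type, ← Finset.mul_sum, hμ.2, mul_one, hX.2]
  have hV : ∀ o, ∀ i < n + 2, V o (freshBlock D i) = blockVal a₀ a₁ o i := fun o i _ => by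
    simp [V, freshBlock]
  obtain ⟨hden, hval⟩ := sum_blockWeight_hasTag ha h V hV C
  refine ⟨X', hm.law U, ⟨subset_addBlock D n, hpD⟩, ⟨?_, fun a => ?_⟩, fun p q hp hq => ?_⟩
  · rw [hpB _ (dependsOn_hasTag _), hden]
    positivity
  · have hpos : X'.prob (fun s => HasTag a₀ a₁ (freshBlock D) .pos s ∧
        HasArgs (freshBlock D) a s) = max (h a) 0 / C := by
      rw [hpB _ ((dependsOn_hasTag _).and (dependsOn_hasArgs a)), ← (hval a).1]
      refine Finset.sum_congr rfl fun o _ => ?_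
      congr
    have hneg : X'.prob (fun s => HasTag a₀ a₁ (freshBlock D) .neg s ∧
        HasArgs (freshBlock D) a s) = max (-h a) 0 / C := by
      rw [hpB _ ((dependsOn_hasTag _).and (dependsOn_hasArgs a)), ← (hval a).2]
      refine Finset.sum_congr rfl fun o _ => ?_
      congr
    rw [hpB _ (dependsOn_hasTag _), hden, hpos, hneg, ← sub_div, mul_one_div]
    congr 1
    -- A real number is the difference of its positive and negative parts; the normalising constant
    -- `C` has cancelled.
    rcases le_total (h a) 0 with h0 | h0
    · rw [max_eq_right h0, max_eq_left (by linarith)]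
      ring
    · rw [max_eq_left h0, max_eq_right (by linarith)]
      ring
  · rw [hprob p q hp hq, hpB p hp, hpD q hq]

end Blocks

/-! ### Tags and arguments of blocks as quantifier-free conditions -/

namespace Cond

/-- The condition that a block has a given tag. -/
def hasTag (z₀ z₁ : ℕ) (B : ℕ → ℕ) (τ : Tag) : Cond :=
  and (eq (B 0) (τ.fst z₀ z₁)) (eq (B 1) (τ.snd z₀ z₁))

theorem holds_hasTag {A : Type w} {z₀ z₁ : ℕ} {a₀ a₁ : A} {s : ℕ → A}
    (h : s z₀ = a₀ ∧ s z₁ = a₁) (B : ℕ → ℕ) (τ : Tag) :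
    (hasTag z₀ z₁ B τ).Holds s ↔ HasTag a₀ a₁ B τ s := by
  cases τ <;> simp [hasTag, Holds, HasTag, Tag.fst, Tag.snd, h.1, h.2]

theorem vars_hasTag {z₀ z₁ : ℕ} {B : ℕ → ℕ} {n : ℕ} {D : Finset ℕ} (h₀ : z₀ ∈ D) (h₁ : z₁ ∈ D)
    (hB : blockVars B n ⊆ D) (τ : Tag) : (hasTag z₀ z₁ B τ).vars ⊆ D := by
  have h2 : B 0 ∈ D := hB (mem_blockVars (by omega))
  have h3 : B 1 ∈ D := hB (mem_blockVars (by omega))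
  cases τ <;> simp [hasTag, vars, Tag.fst, Tag.snd, Finset.insert_subset_iff, *]

/-- The condition that a block has a given tag and its arguments are the values of given
variables. -/
def hasTagArgs (z₀ z₁ : ℕ) (B : ℕ → ℕ) {n : ℕ} (τ : Tag) (x : Fin n → ℕ) : Cond :=
  (List.finRange n).foldr (fun (i : Fin n) θ => and (eq (B (i + 2)) (x i)) θ) (hasTag z₀ z₁ B τ)

theorem holds_hasTagArgs {A : Type w} {z₀ z₁ : ℕ} {a₀ a₁ : A} {s : ℕ → A}
    (h : s z₀ = a₀ ∧ s z₁ = a₁) (B : ℕ → ℕ) {n : ℕ} (τ : Tag) (x : Fin n → ℕ) :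
    (hasTagArgs z₀ z₁ B τ x).Holds s ↔ HasTag a₀ a₁ B τ s ∧ HasArgs B (fun i => s (x i)) s := by
  have : ∀ l : List (Fin n),
      (l.foldr (fun (i : Fin n) θ => and (eq (B (i + 2)) (x i)) θ) (hasTag z₀ z₁ B τ)).Holds s ↔
      HasTag a₀ a₁ B τ s ∧ ∀ i ∈ l, s (B (i + 2)) = s (x i) := by
    intro l
    induction l with
    | nil => simp [holds_hasTag h]
    | cons i l ih =>
      simp only [List.foldr_cons, Holds, ih, List.mem_cons, forall_eq_or_imp]
      tauto
  rw [hasTagArgs, this]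
  simp [HasArgs]

theorem vars_hasTagArgs {z₀ z₁ : ℕ} {B : ℕ → ℕ} {n : ℕ} {D : Finset ℕ} (h₀ : z₀ ∈ D)
    (h₁ : z₁ ∈ D) (hB : blockVars B n ⊆ D) (τ : Tag) {x : Fin n → ℕ} (hx : ∀ i, x i ∈ D) :
    (hasTagArgs z₀ z₁ B τ x).vars ⊆ D := by
  rw [hasTagArgs]
  induction List.finRange n with
  | nil => exact vars_hasTag h₀ h₁ hB τ
  | cons i l ih =>
    refine Finset.union_subset ?_ ih
    simp only [vars, Finset.insert_subset_iff, Finset.singleton_subset_iff]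
    exact ⟨hB (mem_blockVars (by omega)), hx i⟩

end Cond

namespace TeamFormula

variable {L : FirstOrder.Language.{u, v}} {A : Type w} [Fintype A] [Nonempty A] [L.Structure A]
  {c : SplitConvention} {D : Finset ℕ} {X : Team D A} {z₀ z₁ : ℕ} {a₀ a₁ : A}

/-- Quantification over fresh independent blocks that code a function. -/
noncomputable def exBlock (z₀ z₁ : ℕ) (D : Finset ℕ) (n : ℕ) (φ : TeamFormula L) :
    TeamFormula L :=
  exList (freshList D n) <|
    and (and (bneg (Cond.flat false (.hasTag z₀ z₁ (freshBlock D) .den)))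
      (indep [] (freshList D n) D.toList)) φ

theorem freeVars_exBlock (h₀ : z₀ ∈ D) (h₁ : z₁ ∈ D) {n : ℕ} {φ : TeamFormula L}
    (h : φ.freeVars ⊆ addBlock D n) : (exBlock z₀ z₁ D n φ).freeVars ⊆ D := by
  refine freeVars_exList (Finset.union_subset (Finset.union_subset ?_ ?_) h)
  · rw [freeVars, Cond.freeVars_flat]
    exact Cond.vars_hasTag (subset_addBlock D n h₀) (subset_addBlock D n h₁)
      (blockVars_subset_addBlock D n) _
  · simp only [freeVars, List.nil_append, List.toFinset_append, Finset.toList_toFinset,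
      toFinset_freshList]
    exact Finset.union_subset (blockVars_subset_addBlock D n) (subset_addBlock D n)

/-- Positivity of the denominator is the Boolean negation of the tag being absent from the support,
and every block with a positive denominator codes some function. Independence from `D` is added
because products of coded numbers will be read off from conjunctions. -/
theorem sat_exBlock (hX : IsDistribution X) (h₀ : z₀ ∈ D) (h₁ : z₁ ∈ D)
    (hz : X.Forces fun s => s z₀ = a₀ ∧ s z₁ = a₁) (n : ℕ) (φ : TeamFormula L) :
    (exBlock z₀ z₁ D n φ).Sat c D X ↔ ∃ (h : (Fin n → A) → ℝ) (X' : Team (addBlock D n) A),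
      IsDistribution X' ∧ X'.Extends X ∧ X'.Codes a₀ a₁ (freshBlock D) h ∧
      X'.Indep (blockVars (freshBlock D) n) D ∧ φ.Sat c (addBlock D n) X' := by
  rw [exBlock, sat_exList hX (nodup_freshList D n) fun y hy => by
    obtain ⟨i, -, rfl⟩ := List.mem_map.1 hy
    exact freshBlock_notMem D i]
  have hdis : Disjoint (freshList D n).toFinset D.toList.toFinset := by
    rw [toFinset_freshList, Finset.toList_toFinset]
    exact disjoint_blockVars D n
  have key : ∀ X' : Team (addBlock D n) A, IsDistribution X' → X'.Extends X →
      ((bneg (Cond.flat (L := L) false (.hasTag z₀ z₁ (freshBlock D) .den))).Sat c _ X' ↔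
        0 < X'.prob (HasTag a₀ a₁ (freshBlock D) .den)) := by
    intro X' hX' hE
    have hz' := (hE.forces_iff hX' hX ((dependsOn_eq h₀ a₀).and (dependsOn_eq h₁ a₁))).2 hz
    rw [Sat, Cond.sat_flat hX', (Team.prob_nonneg hX' _).lt_iff_ne, ne_comm, ne_eq,
      Team.prob_eq_zero_iff hX']
    refine not_congr (Team.Forces.congr fun s hs => ?_)
    have := Cond.holds_hasTag (hz' s hs) (freshBlock D) .den
    simp [this]
  constructor
  · rintro ⟨X', hX', hE, ⟨h1, h2⟩, h3⟩
    rw [sat_indep_iff_indep hX' _ _ hdis, toFinset_freshList, Finset.toList_toFinset] at h2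
    obtain ⟨h, hh⟩ := Team.exists_codes ((key X' hX' hE).1 h1) n
    exact ⟨h, X', hX', hE, hh, h2, h3⟩
  · rintro ⟨h, X', hX', hE, h1, h2, h3⟩
    refine ⟨X', hX', hE, ⟨(key X' hX' hE).2 h1.1, ?_⟩, h3⟩
    refine (sat_indep_iff_indep hX' _ _ hdis).2 ?_
    rwa [toFinset_freshList, Finset.toList_toFinset]

end TeamFormula

/-! ### Arithmetic of coded numbers -/

section Arithmetic

variable {A : Type w} [Fintype A] [Nonempty A] {D D' : Finset ℕ} {X : Team D A} {a₀ a₁ : A}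
  {z₀ z₁ : ℕ} {g g₁ g₂ : ℕ → ℕ}

/-- The `0`-ary block codes a number. -/
def Team.CodesNum (X : Team D A) (a₀ a₁ : A) (g : ℕ → ℕ) (r : ℝ) : Prop :=
  X.Codes a₀ a₁ g fun _ : Fin 0 → A => r

theorem Team.codesNum_iff {r : ℝ} : X.CodesNum a₀ a₁ g r ↔ 0 < X.prob (HasTag a₀ a₁ g .den) ∧
    X.prob (HasTag a₀ a₁ g .pos) - X.prob (HasTag a₀ a₁ g .neg) =
      r * X.prob (HasTag a₀ a₁ g .den) := by
  simp only [Team.CodesNum, Team.Codes, HasArgs, IsEmpty.forall_iff, and_true, forall_const]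

/-- The condition that three blocks have given tags. -/
def Cond.tags (z₀ z₁ : ℕ) (g g₁ g₂ : ℕ → ℕ) (t : Tag × Tag × Tag) : Cond :=
  .and (.hasTag z₀ z₁ g₂ t.2.2) (.and (.hasTag z₀ z₁ g₁ t.2.1) (.hasTag z₀ z₁ g t.1))

/-- The condition that the tags of three blocks are one of three given triples. -/
def Cond.tagsOr (z₀ z₁ : ℕ) (g g₁ g₂ : ℕ → ℕ) (t t' t'' : Tag × Tag × Tag) : Cond :=
  .or (.tags z₀ z₁ g g₁ g₂ t) (.or (.tags z₀ z₁ g g₁ g₂ t') (.tags z₀ z₁ g g₁ g₂ t''))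

theorem Cond.vars_tagsOr (h₀ : z₀ ∈ D) (h₁ : z₁ ∈ D) (hg : blockVars g 0 ⊆ D)
    (hg₁ : blockVars g₁ 0 ⊆ D) (hg₂ : blockVars g₂ 0 ⊆ D) (t t' t'' : Tag × Tag × Tag) :
    (Cond.tagsOr z₀ z₁ g g₁ g₂ t t' t'').vars ⊆ D := by
  have h : ∀ t, (Cond.tags z₀ z₁ g g₁ g₂ t).vars ⊆ D := fun t =>
    Finset.union_subset (vars_hasTag h₀ h₁ hg₂ _)
      (Finset.union_subset (vars_hasTag h₀ h₁ hg₁ _) (vars_hasTag h₀ h₁ hg _))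
  exact Finset.union_subset (h t) (Finset.union_subset (h t') (h t''))

/-- The product of the probabilities of the tags of three blocks. -/
noncomputable def Team.tagsProd (X : Team D A) (a₀ a₁ : A) (g g₁ g₂ : ℕ → ℕ)
    (t : Tag × Tag × Tag) : ℝ :=
  X.prob (HasTag a₀ a₁ g t.1) * X.prob (HasTag a₀ a₁ g₁ t.2.1) * X.prob (HasTag a₀ a₁ g₂ t.2.2)

/-- Distinct triples of tags are incompatible by `HasTag.unique`, so the probabilities add. Each
conjunction is a product because `g₂` is independent of the other two blocks and `g₁` of `g`. -/
theorem Team.prob_tagsOr (ha : a₀ ≠ a₁) (hz : X.Forces fun s => s z₀ = a₀ ∧ s z₁ = a₁)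
    {S₁ S₂ : Finset ℕ} (h₁ : X.Indep (blockVars g₁ 0) S₁) (h₂ : X.Indep (blockVars g₂ 0) S₂)
    (hg₁ : blockVars g 0 ⊆ S₁) (hg₂ : blockVars g 0 ⊆ S₂) (hg₁₂ : blockVars g₁ 0 ⊆ S₂)
    {t t' t'' : Tag × Tag × Tag} (hne : t ≠ t') (hne' : t ≠ t'') (hne'' : t' ≠ t'') :
    X.prob (Cond.tagsOr z₀ z₁ g g₁ g₂ t t' t'').Holds = X.tagsProd a₀ a₁ g g₁ g₂ t +
      (X.tagsProd a₀ a₁ g g₁ g₂ t' + X.tagsProd a₀ a₁ g g₁ g₂ t'') := by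
  let P : Tag × Tag × Tag → (ℕ → A) → Prop := fun t s =>
    HasTag a₀ a₁ g₂ t.2.2 s ∧ HasTag a₀ a₁ g₁ t.2.1 s ∧ HasTag a₀ a₁ g t.1 s
  have hP : ∀ t, X.prob (P t) = X.tagsProd a₀ a₁ g g₁ g₂ t := by
    intro t
    rw [h₂ _ _ (dependsOn_hasTag _) (((dependsOn_hasTag (n := 0) _).mono_finset hg₁₂).and
      ((dependsOn_hasTag (n := 0) _).mono_finset hg₂)), h₁ _ _ (dependsOn_hasTag _)
      ((dependsOn_hasTag (n := 0) _).mono_finset hg₁), Team.tagsProd]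
    ring
  have hdis : ∀ t t' : Tag × Tag × Tag, t ≠ t' → ∀ s, P t s → ¬ P t' s := fun t t' h s h1 h2 =>
    h (Prod.ext (h1.2.2.unique ha h2.2.2) (Prod.ext (h1.2.1.unique ha h2.2.1)
      (h1.1.unique ha h2.1)))
  rw [← hP, ← hP, ← hP, ← Team.prob_or (hdis _ _ hne''), ← Team.prob_or]
  · refine Team.prob_congr fun s hs => ?_
    have h := fun B τ => Cond.holds_hasTag (hz s hs) B τ
    simp only [Cond.tagsOr, Cond.holds_or, Cond.tags, Cond.Holds, h]
    rfl
  · rintro s h (h' | h')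
    · exact hdis _ _ hne s h h'
    · exact hdis _ _ hne' s h h'

/-- This clears denominators: `k` will be the product of the denominators involved. -/
theorem eq_iff_eq_of_sub_eq_mul {a b r x k : ℝ} (hk : k ≠ 0) (h : a - b = (r - x) * k) :
    a = b ↔ r = x := by
  rw [← sub_eq_zero, h, mul_eq_zero, or_iff_left hk, sub_eq_zero]

/-- Write `r = (p - n) / d` and likewise for `r₁` and `r₂`. Multiplying `r = r₁ + r₂` by `d * d₁ *
d₂` and moving the negative terms to the other side leaves sums of products of tag probabilities. -/
theorem Team.tags_add_iff {r r₁ r₂ : ℝ} (h : X.CodesNum a₀ a₁ g r)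
    (h₁ : X.CodesNum a₀ a₁ g₁ r₁) (h₂ : X.CodesNum a₀ a₁ g₂ r₂) :
    X.tagsProd a₀ a₁ g g₁ g₂ (.pos, .den, .den) + (X.tagsProd a₀ a₁ g g₁ g₂ (.den, .neg, .den) +
      X.tagsProd a₀ a₁ g g₁ g₂ (.den, .den, .neg)) = X.tagsProd a₀ a₁ g g₁ g₂ (.neg, .den, .den) +
      (X.tagsProd a₀ a₁ g g₁ g₂ (.den, .pos, .den) + X.tagsProd a₀ a₁ g g₁ g₂ (.den, .den, .pos)) ↔
      r = r₁ + r₂ := by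
  rw [Team.codesNum_iff] at h h₁ h₂
  simp only [Team.tagsProd]
  set d := X.prob (HasTag a₀ a₁ g .den)
  set d₁ := X.prob (HasTag a₀ a₁ g₁ .den)
  set d₂ := X.prob (HasTag a₀ a₁ g₂ .den)
  have hd : d * d₁ * d₂ ≠ 0 := (mul_pos (mul_pos h.1 h₁.1) h₂.1).ne'
  refine eq_iff_eq_of_sub_eq_mul hd ?_
  linear_combination (d₁ * d₂) * h.2 - (d * d₂) * h₁.2 - (d * d₁) * h₂.2

/-- As for addition; the product `(p₁ - n₁) * (p₂ - n₂)` expands into four terms, of which the two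
mixed ones change sides. -/
theorem Team.tags_mul_iff {r r₁ r₂ : ℝ} (h : X.CodesNum a₀ a₁ g r)
    (h₁ : X.CodesNum a₀ a₁ g₁ r₁) (h₂ : X.CodesNum a₀ a₁ g₂ r₂) :
    X.tagsProd a₀ a₁ g g₁ g₂ (.pos, .den, .den) + (X.tagsProd a₀ a₁ g g₁ g₂ (.den, .pos, .neg) +
      X.tagsProd a₀ a₁ g g₁ g₂ (.den, .neg, .pos)) = X.tagsProd a₀ a₁ g g₁ g₂ (.neg, .den, .den) +
      (X.tagsProd a₀ a₁ g g₁ g₂ (.den, .pos, .pos) + X.tagsProd a₀ a₁ g g₁ g₂ (.den, .neg, .neg)) ↔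
      r = r₁ * r₂ := by
  rw [Team.codesNum_iff] at h h₁ h₂
  simp only [Team.tagsProd]
  set d := X.prob (HasTag a₀ a₁ g .den)
  set d₁ := X.prob (HasTag a₀ a₁ g₁ .den)
  set d₂ := X.prob (HasTag a₀ a₁ g₂ .den)
  have hd : d * d₁ * d₂ ≠ 0 := (mul_pos (mul_pos h.1 h₁.1) h₂.1).ne'
  refine eq_iff_eq_of_sub_eq_mul hd ?_
  have := congrArg₂ (· * ·) h₁.2 h₂.2
  linear_combination (d₁ * d₂) * h.2 - d * this

end Arithmetic

/-! ### Environments -/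

/-- The names of variables, functions and constants belong to `T`. -/
structure Names (T : Finset ℕ) (z₀ z₁ : ℕ) (ρ : ℕ → ℕ) (σ : ℕ → ℕ → ℕ → ℕ) : Prop where
  zero_mem : z₀ ∈ T
  one_mem : z₁ ∈ T
  var_mem : ∀ x, ρ x ∈ T
  fun_mem : ∀ n f, blockVars (σ n f) n ⊆ T

theorem Names.mono {T T' : Finset ℕ} {z₀ z₁ : ℕ} {ρ : ℕ → ℕ} {σ : ℕ → ℕ → ℕ → ℕ}
    (h : Names T z₀ z₁ ρ σ) (hT : T ⊆ T') : Names T' z₀ z₁ ρ σ :=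
  ⟨hT h.zero_mem, hT h.one_mem, fun x => hT (h.var_mem x), fun n f => (h.fun_mem n f).trans hT⟩

theorem Names.update_var {T : Finset ℕ} {z₀ z₁ : ℕ} {ρ : ℕ → ℕ} {σ : ℕ → ℕ → ℕ → ℕ}
    (h : Names T z₀ z₁ ρ σ) (x y : ℕ) :
    Names (insert y T) z₀ z₁ (Function.update ρ x y) σ := by
  have h' := h.mono (Finset.subset_insert y T)
  refine ⟨h'.zero_mem, h'.one_mem, fun z => ?_, h'.fun_mem⟩
  by_cases hz : z = x
  · simp [hz]
  · rw [Function.update_of_ne hz]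
    exact h'.var_mem z

/-- Change the block of a function variable. -/
def updateBlock (σ : ℕ → ℕ → ℕ → ℕ) (n f : ℕ) (B : ℕ → ℕ) : ℕ → ℕ → ℕ → ℕ :=
  fun n' f' => if n' = n ∧ f' = f then B else σ n' f'

theorem Names.update_fun {T : Finset ℕ} {z₀ z₁ : ℕ} {ρ : ℕ → ℕ} {σ : ℕ → ℕ → ℕ → ℕ}
    (h : Names T z₀ z₁ ρ σ) (n f : ℕ) :
    Names (addBlock T n) z₀ z₁ ρ (updateBlock σ n f (freshBlock T)) := by
  have h' := h.mono (subset_addBlock T n)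
  refine ⟨h'.zero_mem, h'.one_mem, h'.var_mem, fun n' f' => ?_⟩
  rw [updateBlock]
  split_ifs with h1
  · rw [h1.1]
    exact blockVars_subset_addBlock T n
  · exact h'.fun_mem n' f'

/-- The team represents an interpretation of the variables in `V` and the functions in `W`. -/
structure Team.Represents {A : Type w} [Fintype A] [Nonempty A] {D : Finset ℕ} (X : Team D A)
    (a₀ a₁ : A) (z₀ z₁ : ℕ) (ρ : ℕ → ℕ) (σ : ℕ → ℕ → ℕ → ℕ) (E : FunInterp A) (s : ℕ → A)
    (V : Finset ℕ) (W : Finset (ℕ × ℕ)) : Prop where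
  const : X.Forces fun u => u z₀ = a₀ ∧ u z₁ = a₁
  var : ∀ x ∈ V, X.Forces fun u => u (ρ x) = s x
  func : ∀ p ∈ W, X.Codes a₀ a₁ (σ p.1 p.2) (E p.1 p.2)

section Represents

variable {A : Type w} [Fintype A] [Nonempty A] {D D' : Finset ℕ} {X : Team D A} {a₀ a₁ : A}
  {z₀ z₁ : ℕ} {ρ : ℕ → ℕ} {σ : ℕ → ℕ → ℕ → ℕ} {E : FunInterp A} {s : ℕ → A} {V V' : Finset ℕ}
  {W W' : Finset (ℕ × ℕ)}

theorem Team.Represents.mono (h : X.Represents a₀ a₁ z₀ z₁ ρ σ E s V W) (hV : V' ⊆ V)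
    (hW : W' ⊆ W) : X.Represents a₀ a₁ z₀ z₁ ρ σ E s V' W' :=
  ⟨h.const, fun x hx => h.var x (hV hx), fun p hp => h.func p (hW hp)⟩

theorem Team.Represents.of_extends {X' : Team D' A} (h : X.Represents a₀ a₁ z₀ z₁ ρ σ E s V W)
    (hX : IsDistribution X) (hX' : IsDistribution X') (hE : X'.Extends X)
    (hn : Names D z₀ z₁ ρ σ) : X'.Represents a₀ a₁ z₀ z₁ ρ σ E s V W := by
  refine ⟨?_, fun x hx => ?_, fun p hp => (h.func p hp).of_extends hE (hn.fun_mem _ _)⟩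
  · exact (hE.forces_iff hX' hX ((dependsOn_eq hn.zero_mem a₀).and
      (dependsOn_eq hn.one_mem a₁))).2 h.const
  · exact (hE.forces_iff hX' hX (dependsOn_eq (hn.var_mem x) _)).2 (h.var x hx)

theorem Team.Represents.update_var {x y : ℕ} {a : A}
    (h : X.Represents a₀ a₁ z₀ z₁ ρ σ E s (V.erase x) W) (hy : X.Forces fun u => u y = a) :
    X.Represents a₀ a₁ z₀ z₁ (Function.update ρ x y) σ E (Function.update s x a) V W := by
  refine ⟨h.const, fun z hz => ?_, h.func⟩
  by_cases hzx : z = x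
  · subst hzx
    simpa using hy
  · simpa [hzx] using h.var z (Finset.mem_erase.2 ⟨hzx, hz⟩)

theorem Team.Represents.update_fun {n f : ℕ} {B : ℕ → ℕ} {g : (Fin n → A) → ℝ}
    (h : X.Represents a₀ a₁ z₀ z₁ ρ σ E s V (W.erase (n, f))) (hg : X.Codes a₀ a₁ B g) :
    X.Represents a₀ a₁ z₀ z₁ ρ (updateBlock σ n f B) (E.update n f g) s V W := by
  refine ⟨h.const, h.var, fun p hp => ?_⟩
  obtain ⟨n', f'⟩ := p
  by_cases h1 : n' = n ∧ f' = f
  · obtain ⟨rfl, rfl⟩ := h1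
    simpa [updateBlock] using hg
  · have h2 := h.func (n', f') (Finset.mem_erase.2 ⟨fun h3 => h1 (by simpa using h3), hp⟩)
    have h3 : E.update n f g n' f' = E n' f' := by
      by_cases hf : f' = f
      · have hn : n' ≠ n := fun hn => h1 ⟨hn, hf⟩
        simp [FunInterp.update, hn]
      · exact FunInterp.update_of_ne _ _ hf
    simpa only [updateBlock, h1, if_false, h3] using h2

end Represents

/-! ### Translation of numerical terms -/

namespace TeamFormula

variable {L : FirstOrder.Language.{u, v}} {A : Type w} [Fintype A] [Nonempty A] [L.Structure A]
  {c : SplitConvention} {D : Finset ℕ} {X : Team D A} {z₀ z₁ : ℕ} {a₀ a₁ : A}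

/-- Quantification over two numbers. -/
noncomputable def exPair (z₀ z₁ : ℕ) (D : Finset ℕ)
    (φ : Finset ℕ → (ℕ → ℕ) → (ℕ → ℕ) → TeamFormula L) : TeamFormula L :=
  exBlock z₀ z₁ D 0 <| exBlock z₀ z₁ (addBlock D 0) 0 <|
    φ (addBlock (addBlock D 0) 0) (freshBlock D) (freshBlock (addBlock D 0))

/-- Fresh independent blocks exist for any two numbers, and conversely any two admissible blocks
code some pair. So the quantifiers range over pairs of reals, provided that the matrix depends only
on the coded numbers. -/
theorem sat_exPair (hX : IsDistribution X) (ha : a₀ ≠ a₁) (h₀ : z₀ ∈ D) (h₁ : z₁ ∈ D)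
    (hz : X.Forces fun s => s z₀ = a₀ ∧ s z₁ = a₁)
    (φ : Finset ℕ → (ℕ → ℕ) → (ℕ → ℕ) → TeamFormula L) (P : ℝ → ℝ → Prop)
    (hφ : ∀ (r₁ r₂ : ℝ) (X' : Team (addBlock (addBlock D 0) 0) A), IsDistribution X' →
      X'.Extends X → X'.CodesNum a₀ a₁ (freshBlock D) r₁ →
      X'.CodesNum a₀ a₁ (freshBlock (addBlock D 0)) r₂ →
      X'.Indep (blockVars (freshBlock D) 0) D →
      X'.Indep (blockVars (freshBlock (addBlock D 0)) 0) (addBlock D 0) →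
      ((φ (addBlock (addBlock D 0) 0) (freshBlock D) (freshBlock (addBlock D 0))).Sat c _ X' ↔
        P r₁ r₂)) :
    (exPair z₀ z₁ D φ).Sat c D X ↔ ∃ r₁ r₂, P r₁ r₂ := by
  have hsub := subset_addBlock D 0
  have hbs := blockVars_subset_addBlock D 0
  have hz' : ∀ X' : Team (addBlock D 0) A, IsDistribution X' → X'.Extends X →
      X'.Forces fun s => s z₀ = a₀ ∧ s z₁ = a₁ := fun X' hX' hE =>
    (hE.forces_iff hX' hX ((dependsOn_eq h₀ a₀).and (dependsOn_eq h₁ a₁))).2 hz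
  have hnum : ∀ h : (Fin 0 → A) → ℝ, h = fun _ => h Fin.elim0 := fun h =>
    funext fun a => by rw [Subsingleton.elim a Fin.elim0]
  rw [exPair, sat_exBlock hX h₀ h₁ hz]
  constructor
  · rintro ⟨g₁, X₁, hX₁, hE₁, hc₁, hi₁, h⟩
    rw [sat_exBlock hX₁ (hsub h₀) (hsub h₁) (hz' X₁ hX₁ hE₁)] at h
    obtain ⟨g₂, X₂, hX₂, hE₂, hc₂, hi₂, h⟩ := h
    rw [hnum g₁] at hc₁
    rw [hnum g₂] at hc₂
    exact ⟨_, _, (hφ _ _ X₂ hX₂ (hE₂.trans hE₁) (hc₁.of_extends hE₂ hbs) hc₂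
      (hi₁.of_extends hE₂ hbs hsub) hi₂).1 h⟩
  · rintro ⟨r₁, r₂, h⟩
    obtain ⟨X₁, hX₁, hE₁, hc₁, hi₁⟩ := exists_block_extension hX ha fun _ : Fin 0 → A => r₁
    obtain ⟨X₂, hX₂, hE₂, hc₂, hi₂⟩ := exists_block_extension hX₁ ha fun _ : Fin 0 → A => r₂
    refine ⟨_, X₁, hX₁, hE₁, hc₁, hi₁, ?_⟩
    rw [sat_exBlock hX₁ (hsub h₀) (hsub h₁) (hz' X₁ hX₁ hE₁)]
    exact ⟨_, X₂, hX₂, hE₂, hc₂, hi₂, (hφ _ _ X₂ hX₂ (hE₂.trans hE₁) (hc₁.of_extends hE₂ hbs) hc₂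
      (hi₁.of_extends hE₂ hbs hsub) hi₂).2 h⟩

/-- The number coded by the block `g` is the value of a numerical term. -/
noncomputable def isValue (z₀ z₁ : ℕ) (ρ : ℕ → ℕ) (σ : ℕ → ℕ → ℕ → ℕ) :
    NumTerm → Finset ℕ → (ℕ → ℕ) → TeamFormula L
  | .app n f x, D, g => probEq z₀ z₁ D
      (.or (.and (.hasTag z₀ z₁ g .pos) (.hasTag z₀ z₁ (σ n f) .den))
        (.and (.hasTag z₀ z₁ g .den) (.hasTagArgs z₀ z₁ (σ n f) .neg fun i => ρ (x i))))
      (.or (.and (.hasTag z₀ z₁ g .neg) (.hasTag z₀ z₁ (σ n f) .den))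
        (.and (.hasTag z₀ z₁ g .den) (.hasTagArgs z₀ z₁ (σ n f) .pos fun i => ρ (x i))))
  | .add i j, D, g => exPair z₀ z₁ D fun D' g₁ g₂ =>
      and (isValue z₀ z₁ ρ σ i D' g₁) <| and (isValue z₀ z₁ ρ σ j D' g₂) <| probEq z₀ z₁ D'
        (.tagsOr z₀ z₁ g g₁ g₂ (.pos, .den, .den) (.den, .neg, .den) (.den, .den, .neg))
        (.tagsOr z₀ z₁ g g₁ g₂ (.neg, .den, .den) (.den, .pos, .den) (.den, .den, .pos))
  | .mul i j, D, g => exPair z₀ z₁ D fun D' g₁ g₂ =>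
      and (isValue z₀ z₁ ρ σ i D' g₁) <| and (isValue z₀ z₁ ρ σ j D' g₂) <| probEq z₀ z₁ D'
        (.tagsOr z₀ z₁ g g₁ g₂ (.pos, .den, .den) (.den, .pos, .neg) (.den, .neg, .pos))
        (.tagsOr z₀ z₁ g g₁ g₂ (.neg, .den, .den) (.den, .pos, .pos) (.den, .neg, .neg))

theorem freeVars_isValue {ρ : ℕ → ℕ} {σ : ℕ → ℕ → ℕ → ℕ} (i : NumTerm) {D : Finset ℕ}
    {g : ℕ → ℕ} (h : Names D z₀ z₁ ρ σ) (hg : blockVars g 0 ⊆ D) :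
    (isValue (L := L) z₀ z₁ ρ σ i D g).freeVars ⊆ D := by
  have hpair : ∀ (D : Finset ℕ) (g : ℕ → ℕ) (i j : NumTerm) (t t' t'' u u' u'' : Tag × Tag × Tag),
      Names D z₀ z₁ ρ σ → blockVars g 0 ⊆ D →
      (∀ {D : Finset ℕ} {g : ℕ → ℕ}, Names D z₀ z₁ ρ σ → blockVars g 0 ⊆ D →
        (isValue (L := L) z₀ z₁ ρ σ i D g).freeVars ⊆ D) →
      (∀ {D : Finset ℕ} {g : ℕ → ℕ}, Names D z₀ z₁ ρ σ → blockVars g 0 ⊆ D →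
        (isValue (L := L) z₀ z₁ ρ σ j D g).freeVars ⊆ D) →
      (exPair (L := L) z₀ z₁ D fun D' g₁ g₂ => and (isValue z₀ z₁ ρ σ i D' g₁) <|
        and (isValue z₀ z₁ ρ σ j D' g₂) <| probEq z₀ z₁ D' (.tagsOr z₀ z₁ g g₁ g₂ t t' t'')
          (.tagsOr z₀ z₁ g g₁ g₂ u u' u'')).freeVars ⊆ D := by
    intro D g i j t t' t'' u u' u'' h hg hi hj
    have hs := subset_addBlock D 0
    have hs' := subset_addBlock (addBlock D 0) 0
    have hb := (blockVars_subset_addBlock D 0).trans hs'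
    have hb' := blockVars_subset_addBlock (addBlock D 0) 0
    have hn := h.mono (hs.trans hs')
    have hg' := hg.trans (hs.trans hs')
    refine freeVars_exBlock h.zero_mem h.one_mem (freeVars_exBlock (hs h.zero_mem) (hs h.one_mem)
      (Finset.union_subset (hi hn hb) (Finset.union_subset (hj hn hb') ?_)))
    exact freeVars_probEq hn.zero_mem hn.one_mem
      (Cond.vars_tagsOr hn.zero_mem hn.one_mem hg' hb hb' _ _ _)
      (Cond.vars_tagsOr hn.zero_mem hn.one_mem hg' hb hb' _ _ _)
  induction i generalizing D g with
  | app n f x =>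
    have hv := fun τ => Cond.vars_hasTag h.zero_mem h.one_mem hg τ
    have hv' := fun τ => Cond.vars_hasTag h.zero_mem h.one_mem (h.fun_mem n f) τ
    have hv'' := fun τ => Cond.vars_hasTagArgs h.zero_mem h.one_mem (h.fun_mem n f) τ
      fun i => h.var_mem (x i)
    exact freeVars_probEq h.zero_mem h.one_mem
      (Finset.union_subset (Finset.union_subset (hv _) (hv' _))
        (Finset.union_subset (hv _) (hv'' _)))
      (Finset.union_subset (Finset.union_subset (hv _) (hv' _))
        (Finset.union_subset (hv _) (hv'' _)))
  | add i j hi hj => exact hpair D g i j _ _ _ _ _ _ h hg hi hj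
  | mul i j hi hj => exact hpair D g i j _ _ _ _ _ _ h hg hi hj

end TeamFormula

namespace TeamFormula

variable {L : FirstOrder.Language.{u, v}} {A : Type w} [Fintype A] [Nonempty A] [L.Structure A]
  {c : SplitConvention} {z₀ z₁ : ℕ} {a₀ a₁ : A}

/-- Clearing denominators in `r = h(a)` gives `p * d' + d * n' = n * d' + d * p'`, with primes for
the block of `f`. The block `g` is independent of `T`, which contains the block of `f`, so both
sides are probabilities of disjoint unions of conjunctions. -/
theorem sat_isValue_app (ha : a₀ ≠ a₁) {ρ : ℕ → ℕ} {σ : ℕ → ℕ → ℕ → ℕ} {E : FunInterp A}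
    {s : ℕ → A} {n f : ℕ} {x : Fin n → ℕ} {D T : Finset ℕ} {X : Team D A} {g : ℕ → ℕ} {r : ℝ}
    (hX : IsDistribution X) (hT : T ⊆ D) (hn : Names T z₀ z₁ ρ σ) (hg : blockVars g 0 ⊆ D)
    (hi : X.Indep (blockVars g 0) T) (hr : X.CodesNum a₀ a₁ g r)
    (h : X.Represents a₀ a₁ z₀ z₁ ρ σ E s (NumTerm.app n f x).vars (NumTerm.app n f x).funs) :
    (isValue (L := L) z₀ z₁ ρ σ (.app n f x) D g).Sat c D X ↔
      r = (NumTerm.app n f x).eval E s := by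
  have hv := fun τ => Cond.vars_hasTag (hT hn.zero_mem) (hT hn.one_mem) hg τ
  have hv' := fun τ => Cond.vars_hasTag (hT hn.zero_mem) (hT hn.one_mem)
    ((hn.fun_mem n f).trans hT) τ
  have hv'' := fun τ => Cond.vars_hasTagArgs (hT hn.zero_mem) (hT hn.one_mem)
    ((hn.fun_mem n f).trans hT) τ fun i => hT (hn.var_mem (x i))
  have hsub : ∀ τ τ', (Cond.or (.and (.hasTag z₀ z₁ g τ) (.hasTag z₀ z₁ (σ n f) .den))
      (.and (.hasTag z₀ z₁ g .den) (.hasTagArgs z₀ z₁ (σ n f) τ' fun i => ρ (x i)))).vars ⊆ D :=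
    fun τ τ' => Finset.union_subset (Finset.union_subset (hv _) (hv' _))
      (Finset.union_subset (hv _) (hv'' _))
  -- The argument variables are constants with the values prescribed by `s`, so comparing the block
  -- with them selects one tuple of arguments.
  have hx : X.Forces fun u => ∀ i, u (ρ (x i)) = s (x i) := fun u hu i =>
    h.var (x i) (by simp [NumTerm.vars]) u hu
  have key : ∀ τ τ' : Tag, τ ≠ .den → X.prob (Cond.or (.and (.hasTag z₀ z₁ g τ)
      (.hasTag z₀ z₁ (σ n f) .den)) (.and (.hasTag z₀ z₁ g .den)
      (.hasTagArgs z₀ z₁ (σ n f) τ' fun i => ρ (x i)))).Holds =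
      X.prob (HasTag a₀ a₁ g τ) * X.prob (HasTag a₀ a₁ (σ n f) .den) +
      X.prob (HasTag a₀ a₁ g .den) * X.prob (fun u => HasTag a₀ a₁ (σ n f) τ' u ∧
        HasArgs (σ n f) (fun i => s (x i)) u) := by
    intro τ τ' hτ
    rw [← hi _ _ (dependsOn_hasTag _) ((dependsOn_hasTag _).mono_finset (hn.fun_mem n f)),
      ← hi _ _ (dependsOn_hasTag _) (((dependsOn_hasTag _).and (dependsOn_hasArgs _)).mono_finset
        (hn.fun_mem n f)), ← Team.prob_or]
    · refine Team.prob_congr fun u hu => ?_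
      have h1 := fun B τ => Cond.holds_hasTag (h.const u hu) B τ
      have h2 := Cond.holds_hasTagArgs (h.const u hu) (σ n f) τ' fun i => ρ (x i)
      simp only [hx u hu] at h2
      simp only [Cond.holds_or, Cond.Holds, h1, h2]
    · exact fun u h1 h2 => hτ (h1.1.unique ha h2.1)
  rw [isValue, sat_probEq hX ha (hT hn.zero_mem) (hT hn.one_mem) h.const
    (hsub _ _) (hsub _ _), key _ _ (by simp), key _ _ (by simp)]
  have hf := h.func (n, f) (by simp [NumTerm.funs])
  have hf' := hf.2 fun i => s (x i)
  have hr' := Team.codesNum_iff.1 hr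
  refine eq_iff_eq_of_sub_eq_mul (mul_pos hr'.1 hf.1).ne' ?_
  rw [NumTerm.eval]
  linear_combination X.prob (HasTag a₀ a₁ (σ n f) .den) * hr'.2 -
    X.prob (HasTag a₀ a₁ g .den) * hf'

/-- A compound term is evaluated through existentially chosen values of its parts. The set `T` holds
the names and is kept apart from the number block: in the induction, the first auxiliary block is
independent of `D` and the second of `D` together with the first, and both of these sets contain all
names. -/
theorem sat_isValue (ha : a₀ ≠ a₁) {ρ : ℕ → ℕ} {σ : ℕ → ℕ → ℕ → ℕ} {E : FunInterp A}
    {s : ℕ → A} (i : NumTerm) {D T : Finset ℕ} {X : Team D A} {g : ℕ → ℕ} {r : ℝ}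
    (hX : IsDistribution X) (hT : T ⊆ D) (hn : Names T z₀ z₁ ρ σ) (hg : blockVars g 0 ⊆ D)
    (hi : X.Indep (blockVars g 0) T) (hr : X.CodesNum a₀ a₁ g r)
    (h : X.Represents a₀ a₁ z₀ z₁ ρ σ E s i.vars i.funs) :
    (isValue (L := L) z₀ z₁ ρ σ i D g).Sat c D X ↔ r = i.eval E s := by
  induction i generalizing D T g r with
  | app n f x => exact sat_isValue_app ha hX hT hn hg hi hr h
  | add i j ihi ihj =>
    have hnD := hn.mono hT
    rw [isValue, sat_exPair hX ha hnD.zero_mem hnD.one_mem h.const _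
      fun r₁ r₂ => r₁ = i.eval E s ∧ r₂ = j.eval E s ∧ r = r₁ + r₂]
    · simp [NumTerm.eval]
    · intro r₁ r₂ X' hX' hE hc₁ hc₂ hi₁ hi₂
      have hs := subset_addBlock D 0
      have hs' := subset_addBlock (addBlock D 0) 0
      have hb := blockVars_subset_addBlock D 0
      have hb' := blockVars_subset_addBlock (addBlock D 0) 0
      have h' := h.of_extends hX hX' hE hnD
      have hg' := hg.trans hs
      have hn' := hnD.mono (hs.trans hs')
      have hr' := hr.of_extends hE hg
      rw [Sat, Sat, ihi hX' (hs.trans hs') hnD (hb.trans hs') hi₁ hc₁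
        (h'.mono Finset.subset_union_left Finset.subset_union_left),
        ihj hX' hs' (hnD.mono hs) hb' hi₂ hc₂
        (h'.mono Finset.subset_union_right Finset.subset_union_right),
        sat_probEq hX' ha hn'.zero_mem hn'.one_mem h'.const
        (Cond.vars_tagsOr hn'.zero_mem hn'.one_mem (hg'.trans hs') (hb.trans hs') hb' _ _ _)
        (Cond.vars_tagsOr hn'.zero_mem hn'.one_mem (hg'.trans hs') (hb.trans hs') hb' _ _ _),
        Team.prob_tagsOr ha h'.const hi₁ hi₂ hg hg' hb (by simp) (by simp) (by simp),
        Team.prob_tagsOr ha h'.const hi₁ hi₂ hg hg' hb (by simp) (by simp) (by simp),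
        Team.tags_add_iff hr' hc₁ hc₂]
  | mul i j ihi ihj =>
    have hnD := hn.mono hT
    rw [isValue, sat_exPair hX ha hnD.zero_mem hnD.one_mem h.const _
      fun r₁ r₂ => r₁ = i.eval E s ∧ r₂ = j.eval E s ∧ r = r₁ * r₂]
    · simp [NumTerm.eval]
    · intro r₁ r₂ X' hX' hE hc₁ hc₂ hi₁ hi₂
      have hs := subset_addBlock D 0
      have hs' := subset_addBlock (addBlock D 0) 0
      have hb := blockVars_subset_addBlock D 0
      have hb' := blockVars_subset_addBlock (addBlock D 0) 0
      have h' := h.of_extends hX hX' hE hnD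
      have hg' := hg.trans hs
      have hn' := hnD.mono (hs.trans hs')
      have hr' := hr.of_extends hE hg
      rw [Sat, Sat, ihi hX' (hs.trans hs') hnD (hb.trans hs') hi₁ hc₁
        (h'.mono Finset.subset_union_left Finset.subset_union_left),
        ihj hX' hs' (hnD.mono hs) hb' hi₂ hc₂
        (h'.mono Finset.subset_union_right Finset.subset_union_right),
        sat_probEq hX' ha hn'.zero_mem hn'.one_mem h'.const
        (Cond.vars_tagsOr hn'.zero_mem hn'.one_mem (hg'.trans hs') (hb.trans hs') hb' _ _ _)
        (Cond.vars_tagsOr hn'.zero_mem hn'.one_mem (hg'.trans hs') (hb.trans hs') hb' _ _ _),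
        Team.prob_tagsOr ha h'.const hi₁ hi₂ hg hg' hb (by simp) (by simp) (by simp),
        Team.prob_tagsOr ha h'.const hi₁ hi₂ hg hg' hb (by simp) (by simp) (by simp),
        Team.tags_mul_iff hr' hc₁ hc₂]

/-- Two numerical terms have the same value. -/
noncomputable def sameValue (z₀ z₁ : ℕ) (D : Finset ℕ) (ρ : ℕ → ℕ) (σ : ℕ → ℕ → ℕ → ℕ)
    (i j : NumTerm) : TeamFormula L :=
  exBlock z₀ z₁ D 0 <| and (isValue z₀ z₁ ρ σ i (addBlock D 0) (freshBlock D))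
    (isValue z₀ z₁ ρ σ j (addBlock D 0) (freshBlock D))

theorem freeVars_sameValue {D : Finset ℕ} {ρ : ℕ → ℕ} {σ : ℕ → ℕ → ℕ → ℕ} {i j : NumTerm}
    (h : Names D z₀ z₁ ρ σ) : (sameValue (L := L) z₀ z₁ D ρ σ i j).freeVars ⊆ D :=
  freeVars_exBlock h.zero_mem h.one_mem (Finset.union_subset
    (freeVars_isValue i (h.mono (subset_addBlock D 0)) (blockVars_subset_addBlock D 0))
    (freeVars_isValue j (h.mono (subset_addBlock D 0)) (blockVars_subset_addBlock D 0)))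

/-- Equality is stated through a common number. As the formula holds iff the values agree, its
Boolean negation expresses inequality. -/
theorem sat_sameValue (ha : a₀ ≠ a₁) {ρ : ℕ → ℕ} {σ : ℕ → ℕ → ℕ → ℕ} {E : FunInterp A}
    {s : ℕ → A} {i j : NumTerm} {D : Finset ℕ} {X : Team D A} (hX : IsDistribution X)
    (hn : Names D z₀ z₁ ρ σ)
    (h : X.Represents a₀ a₁ z₀ z₁ ρ σ E s (i.vars ∪ j.vars) (i.funs ∪ j.funs)) :
    (sameValue (L := L) z₀ z₁ D ρ σ i j).Sat c D X ↔ i.eval E s = j.eval E s := by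
  have key : ∀ (r : ℝ) (X' : Team (addBlock D 0) A), IsDistribution X' → X'.Extends X →
      X'.CodesNum a₀ a₁ (freshBlock D) r → X'.Indep (blockVars (freshBlock D) 0) D →
      ((and (isValue (L := L) z₀ z₁ ρ σ i (addBlock D 0) (freshBlock D))
        (isValue z₀ z₁ ρ σ j (addBlock D 0) (freshBlock D))).Sat c (addBlock D 0) X' ↔
        r = i.eval E s ∧ r = j.eval E s) := by
    intro r X' hX' hE hc hi
    have h' := h.of_extends hX hX' hE hn
    rw [Sat, sat_isValue ha i hX' (subset_addBlock D 0) hn (blockVars_subset_addBlock D 0) hi hc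
      (h'.mono Finset.subset_union_left Finset.subset_union_left),
      sat_isValue ha j hX' (subset_addBlock D 0) hn (blockVars_subset_addBlock D 0) hi hc
      (h'.mono Finset.subset_union_right Finset.subset_union_right)]
  rw [sameValue, sat_exBlock hX hn.zero_mem hn.one_mem h.const]
  constructor
  · rintro ⟨g, X', hX', hE, hc, hi, h1⟩
    rw [show g = fun _ => g Fin.elim0 from
      funext fun a => by rw [Subsingleton.elim a Fin.elim0]] at hc
    obtain ⟨h2, h3⟩ := (key _ X' hX' hE hc hi).1 h1
    exact h2.symm.trans h3
  · intro h1
    obtain ⟨X', hX', hE, hc, hi⟩ := exists_block_extension hX ha fun _ : Fin 0 → A => i.eval E s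
    exact ⟨_, X', hX', hE, hc, hi, (key _ X' hX' hE hc hi).2 ⟨rfl, h1⟩⟩

end TeamFormula

/-! ### From second-order logic to team logic -/

open TeamFormula in
/-- The translation of second-order formulas for structures with at least two elements.  The
current team has the variables `D`, of which `z₀` and `z₁` are distinct constants, first-order
variables are represented by constants according to `ρ`, and function variables by blocks
according to `σ`. -/
noncomputable def SOFormula.toTeam {L : FirstOrder.Language.{u, v}} (z₀ z₁ : ℕ) :
    SOFormula L → Finset ℕ → (ℕ → ℕ) → (ℕ → ℕ → ℕ → ℕ) → TeamFormula L
  | numEq i j, D, ρ, σ => sameValue z₀ z₁ D ρ σ i j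
  | numNeq i j, D, ρ, σ => .bneg (sameValue z₀ z₁ D ρ σ i j)
  | eq x y, _, ρ, _ => .eq (ρ x) (ρ y)
  | neq x y, _, ρ, _ => .neq (ρ x) (ρ y)
  | rel R x, _, ρ, _ => .rel R fun i => ρ (x i)
  | nrel R x, _, ρ, _ => .nrel R fun i => ρ (x i)
  | and φ ψ, D, ρ, σ => .and (φ.toTeam z₀ z₁ D ρ σ) (ψ.toTeam z₀ z₁ D ρ σ)
  | or φ ψ, D, ρ, σ => .bor (φ.toTeam z₀ z₁ D ρ σ) (ψ.toTeam z₀ z₁ D ρ σ)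
  | ex x φ, D, ρ, σ => exConst (fresh D)
      (φ.toTeam z₀ z₁ (insert (fresh D) D) (Function.update ρ x (fresh D)) σ)
  | all x φ, D, ρ, σ => .bneg <| exConst (fresh D) <| .bneg
      (φ.toTeam z₀ z₁ (insert (fresh D) D) (Function.update ρ x (fresh D)) σ)
  | exFun n f φ, D, ρ, σ => exBlock z₀ z₁ D n
      (φ.toTeam z₀ z₁ (addBlock D n) ρ (updateBlock σ n f (freshBlock D)))
  | allFun n f φ, D, ρ, σ => .bneg <| exBlock z₀ z₁ D n <| .bneg
      (φ.toTeam z₀ z₁ (addBlock D n) ρ (updateBlock σ n f (freshBlock D)))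

namespace SOFormula

variable {L : FirstOrder.Language.{u, v}} {z₀ z₁ : ℕ}

theorem freeVars_toTeam (ψ : SOFormula L) {D : Finset ℕ} {ρ : ℕ → ℕ} {σ : ℕ → ℕ → ℕ → ℕ}
    (h : Names D z₀ z₁ ρ σ) : (ψ.toTeam z₀ z₁ D ρ σ).freeVars ⊆ D := by
  induction ψ generalizing D ρ σ with
  | numEq i j => exact TeamFormula.freeVars_sameValue h
  | numNeq i j => exact TeamFormula.freeVars_sameValue h
  | eq x y => simp [toTeam, TeamFormula.freeVars, Finset.insert_subset_iff, h.var_mem]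
  | neq x y => simp [toTeam, TeamFormula.freeVars, Finset.insert_subset_iff, h.var_mem]
  | rel R x => simp [toTeam, TeamFormula.freeVars, Finset.image_subset_iff, h.var_mem]
  | nrel R x => simp [toTeam, TeamFormula.freeVars, Finset.image_subset_iff, h.var_mem]
  | and φ ψ ih₁ ih₂ => exact Finset.union_subset (ih₁ h) (ih₂ h)
  | or φ ψ ih₁ ih₂ => exact Finset.union_subset (ih₁ h) (ih₂ h)
  | ex x φ ih => exact TeamFormula.freeVars_exConst (ih (h.update_var x _))
  | all x φ ih => exact TeamFormula.freeVars_exConst (φ := .bneg _) (ih (h.update_var x _))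
  | exFun n f φ ih =>
    exact TeamFormula.freeVars_exBlock h.zero_mem h.one_mem (ih (h.update_fun n f))
  | allFun n f φ ih =>
    exact TeamFormula.freeVars_exBlock h.zero_mem h.one_mem (φ := .bneg _)
      (ih (h.update_fun n f))

variable {A : Type w} [Fintype A] [Nonempty A] [L.Structure A] {c : SplitConvention} {a₀ a₁ : A}

/-- Truth of `ψ` is assumed to depend only on the represented element, so any extension by a
constant with that value can serve as the witness. -/
theorem sat_exConst_toTeam {φ : SOFormula L} {x : ℕ} {D : Finset ℕ} {X : Team D A} {ρ : ℕ → ℕ}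
    {σ : ℕ → ℕ → ℕ → ℕ} {E : FunInterp A} {s : ℕ → A} (hX : IsDistribution X)
    (hn : Names D z₀ z₁ ρ σ)
    (h : X.Represents a₀ a₁ z₀ z₁ ρ σ E s (φ.freeVars.erase x) φ.freeFuns) (ψ : TeamFormula L)
    (P : A → Prop)
    (hψ : ∀ (X' : Team (insert (fresh D) D) A) (a : A), IsDistribution X' →
      X'.Represents a₀ a₁ z₀ z₁ (Function.update ρ x (fresh D)) σ E (Function.update s x a)
        φ.freeVars φ.freeFuns → (ψ.Sat c (insert (fresh D) D) X' ↔ P a)) :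
    (TeamFormula.exConst (fresh D) ψ).Sat c D X ↔ ∃ a, P a := by
  rw [TeamFormula.sat_exConst hX (fresh_notMem D)]
  refine exists_congr fun a => ?_
  constructor
  · rintro ⟨X', hX', hE, ha, h1⟩
    exact (hψ X' a hX' ((h.of_extends hX hX' hE hn).update_var ha)).1 h1
  · intro h1
    obtain ⟨X', hX', hE, ha⟩ := exists_const_extension hX (fresh_notMem D) a
    exact ⟨X', hX', hE, ha, (hψ X' a hX' ((h.of_extends hX hX' hE hn).update_var ha)).2 h1⟩

/-- Many teams code the same function, and truth of `ψ` is assumed to depend on the coded function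
only. Independence of a function block is not part of the invariant; only the number blocks
introduced later rely on their independence. -/
theorem sat_exBlock_toTeam (ha : a₀ ≠ a₁) {φ : SOFormula L} {n f : ℕ} {D : Finset ℕ}
    {X : Team D A} {ρ : ℕ → ℕ} {σ : ℕ → ℕ → ℕ → ℕ} {E : FunInterp A} {s : ℕ → A}
    (hX : IsDistribution X) (hn : Names D z₀ z₁ ρ σ)
    (h : X.Represents a₀ a₁ z₀ z₁ ρ σ E s φ.freeVars (φ.freeFuns.erase (n, f)))
    (ψ : TeamFormula L) (P : ((Fin n → A) → ℝ) → Prop)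
    (hψ : ∀ (X' : Team (addBlock D n) A) (g : (Fin n → A) → ℝ), IsDistribution X' →
      X'.Represents a₀ a₁ z₀ z₁ ρ (updateBlock σ n f (freshBlock D)) (E.update n f g) s
        φ.freeVars φ.freeFuns → (ψ.Sat c (addBlock D n) X' ↔ P g)) :
    (TeamFormula.exBlock z₀ z₁ D n ψ).Sat c D X ↔ ∃ g, P g := by
  rw [TeamFormula.sat_exBlock hX hn.zero_mem hn.one_mem h.const]
  refine exists_congr fun g => ?_
  constructor
  · rintro ⟨X', hX', hE, hg, -, h1⟩
    exact (hψ X' g hX' ((h.of_extends hX hX' hE hn).update_fun hg)).1 h1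
  · intro h1
    obtain ⟨X', hX', hE, hg, hi⟩ := exists_block_extension hX ha g
    exact ⟨X', hX', hE, hg, hi, (hψ X' g hX' ((h.of_extends hX hX' hE hn).update_fun hg)).2 h1⟩

/-- The induction shows that truth does not depend on which distribution codes the environment.
First-order literals reduce to constant conditions on the nonempty support, so negated ones need no
Boolean negation; disjunctions, universal quantifiers and numerical inequalities do. -/
theorem sat_toTeam (ha : a₀ ≠ a₁) (ψ : SOFormula L) {D : Finset ℕ} {X : Team D A} {ρ : ℕ → ℕ}
    {σ : ℕ → ℕ → ℕ → ℕ} {E : FunInterp A} {s : ℕ → A} (hX : IsDistribution X)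
    (hn : Names D z₀ z₁ ρ σ)
    (h : X.Represents a₀ a₁ z₀ z₁ ρ σ E s ψ.freeVars ψ.freeFuns) :
    (ψ.toTeam z₀ z₁ D ρ σ).Sat c D X ↔ ψ.Sat E s := by
  induction ψ generalizing D ρ σ E s with
  | numEq i j => exact TeamFormula.sat_sameValue ha hX hn h
  | numNeq i j => exact not_congr (TeamFormula.sat_sameValue ha hX hn h)
  | eq x y =>
    have hx := h.var x (by simp [freeVars])
    have hy := h.var y (by simp [freeVars])
    rw [Sat, ← Team.forces_const_iff hX (P := s x = s y)]
    exact Team.Forces.congr (p := fun u => u (ρ x) = u (ρ y)) fun u hu =>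
      iff_of_eq (congrArg₂ _ (hx u hu) (hy u hu))
  | neq x y =>
    have hx := h.var x (by simp [freeVars])
    have hy := h.var y (by simp [freeVars])
    rw [Sat, ← Team.forces_const_iff hX (P := s x ≠ s y)]
    exact Team.Forces.congr (p := fun u => u (ρ x) ≠ u (ρ y)) fun u hu =>
      iff_of_eq (congrArg₂ _ (hx u hu) (hy u hu))
  | rel R x =>
    have hx := fun i => h.var (x i) (by simp [freeVars])
    exact (Team.Forces.congr (p := fun u => FirstOrder.Language.Structure.RelMap R
      fun i => u (ρ (x i))) (q := fun _ => FirstOrder.Language.Structure.RelMap R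
      fun i => s (x i)) fun u hu => iff_of_eq (congrArg _ (funext fun i => hx i u hu))).trans
      (Team.forces_const_iff hX)
  | nrel R x =>
    have hx := fun i => h.var (x i) (by simp [freeVars])
    exact (Team.Forces.congr (p := fun u => ¬ FirstOrder.Language.Structure.RelMap R
      fun i => u (ρ (x i))) (q := fun _ => ¬ FirstOrder.Language.Structure.RelMap R
      fun i => s (x i)) fun u hu => not_congr
        (iff_of_eq (congrArg _ (funext fun i => hx i u hu)))).trans (Team.forces_const_iff hX)
  | and φ ψ ih₁ ih₂ =>
    exact and_congr
      (ih₁ hX hn (h.mono Finset.subset_union_left Finset.subset_union_left))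
      (ih₂ hX hn (h.mono Finset.subset_union_right Finset.subset_union_right))
  | or φ ψ ih₁ ih₂ =>
    rw [toTeam, TeamFormula.sat_bor]
    exact or_congr
      (ih₁ hX hn (h.mono Finset.subset_union_left Finset.subset_union_left))
      (ih₂ hX hn (h.mono Finset.subset_union_right Finset.subset_union_right))
  | ex x φ ih =>
    exact sat_exConst_toTeam hX hn h _ _ fun X' a hX' h' => ih hX' (hn.update_var x _) h'
  | all x φ ih =>
    exact (not_congr (sat_exConst_toTeam hX hn h (.bneg _)
      (fun a => ¬ φ.Sat E (Function.update s x a)) fun X' a hX' h' =>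
      not_congr (ih hX' (hn.update_var x _) h'))).trans not_exists_not
  | exFun n f φ ih =>
    exact sat_exBlock_toTeam ha hX hn h _ _ fun X' g hX' h' => ih hX' (hn.update_fun n f) h'
  | allFun n f φ ih =>
    exact (not_congr (sat_exBlock_toTeam ha hX hn h (.bneg _)
      (fun g => ¬ φ.Sat (E.update n f g) s) fun X' g hX' h' =>
      not_congr (ih hX' (hn.update_fun n f) h'))).trans not_exists_not

end SOFormula

/-! ### Structures with one element -/

theorem NumTerm.eval_congr_of_subsingleton {A A' : Type w} [Subsingleton A] [Subsingleton A']
    (i : NumTerm) {E : FunInterp A} {E' : FunInterp A'} (s : ℕ → A) (s' : ℕ → A')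
    (hE : ∀ p ∈ i.funs, ∀ a a', E p.1 p.2 a = E' p.1 p.2 a') : i.eval E s = i.eval E' s' := by
  induction i with
  | app n f x => exact hE (n, f) (by simp [funs]) _ _
  | add i j hi hj =>
    simp only [funs, Finset.mem_union] at hE
    simp only [eval, hi fun p hp => hE p (Or.inl hp), hj fun p hp => hE p (Or.inr hp)]
  | mul i j hi hj =>
    simp only [funs, Finset.mem_union] at hE
    simp only [eval, hi fun p hp => hE p (Or.inl hp), hj fun p hp => hE p (Or.inr hp)]

/-- A one-element structure is determined up to isomorphism by the relations that hold in it, and a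
function on it is a single number, so witnesses for function quantifiers transfer in both
directions. -/
theorem SOFormula.sat_congr_of_subsingleton {L : FirstOrder.Language.{u, v}} {A A' : Type w}
    [Subsingleton A] [Subsingleton A'] [Nonempty A] [Nonempty A'] [L.Structure A] [L.Structure A']
    (hR : ∀ (n : ℕ) (R : L.Relations n) (a : Fin n → A) (a' : Fin n → A'),
      FirstOrder.Language.Structure.RelMap R a ↔ FirstOrder.Language.Structure.RelMap R a')
    (ψ : SOFormula L) {E : FunInterp A} {E' : FunInterp A'} (s : ℕ → A) (s' : ℕ → A')
    (hE : ∀ p ∈ ψ.freeFuns, ∀ a a', E p.1 p.2 a = E' p.1 p.2 a') :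
    ψ.Sat E s ↔ ψ.Sat E' s' := by
  have hupd : ∀ (n f : ℕ) (φ : SOFormula L) (E : FunInterp A) (E' : FunInterp A')
      (g : (Fin n → A) → ℝ) (g' : (Fin n → A') → ℝ), (∀ a a', g a = g' a') →
      (∀ p ∈ φ.freeFuns.erase (n, f), ∀ a a', E p.1 p.2 a = E' p.1 p.2 a') →
      ∀ p ∈ φ.freeFuns, ∀ a a', E.update n f g p.1 p.2 a = E'.update n f g' p.1 p.2 a' := by
    rintro n f φ E E' g g' hg hE ⟨n', f'⟩ hp a a'
    by_cases hf : f' = f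
    · by_cases hn : n' = n
      · subst hf hn
        simpa using hg a a'
      · simpa [FunInterp.update, hn] using
          hE (n', f') (Finset.mem_erase.2 ⟨by simp [hn], hp⟩) a a'
    · simpa only [FunInterp.update_of_ne _ _ hf] using
        hE (n', f') (Finset.mem_erase.2 ⟨by simp [hf], hp⟩) a a'
  have hg : ∀ (n : ℕ) (g : (Fin n → A) → ℝ), ∃ g' : (Fin n → A') → ℝ, ∀ a a', g a = g' a' :=
    fun n g => ⟨fun _ => g fun _ => Classical.arbitrary A, fun a a' =>
      congrArg g (Subsingleton.elim _ _)⟩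
  have hg' : ∀ (n : ℕ) (g' : (Fin n → A') → ℝ), ∃ g : (Fin n → A) → ℝ, ∀ a a', g a = g' a' :=
    fun n g' => ⟨fun _ => g' fun _ => Classical.arbitrary A', fun a a' =>
      congrArg g' (Subsingleton.elim _ _)⟩
  induction ψ generalizing E E' s s' with
  | numEq i j =>
    simp only [freeFuns, Finset.mem_union] at hE
    rw [Sat, Sat, i.eval_congr_of_subsingleton s s' fun p hp => hE p (Or.inl hp),
      j.eval_congr_of_subsingleton s s' fun p hp => hE p (Or.inr hp)]
  | numNeq i j =>
    simp only [freeFuns, Finset.mem_union] at hE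
    rw [Sat, Sat, i.eval_congr_of_subsingleton s s' fun p hp => hE p (Or.inl hp),
      j.eval_congr_of_subsingleton s s' fun p hp => hE p (Or.inr hp)]
  | eq x y => exact iff_of_true (Subsingleton.elim _ _) (Subsingleton.elim _ _)
  | neq x y =>
    exact iff_of_false (fun h : s x ≠ s y => h (Subsingleton.elim _ _))
      (fun h : s' x ≠ s' y => h (Subsingleton.elim _ _))
  | rel R x => exact hR _ R _ _
  | nrel R x => exact not_congr (hR _ R _ _)
  | and φ ψ ih₁ ih₂ =>
    simp only [freeFuns, Finset.mem_union] at hE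
    exact and_congr (ih₁ s s' fun p hp => hE p (Or.inl hp)) (ih₂ s s' fun p hp => hE p (Or.inr hp))
  | or φ ψ ih₁ ih₂ =>
    simp only [freeFuns, Finset.mem_union] at hE
    exact or_congr (ih₁ s s' fun p hp => hE p (Or.inl hp)) (ih₂ s s' fun p hp => hE p (Or.inr hp))
  | ex x φ ih =>
    exact ⟨fun ⟨a, h⟩ => ⟨Classical.arbitrary A', (ih _ _ hE).1 h⟩,
      fun ⟨a, h⟩ => ⟨Classical.arbitrary A, (ih _ _ hE).2 h⟩⟩
  | all x φ ih =>
    exact ⟨fun h a => (ih _ _ hE).1 (h (Classical.arbitrary A)),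
      fun h a => (ih _ _ hE).2 (h (Classical.arbitrary A'))⟩
  | exFun n f φ ih =>
    constructor
    · rintro ⟨g, h⟩
      obtain ⟨g', hgg⟩ := hg n g
      exact ⟨g', (ih _ _ (hupd n f φ E E' g g' hgg hE)).1 h⟩
    · rintro ⟨g', h⟩
      obtain ⟨g, hgg⟩ := hg' n g'
      exact ⟨g, (ih _ _ (hupd n f φ E E' g g' hgg hE)).2 h⟩
  | allFun n f φ ih =>
    constructor
    · intro h g'
      obtain ⟨g, hgg⟩ := hg' n g'
      exact (ih _ _ (hupd n f φ E E' g g' hgg hE)).1 (h g)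
    · intro h g
      obtain ⟨g', hgg⟩ := hg n g
      exact (ih _ _ (hupd n f φ E E' g g' hgg hE)).2 (h g')

namespace TeamFormula

variable {L : FirstOrder.Language.{u, v}}

/-- Finite conjunctions. -/
def bigAnd : List (TeamFormula L) → TeamFormula L
  | [] => all 0 (eq 0 0)
  | φ :: l => and φ (bigAnd l)

theorem sat_bigAnd {A : Type w} [Fintype A] [Nonempty A] [L.Structure A] {c : SplitConvention}
    {D : Finset ℕ} {X : Team D A} (l : List (TeamFormula L)) :
    (bigAnd l).Sat c D X ↔ ∀ φ ∈ l, φ.Sat c D X := by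
  induction l <;> simp_all [bigAnd, Sat]

theorem freeVars_bigAnd {l : List (TeamFormula L)} (h : ∀ φ ∈ l, φ.freeVars = ∅) :
    (bigAnd l).freeVars = ∅ := by
  induction l with
  | nil => simp [bigAnd, freeVars]
  | cons φ l ih =>
    rw [bigAnd, freeVars, h φ (by simp), ih fun ψ hψ => h ψ (by simp [hψ]), Finset.empty_union]

/-- Finite Boolean disjunctions. -/
def bigOr (l : List (TeamFormula L)) : TeamFormula L := bneg (bigAnd (l.map bneg))

theorem sat_bigOr {A : Type w} [Fintype A] [Nonempty A] [L.Structure A] {c : SplitConvention}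
    {D : Finset ℕ} {X : Team D A} (l : List (TeamFormula L)) :
    (bigOr l).Sat c D X ↔ ∃ φ ∈ l, φ.Sat c D X := by
  simp [bigOr, Sat, sat_bigAnd]

theorem freeVars_bigOr {l : List (TeamFormula L)} (h : ∀ φ ∈ l, φ.freeVars = ∅) :
    (bigOr l).freeVars = ∅ := by
  refine freeVars_bigAnd fun φ hφ => ?_
  obtain ⟨ψ, hψ, rfl⟩ := List.mem_map.1 hφ
  exact h ψ hψ

/-- The relation `R` holds in a structure with one element. -/
def holdsRel (R : Σ n, L.Relations n) : TeamFormula L := ex 0 (rel R.2 fun _ => 0)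

theorem freeVars_holdsRel (R : Σ n, L.Relations n) : (holdsRel R).freeVars = ∅ := by
  ext x
  simp only [holdsRel, freeVars, Finset.mem_erase, Finset.mem_image, Finset.notMem_empty, iff_false]
  rintro ⟨h, i, -, rfl⟩
  exact h rfl

theorem sat_holdsRel {A : Type w} [Fintype A] [Nonempty A] [Subsingleton A] [L.Structure A]
    {c : SplitConvention} {D : Finset ℕ} {X : Team D A} (hX : IsDistribution X)
    (R : Σ n, L.Relations n) : (holdsRel R).Sat c D X ↔
      ∀ a : Fin R.1 → A, FirstOrder.Language.Structure.RelMap R.2 a := by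
  constructor
  · rintro ⟨F, hF, h⟩ a
    obtain ⟨s, hs⟩ := (hX.supplement 0 hF).exists_ne_zero
    rw [Subsingleton.elim a fun i => s.val 0]
    exact h s hs
  · intro h
    exact ⟨fun _ _ => 1 / (Fintype.card A : ℝ), fun _ => isDistribution_uniform,
      fun s _ => h _⟩

/-- The relations that hold in a structure with one element are those in `T`. -/
noncomputable def hasType [Finite (Σ n, L.Relations n)] (T : Finset (Σ n, L.Relations n)) :
    TeamFormula L :=
  letI := Fintype.ofFinite (Σ n, L.Relations n)
  bigAnd ((Finset.univ : Finset (Σ n, L.Relations n)).toList.map fun R =>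
    if R ∈ T then holdsRel R else bneg (holdsRel R))

theorem freeVars_hasType [Finite (Σ n, L.Relations n)] (T : Finset (Σ n, L.Relations n)) :
    (hasType T).freeVars = ∅ := by
  refine freeVars_bigAnd fun φ hφ => ?_
  obtain ⟨R, -, rfl⟩ := List.mem_map.1 hφ
  split_ifs
  · exact freeVars_holdsRel R
  · exact freeVars_holdsRel R

theorem sat_hasType [Finite (Σ n, L.Relations n)] {A : Type w} [Fintype A] [Nonempty A]
    [Subsingleton A] [L.Structure A] {c : SplitConvention} {D : Finset ℕ} {X : Team D A}
    (hX : IsDistribution X) (T : Finset (Σ n, L.Relations n)) : (hasType T).Sat c D X ↔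
      ∀ R : Σ n, L.Relations n, R ∈ T ↔
        ∀ a : Fin R.1 → A, FirstOrder.Language.Structure.RelMap R.2 a := by
  rw [hasType, sat_bigAnd]
  simp only [List.mem_map, Finset.mem_toList, Finset.mem_univ, true_and, forall_exists_index,
    forall_apply_eq_imp_iff]
  refine forall_congr' fun R => ?_
  split_ifs with h
  · rw [sat_holdsRel hX]
    tauto
  · rw [Sat, sat_holdsRel hX]
    tauto

end TeamFormula

/-- Truth of a second-order formula in the structures with one element, for constant functions
with value one, is expressed by a team formula. -/
theorem SOFormula.exists_teamFormula_of_subsingleton {L : FirstOrder.Language.{u, v}}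
    [Finite (Σ n, L.Relations n)] (ψ : SOFormula L) : ∃ φ : TeamFormula L, φ.freeVars = ∅ ∧
      ∀ (c : SplitConvention) (A : Type w) [Fintype A] [Nonempty A] [Subsingleton A]
        [L.Structure A] (D : Finset ℕ) (X : Team D A), IsDistribution X →
        ∀ (E : FunInterp A) (s : ℕ → A), (∀ p ∈ ψ.freeFuns, ∀ a, E p.1 p.2 a = 1) →
          (φ.Sat c D X ↔ ψ.Sat E s) := by
  -- A type is good if `ψ` holds in some one-element structure of this type, and then it holds in
  -- all of them by `SOFormula.sat_congr_of_subsingleton`. The vocabulary is finite, so the good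
  -- types can be listed.
  let Good : Finset (Σ n, L.Relations n) → Prop := fun T =>
    ∃ (A : Type w) (_ : Nonempty A) (_ : Subsingleton A) (_ : L.Structure A) (E : FunInterp A)
      (s : ℕ → A), (∀ R : Σ n, L.Relations n, R ∈ T ↔
        ∀ a : Fin R.1 → A, FirstOrder.Language.Structure.RelMap R.2 a) ∧
        (∀ p ∈ ψ.freeFuns, ∀ a, E p.1 p.2 a = 1) ∧ ψ.Sat E s
  let _ := Fintype.ofFinite (Σ n, L.Relations n)
  refine ⟨.bigOr ((Finset.univ.filter Good).toList.map .hasType), ?_, ?_⟩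
  · refine TeamFormula.freeVars_bigOr fun φ hφ => ?_
    obtain ⟨T, -, rfl⟩ := List.mem_map.1 hφ
    exact TeamFormula.freeVars_hasType T
  · intro c A _ _ _ _ D X hX E s hE
    rw [TeamFormula.sat_bigOr]
    simp only [List.mem_map, Finset.mem_toList, Finset.mem_filter, Finset.mem_univ, true_and,
      exists_exists_and_eq_and, TeamFormula.sat_hasType hX]
    constructor
    · rintro ⟨T, ⟨A', _, _, _, E', s', hT, hE', h⟩, hT'⟩
      refine (ψ.sat_congr_of_subsingleton (fun n R a a' => ?_) s s' fun p hp a a' => ?_).2 h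
      · have h1 := (hT' ⟨n, R⟩).symm.trans (hT ⟨n, R⟩)
        constructor
        · intro h2
          exact h1.1 (fun b => by rwa [Subsingleton.elim b a]) a'
        · intro h2
          exact h1.2 (fun b => by rwa [Subsingleton.elim b a']) a
      · rw [hE p hp, hE' p hp]
    · intro h
      refine ⟨Finset.univ.filter fun R => ∀ a : Fin R.1 → A,
        FirstOrder.Language.Structure.RelMap R.2 a, ⟨A, inferInstance, inferInstance,
        inferInstance, E, s, fun R => by simp, hE, h⟩, fun R => by simp⟩

/-! ### Structures with at least two elements -/

namespace TeamFormula

variable {L : FirstOrder.Language.{u, v}}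

/-- Quantification over two distinct constants. -/
def exDistinct (D : Finset ℕ) (φ : TeamFormula L) : TeamFormula L :=
  exConst (fresh D) <| exConst (fresh (insert (fresh D) D)) <|
    and (neq (fresh D) (fresh (insert (fresh D) D))) φ

theorem freeVars_exDistinct {D : Finset ℕ} {φ : TeamFormula L}
    (h : φ.freeVars ⊆ insert (fresh (insert (fresh D) D)) (insert (fresh D) D)) :
    (exDistinct D φ).freeVars ⊆ D := by
  refine freeVars_exConst (freeVars_exConst (Finset.union_subset ?_ h))
  simp [freeVars, Finset.insert_subset_iff]

/-- Constants with different values can be added precisely if there are two elements; the matrix is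
assumed to have the same truth value for every such pair. -/
theorem sat_exDistinct {A : Type w} [Fintype A] [Nonempty A] [L.Structure A]
    {c : SplitConvention} {D : Finset ℕ} {X : Team D A} (hX : IsDistribution X)
    {φ : TeamFormula L} {P : Prop}
    (hφ : ∀ (a₀ a₁ : A) (X' : Team (insert (fresh (insert (fresh D) D)) (insert (fresh D) D)) A),
      a₀ ≠ a₁ → IsDistribution X' → X'.Extends X →
      (X'.Forces fun s => s (fresh D) = a₀ ∧ s (fresh (insert (fresh D) D)) = a₁) →
      (φ.Sat c _ X' ↔ P)) :
    (exDistinct D φ).Sat c D X ↔ Nontrivial A ∧ P := by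
  have hz := Finset.mem_insert_self (fresh D) D
  rw [exDistinct, sat_exConst hX (fresh_notMem D)]
  constructor
  · rintro ⟨a₀, X₁, hX₁, hE₁, h₀, h⟩
    rw [sat_exConst hX₁ (fresh_notMem _)] at h
    obtain ⟨a₁, X₂, hX₂, hE₂, h₁, hne, h⟩ := h
    have h₀' := (hE₂.forces_iff hX₂ hX₁ (dependsOn_eq hz a₀)).2 h₀
    have ha : a₀ ≠ a₁ := by
      obtain ⟨s, hs⟩ := hX₂.exists_ne_zero
      have h3 := hne s hs
      rwa [h₀' s hs, h₁ s hs] at h3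
    exact ⟨⟨a₀, a₁, ha⟩, (hφ a₀ a₁ X₂ ha hX₂ (hE₂.trans hE₁) (h₀'.and h₁)).1 h⟩
  · rintro ⟨⟨a₀, a₁, ha⟩, h⟩
    obtain ⟨X₁, hX₁, hE₁, h₀⟩ := exists_const_extension hX (fresh_notMem D) a₀
    obtain ⟨X₂, hX₂, hE₂, h₁⟩ := exists_const_extension hX₁ (fresh_notMem _) a₁
    have h₀' := (hE₂.forces_iff hX₂ hX₁ (dependsOn_eq hz a₀)).2 h₀
    refine ⟨a₀, X₁, hX₁, hE₁, h₀, ?_⟩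
    rw [sat_exConst hX₁ (fresh_notMem _)]
    refine ⟨a₁, X₂, hX₂, hE₂, h₁, fun s hs => ?_,
      (hφ a₀ a₁ X₂ ha hX₂ (hE₂.trans hE₁) (h₀'.and h₁)).2 h⟩
    rw [h₀' s hs, h₁ s hs]
    exact ha

end TeamFormula

/-- The block formed by a uniformly distributed variable, a constant, and given variables. -/
def teamBlock {k : ℕ} (x : Fin k → ℕ) (b z : ℕ) : ℕ → ℕ
  | 0 => b
  | 1 => z
  | i + 2 => if h : i < k then x ⟨i, h⟩ else z

/-- A team codes its own weight function, once a uniformly distributed variable is added. -/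
theorem Team.codes_teamBlock {A : Type w} [Fintype A] [Nonempty A] {D D' : Finset ℕ}
    {X : Team D A} {X' : Team D' A} {a₀ a₁ : A} {z b k : ℕ} {x : Fin k → ℕ} (ha : a₀ ≠ a₁)
    (hX' : IsDistribution X') (hE : X'.Extends X) (hD : D = Finset.univ.image x)
    (hinj : Function.Injective x) (hz : X'.Forces fun s => s z = a₀) (hzD : z ∈ D') (hb : b ∉ D')
    {g : (Fin k → A) → ℝ} (hg : ∀ t : Assignment D A, g (fun i => t.val (x i)) = X t) :
    (X'.duplicate b).Codes a₀ a₁ (teamBlock x b z) g := by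
  have hxD : ∀ i, x i ∈ D := fun i => by simp [hD]
  have hargs : ∀ (s : ℕ → A) (a : Fin k → A),
      HasArgs (teamBlock x b z) a s ↔ ∀ i, s (x i) = a i := fun s a => by
    refine forall_congr' fun i => ?_
    simp [teamBlock]
  have hdep : ∀ a : Fin k → A, DependsOn (fun s : ℕ → A => ∀ i, s (x i) = a i) (D : Set ℕ) := by
    intro a s t h
    refine propext (forall_congr' fun i => ?_)
    rw [h (x i) (hxD i)]
  -- The tag consists of the uniform variable `b` and the constant `z`: `b = a₁` marks the
  -- denominator and `b = a₀` the positive part, so both carry the factor `1 / |A|`, which cancels.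
  -- The negative tag would need `z = a₁`.
  have hden : (X'.duplicate b).prob (HasTag a₀ a₁ (teamBlock x b z) .den) =
      1 / Fintype.card A := by
    rw [show HasTag a₀ a₁ (teamBlock x b z) .den = fun s => s z = a₀ ∧ s b = a₁ from
      funext fun s => propext and_comm, Team.prob_duplicate hb (dependsOn_eq hzD _),
      (Team.prob_eq_one_iff hX').2 hz]
  have hneg : ∀ a : Fin k → A, (X'.duplicate b).prob (fun s => HasTag a₀ a₁ (teamBlock x b z) .neg s ∧
      HasArgs (teamBlock x b z) a s) = 0 := by
    intro a
    rw [Team.prob_eq_zero_iff (hX'.duplicate b)]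
    have h1 := ((Team.extends_duplicate hb).forces_iff (hX'.duplicate b) hX'
      (dependsOn_eq hzD a₀)).2 hz
    exact h1.mono fun s hs h => ha (hs.symm.trans h.1.2)
  have hpos : ∀ a : Fin k → A, (X'.duplicate b).prob (fun s => HasTag a₀ a₁ (teamBlock x b z) .pos s ∧
      HasArgs (teamBlock x b z) a s) = g a / Fintype.card A := by
    intro a
    -- Every tuple of arguments comes from an assignment, because `x` has no repetitions.
    obtain ⟨t, ht⟩ : ∃ t : Assignment D A, ∀ i, t.val (x i) = a i := by
      refine ⟨Assignment.ofFun D (Function.extend x a fun _ => Classical.arbitrary A),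
        fun i => ?_⟩
      rw [Assignment.val_ofFun (hxD i), hinj.extend_apply]
    have h1 : (fun s : ℕ → A => ∀ i, s (x i) = a i) = AgreeOn D t.val := by
      funext s
      refine propext ⟨fun h y hy => ?_, fun h i => (h _ (hxD i)).trans (ht i)⟩
      rw [hD, Finset.mem_image] at hy
      obtain ⟨i, -, rfl⟩ := hy
      rw [h, ht]
    have h2 : X'.prob (fun s => s z = a₀ ∧ ∀ i, s (x i) = a i) = g a := by
      rw [Team.prob_congr (q := fun s => ∀ i, s (x i) = a i)
        (hz.mono fun s hs => and_iff_right hs), hE.2 _ (hdep a), h1, Team.prob_agreeOn_self, ← hg,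
        funext ht]
    rw [← h2, ← Team.prob_duplicate hb ((dependsOn_eq hzD a₀).and ((hdep a).mono_finset hE.1)) a₀]
    congr 1
    funext s
    rw [hargs]
    exact propext ⟨fun h => ⟨⟨h.1.2, h.2⟩, h.1.1⟩, fun h => ⟨⟨h.2, h.1.1⟩, h.1.2⟩⟩
  refine ⟨?_, fun a => ?_⟩
  · rw [hden]
    positivity
  · rw [hden, hpos, hneg]
    ring

/-- With two elements, distinct constants and a uniform variable are added, and
`SOFormula.sat_toTeam` applies with the team's own block. One-element structures are covered by the
list of types. The link between `E` and `X` is required only if `f` occurs free, so that sentences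
are an instance. -/
theorem exists_teamFormula_of_formula {L : FirstOrder.Language.{u, v}}
    [Finite (Σ n, L.Relations n)] (c : SplitConvention) {k : ℕ} (x : Fin k ↪ ℕ) (f : ℕ)
    (ψ : SOFormula L) (hψ : ψ.freeVars = ∅) (hf : ψ.freeFuns ⊆ {(k, f)}) :
    ∃ φ : TeamFormula L, φ.freeVars ⊆ Finset.univ.map x ∧
      ∀ (A : Type w) [Fintype A] [Nonempty A] [L.Structure A] (X : Team (Finset.univ.map x) A),
        IsDistribution X → ∀ (E : FunInterp A) (s : ℕ → A), ((k, f) ∈ ψ.freeFuns →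
        ∀ t : Assignment (Finset.univ.map x) A, E k f (fun i => t.val (x i)) = X t) →
        (φ.Sat c (Finset.univ.map x) X ↔ ψ.Sat E s) := by
  obtain ⟨θ, hθ, hθs⟩ := ψ.exists_teamFormula_of_subsingleton.{u, v, w}
  set D := Finset.univ.map x with hD
  let z₀ := fresh D
  let z₁ := fresh (insert z₀ D)
  let D₁ := insert z₁ (insert z₀ D)
  -- Only `(k, f)` can occur free, so every name may be given the same block; its padding by `z₀`
  -- keeps blocks of other arities among the available variables. All first-order variables are
  -- mapped to `z₀` for the same reason.
  let σ : ℕ → ℕ → ℕ → ℕ := fun _ _ => teamBlock x (fresh D₁) z₀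
  have hz₀ : z₀ ∈ D₁ := by simp [D₁]
  have hz₁ : z₁ ∈ D₁ := by simp [D₁]
  have hDD : D ⊆ D₁ := (Finset.subset_insert _ _).trans (Finset.subset_insert _ _)
  have hn : Names (insert (fresh D₁) D₁) z₀ z₁ (fun _ => z₀) σ := by
    refine ⟨Finset.mem_insert_of_mem hz₀, Finset.mem_insert_of_mem hz₁,
      fun _ => Finset.mem_insert_of_mem hz₀, fun n g y hy => ?_⟩
    obtain ⟨i, -, rfl⟩ := Finset.mem_image.1 hy
    rcases i with _ | _ | i
    · simp [σ, teamBlock]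
    · simp [σ, teamBlock, hz₀]
    · simp only [σ, teamBlock]
      split_ifs
      · exact Finset.mem_insert_of_mem (hDD (by simp [hD]))
      · exact Finset.mem_insert_of_mem hz₀
  -- The second disjunct takes over exactly if there are no two distinct elements.
  refine ⟨.bor (.exDistinct D (.all (fresh D₁) (ψ.toTeam z₀ z₁ (insert (fresh D₁) D₁) (fun _ => z₀) σ)))
    (.and (.bneg (.exDistinct D (.all 0 (.eq 0 0)))) θ), ?_, ?_⟩
  · rw [TeamFormula.freeVars_bor]
    refine Finset.union_subset (TeamFormula.freeVars_exDistinct ?_)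
      (Finset.union_subset (TeamFormula.freeVars_exDistinct ?_) ?_)
    · exact Finset.subset_insert_iff.1 (ψ.freeVars_toTeam hn)
    · simp [TeamFormula.freeVars]
    · simp [hθ]
  · intro A _ _ _ X hX E s hE
    rw [TeamFormula.sat_bor, TeamFormula.Sat, TeamFormula.Sat,
      TeamFormula.sat_exDistinct hX (φ := .all 0 (.eq 0 0)) (P := True) (by simp [TeamFormula.Sat]),
      TeamFormula.sat_exDistinct hX (P := ψ.Sat E s)]
    · by_cases hA : Nontrivial A
      · simp [hA]
      · have : Subsingleton A := not_nontrivial_iff_subsingleton.1 hA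
        rw [hθs c A D X hX E s]
        · simp [hA]
        · intro p hp a
          have hp' := Finset.mem_singleton.1 (hf hp)
          subst hp'
          -- Over one element there is a single assignment, which carries the whole weight one.
          rw [Subsingleton.elim a fun i => (Classical.arbitrary (Assignment D A)).val (x i),
            hE hp, ← hX.2, Fintype.sum_subsingleton]
    · intro a₀ a₁ X' ha hX' hEx hz
      refine ψ.sat_toTeam ha (hX'.duplicate (fresh D₁)) hn ⟨?_, by simp [hψ], fun p hp => ?_⟩
      · exact ((Team.extends_duplicate (fresh_notMem D₁)).forces_iff (hX'.duplicate _) hX'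
          ((dependsOn_eq hz₀ a₀).and (dependsOn_eq hz₁ a₁))).2 hz
      · have hp' := Finset.mem_singleton.1 (hf hp)
        subst hp'
        exact Team.codes_teamBlock ha hX' hEx (by rw [hD, Finset.map_eq_image]) x.injective
          (hz.mono fun _ h => h.1) hz₀ (fresh_notMem D₁) (hE hp)

/-- A sentence is the case of no variables, applied to the trivial team; the name `0` of the
function is immaterial, as no function variable is free. -/
theorem exists_teamFormula_of_sentence {L : FirstOrder.Language.{u, v}}
    [Finite (Σ n, L.Relations n)] (c : SplitConvention) (ψ : SOFormula L) (hψ : ψ.freeVars = ∅)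
    (hf : ψ.freeFuns = ∅) :
    ∃ φ : TeamFormula L, φ.freeVars = ∅ ∧ EquivSentences.{u, v, w} c φ ψ := by
  obtain ⟨φ, h1, h2⟩ := exists_teamFormula_of_formula.{u, v, w} c
    (Function.Embedding.ofIsEmpty : Fin 0 ↪ ℕ) 0 ψ hψ (by simp [hf])
  exact ⟨φ, Finset.subset_empty.1 h1, fun A _ _ _ E s =>
    h2 A (Team.trivial A) (isDistribution_trivial A) E s (by simp [hf])⟩

end ProbTeam

theorem mainTheorem1 (L : FirstOrder.Language.{u, v}) [L.IsRelational]
    [Finite (Σ n, L.Relations n)] (c : ProbTeam.SplitConvention) :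
    -- every team sentence is equivalent to a second-order sentence
    (∀ φ : ProbTeam.TeamFormula L, φ.freeVars = ∅ →
      ∃ ψ : ProbTeam.SOFormula L, ψ.freeVars = ∅ ∧ ψ.freeFuns = ∅ ∧
        ProbTeam.EquivSentences.{u, v, w} c φ ψ) ∧
    -- and conversely
    (∀ ψ : ProbTeam.SOFormula L, ψ.freeVars = ∅ → ψ.freeFuns = ∅ →
      ∃ φ : ProbTeam.TeamFormula L, φ.freeVars = ∅ ∧
        ProbTeam.EquivSentences.{u, v, w} c φ ψ) ∧
    -- every team formula is equivalent to a second-order formula about the team's distribution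
    (∀ (k : ℕ) (x : Fin k ↪ ℕ) (f : ℕ) (φ : ProbTeam.TeamFormula L),
      φ.freeVars ⊆ Finset.univ.map x →
      ∃ ψ : ProbTeam.SOFormula L, ψ.freeVars = ∅ ∧ ψ.freeFuns = {(k, f)} ∧
        ProbTeam.EquivFormulas.{u, v, w} c x f φ ψ) ∧
    -- and conversely
    (∀ (k : ℕ) (x : Fin k ↪ ℕ) (f : ℕ) (ψ : ProbTeam.SOFormula L),
      ψ.freeVars = ∅ → ψ.freeFuns ⊆ {(k, f)} →
      ∃ φ : ProbTeam.TeamFormula L, φ.freeVars ⊆ Finset.univ.map x ∧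
        ProbTeam.EquivFormulas.{u, v, w} c x f φ ψ) := by
  refine ⟨ProbTeam.exists_soFormula_of_sentence c, ProbTeam.exists_teamFormula_of_sentence c,
    fun k x f => ProbTeam.exists_soFormula_of_formula c x f, fun k x f ψ hψ hf => ?_⟩
  obtain ⟨φ, h1, h2⟩ := ProbTeam.exists_teamFormula_of_formula.{u, v, w} c x f ψ hψ hf
  exact ⟨φ, h1, fun A _ _ _ X hX E s h => h2 A X hX E s fun _ => h⟩
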